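/- **Setting.** For each $n\ge 1$ let $\omega_1,\dots,\omega_n>0$ (depending on $n$), and put $\rho=1/\sum_i\omega_i$, $\omega_{\rm avg}=\frac1n\sum_i\omega_i$, $\omega_{\min}=\min_i\omega_i$, $\omega_{\max}=\max_i\omega_i$; assume $\omega_{\max}^2\le 1/\rho$. Let $p_W$ (which may depend on $n$) be a probability law on $(0,1]$ and write $E[W^m]$ for its $m$-th moment. The random weighted network $G$ on the nodes $1,\dots,n$ is defined as follows: independently for all unordered pairs $\{i,j\}$ (with $i=j$ allowed), the link $(i,j)$ exists with probability $p_{ij}=\rho\,\omega_i\omega_j$ and then carries a weight $w(i,j)$ drawn from $p_W$. Let $A$ be the weighted adjacency matrix ($A(i,j)=w(i,j)$ if the link exists and $0$ otherwise), $d_i=\sum_jA(i,j)$, $D=\mathrm{diag}(d_i)$, and let $N=I-D^{-1/2}AD^{-1/2}$ be the normalized Laplacian (with $0^{-1/2}:=0$), with eigenvalues $\lambda_1\le\lambda_2\le\dots\le\lambda_n$. Let $$f^{(n)}_\Lambda=\mathbb E\Big[\frac1{n-1}\sum_{l=2}^n\delta_{\lambda_l}\Big]$$ be the expected eigenvalue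 distribution without the trivial eigenvalue, $r=\max_{2\le l\le n}|1-\lambda_l|$ the spectral radius, and $$\tilde r=\frac{2}{\sqrt{\omega_{\rm avg}}}\,\frac{\sqrt{E[W^2]}}{E[W]} .$$ **Theorem (Wigner's semicircle law for the weighted network $G$).** Assume that, as $n\to\infty$, $\omega_{\min}\to\infty$, $\omega_{\rm avg}/n\to0$, and $$\omega_{\min}^2\gg\frac{\omega_{\rm avg}}{E[W^2]},\qquad\text{i.e.}\qquad \frac{\omega_{\rm avg}}{E[W^2]\,\omega_{\min}^2}\to0 .$$ 1. $f^{(n)}_\Lambda$ converges to the semicircle law with centre $1$ and radius $\tilde r$, on the scale of $\tilde r$: if $\Lambda$ has law $f_\Lambda^{(n)}$, the law of $(\Lambda-1)/\tilde r$ converges weakly, as $n\to\infty$, to the semicircle law with centre $0$ and radius $1$, where the semicircle law with centre $c$ and radius $s$ has density $\frac{2}{\pi s^2}\sqrt{s^2-(c-x)^2}$ for $c-s<x<c+s$ and $0$ otherwise. 2. If moreover $\omega_{\min}^2\ge c\,(\log n)^6\,\omega_{\rm avg}/E[W^2]$ for some constant $c>0$ and all large $n$, then $\tilde r$ is the limit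 value of the spectral radius: $r/\tilde r\to1$ in probability as $n\to\infty$. -/

import Mathlib

open Filter Topology MeasureTheory Asymptotics

noncomputable section

namespace WeightedChungLu

/-! ### Expected degrees -/

/-- `ρ = 1 / ∑ ω i`. -/
def rho {n : ℕ} (ω : Fin n → ℝ) : ℝ := 1 / ∑ i, ω i

/-- The average `ω_avg`. -/
def avg {n : ℕ} (ω : Fin n → ℝ) : ℝ := (∑ i, ω i) / n

/-- The minimum `ω_min`. -/
def wmin {n : ℕ} (ω : Fin n → ℝ) : ℝ := ⨅ i, ω i

/-- The maximum `ω_max`. -/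
def wmax {n : ℕ} (ω : Fin n → ℝ) : ℝ := ⨆ i, ω i

/-- The `m`-th moment `E[W ^ m]` of the weight of an existing link, where `ν` is the law of `W`. -/
def moment (ν : Measure ℝ) (m : ℕ) : ℝ := ∫ x, x ^ m ∂ν

/-! ### The random weighted network -/

/-- The probability `p_ij = ρ ω_i ω_j` that the link `{i, j}` exists (`i = j` is allowed). -/
def linkProb {n : ℕ} (ω : Fin n → ℝ) : Sym2 (Fin n) → ℝ :=
  Sym2.lift ⟨fun i j => rho ω * ω i * ω j, fun i j => by ring⟩

/-- The law of the weight carried by an unordered pair `e`: with probability `p_e` the link exists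
and its weight is drawn from `ν`, otherwise the weight is `0`. -/
def linkLaw {n : ℕ} (ω : Fin n → ℝ) (ν : Measure ℝ) (e : Sym2 (Fin n)) : Measure ℝ :=
  ENNReal.ofReal (linkProb ω e) • ν + ENNReal.ofReal (1 - linkProb ω e) • Measure.dirac 0

/-- The law of the whole random weighted network: the weights of the unordered pairs are
independent. A weighted network on `n` nodes is a function `w : Sym2 (Fin n) → ℝ`, with
`w s(i, j)` the weight of the link `(i, j)`, and `0` when there is no such link. -/
def networkLaw {n : ℕ} (ω : Fin n → ℝ) (ν : Measure ℝ) : Measure (Sym2 (Fin n) → ℝ) :=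
  Measure.pi fun e => linkLaw ω ν e

/-! ### The normalized Laplacian and its spectrum -/

/-- The weighted adjacency matrix `A`. -/
def adj {n : ℕ} (w : Sym2 (Fin n) → ℝ) : Matrix (Fin n) (Fin n) ℝ :=
  Matrix.of fun i j => w s(i, j)

/-- The weighted degree `d_i`. -/
def deg {n : ℕ} (w : Sym2 (Fin n) → ℝ) (i : Fin n) : ℝ := ∑ j, adj w i j

/-- The diagonal matrix `D^(-1/2)`; the entry at a node of degree `0` is `0`. -/
def invSqrtDeg {n : ℕ} (w : Sym2 (Fin n) → ℝ) : Matrix (Fin n) (Fin n) ℝ :=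
  Matrix.diagonal fun i => (√(deg w i))⁻¹

/-- The normalized Laplacian `N = I - D^(-1/2) A D^(-1/2)`. -/
def normLap {n : ℕ} (w : Sym2 (Fin n) → ℝ) : Matrix (Fin n) (Fin n) ℝ :=
  1 - invSqrtDeg w * adj w * invSqrtDeg w

theorem normLap_isHermitian {n : ℕ} (w : Sym2 (Fin n) → ℝ) : (normLap w).IsHermitian := by
  ext i j
  simp [normLap, invSqrtDeg, adj, Matrix.one_apply, Sym2.eq_swap (a := j) (b := i),
    eq_comm (a := j) (b := i)]
  ring

/-- The eigenvalues of the normalized Laplacian with multiplicity, in ascending order;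
`eig w 0` is the smallest one (Mathlib's `eigenvalues₀` is in descending order). -/
def eig {n : ℕ} (w : Sym2 (Fin n) → ℝ) (l : Fin n) : ℝ :=
  (normLap_isHermitian w).eigenvalues₀ (Fin.cast (Fintype.card_fin n).symm l.rev)

/-- The empirical eigenvalue distribution `(1 / (n - 1)) ∑_{l ≥ 2} δ_{λ_l}`, without the smallest
(trivial) eigenvalue. -/
def empiricalLaw {n : ℕ} (w : Sym2 (Fin n) → ℝ) : Measure ℝ :=
  ((n - 1 : ℕ) : ENNReal)⁻¹ • ∑ l : Fin n with 0 < l.val, Measure.dirac (eig w l)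

/-- The expected empirical eigenvalue distribution: the average of `empiricalLaw w` over the
random network `w`. -/
def eigenvalueLaw {n : ℕ} (ω : Fin n → ℝ) (ν : Measure ℝ) : Measure ℝ :=
  (networkLaw ω ν).bind empiricalLaw

/-- The spectral radius `r = max_{l ≥ 2} |1 - λ_l|`. -/
def specRadius {n : ℕ} (w : Sym2 (Fin n) → ℝ) : ℝ :=
  ⨆ l : {l : Fin n // 0 < l.val}, |1 - eig w l|

/-! ### The semicircle law -/

/-- The density of the semicircle law with centre `c` and radius `r`. -/
def semicircleDensity (c r x : ℝ) : ℝ :=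
  if c - r < x ∧ x < c + r then 2 / (Real.pi * r ^ 2) * √(r ^ 2 - (c - x) ^ 2) else 0

/-- The semicircle law with centre `c` and radius `r`. -/
def semicircleLaw (c r : ℝ) : Measure ℝ :=
  volume.withDensity fun x => ENNReal.ofReal (semicircleDensity c r x)

/-- The radius `r̃ = (2 / √ω_avg) * √E[W ^ 2] / E[W]`. -/
def limitRadius {n : ℕ} (ω : Fin n → ℝ) (ν : Measure ℝ) : ℝ :=
  2 / √(avg ω) * (√(moment ν 2) / moment ν 1)

end WeightedChungLu

end

/-! Let X be the symmetric matrix with entries `centredWeight`. They are independent over unordered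
pairs, centred, of variance at most 1/(4n) with a mean relative deficit of order ω_avg/n, and
bounded by √κ/2, where κ = `sparsity` tends to 0. By the exact identity `IsModel.scaledLap_apply`,
(N - I)/r̃ = T X T - c u uᵀ, where T is the diagonal matrix of the (d_i / E d_i)^(-1/2) and c ≥ 0.
So up to a diagonal factor close to I and a rank one term, which accounts for the trivial
eigenvalue, the matrix is of Wigner type.

Bulk. For a fixed z in the upper half plane, the trace of (X - z)R = I expresses z s + 1 by the sums
of x_ij R_ji, where s is the Stieltjes transform. Expanding to first order in each entry, which is
independent of the others, shows that s²/4 + z s + 1 tends to 0 in L²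
(`integral_norm_defect_sq_le`). Passing from X to (N - I)/r̃ is harmless: vertices of atypical
degree are few by Chebyshev and cause a perturbation of small rank, and the others one of small
Frobenius norm (`norm_stieltjes_diagonal_mul_sub_le`). The quadratic equation is stable on Im s ≥ 0
(`abs_im_sub_sqrt_le`), and Poisson smoothing converts Im s into linear statistics
(`tendsto_integral_abs_linearStatistic`). As the limit has total mass 1, no mass escapes, and
compactly supported test functions may be replaced by bounded ones.

Edge. A radius below (1 - ε) r̃ would leave a bump function just inside the edge with at most the
trivial eigenvalue to see, against the semicircle law. For the upper bound, the rank one term is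
negative and vanishes on a hyperplane, so it affects only the smallest eigenvalue, and r ≤ r̃ (1 +
τ)² ‖X‖ when all relative degrees are within τ of 1 (`IsModel.specRadius_le`). Chernoff's bound
controls the degrees. The norm is controlled by E tr (2X)^k ≤ n (2 + (k+1)(k+2)√κ)^k
(`integral_trace_pow_adj_le`) with k of order log n. The error k²√κ must vanish, which is where the
power (log n)^6 enters. The trace bound comes from a recursion over walks with a potential function
(`walkSum_le`) instead of an enumeration of their shapes. -/

namespace WeightedChungLu

/-! ### Weighted exploration of walks -/

section Walks

variable {α : Type*} [DecidableEq α]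

/-- The number of edges of `O` at the vertex `v`. -/
def openDeg (O : Finset (Sym2 α)) (v : α) : ℕ := (O.filter (v ∈ ·)).card

theorem openDeg_insert {O : Finset (Sym2 α)} {e : Sym2 α} (he : e ∉ O) (v : α) :
    openDeg (insert e O) v = openDeg O v + if v ∈ e then 1 else 0 := by
  unfold openDeg
  rw [Finset.filter_insert]
  split_ifs with h
  · rw [Finset.card_insert_of_notMem (by simp [he])]
  · simp

theorem openDeg_erase {O : Finset (Sym2 α)} {e : Sym2 α} (he : e ∈ O) (v : α) :
    openDeg (O.erase e) v + (if v ∈ e then 1 else 0) = openDeg O v := by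
  conv_rhs => rw [← Finset.insert_erase he]
  rw [openDeg_insert (by simp)]

variable [Fintype α]

/-- The potential of a set of open edges `O` with a walker at `u`. It is `0` when the open edges
form a path that ends at `u`. -/
def excess (O : Finset (Sym2 α)) (u : α) : ℕ :=
  ∑ v, (openDeg O v - 2) + if 2 ≤ openDeg O u then 1 else 0

/-- The total weight of the walks of `j` steps from `u`, where `S` is the set of vertices visited
so far and `O` the set of open edges. A step to a new vertex has weight `c` and opens its edge, a
step along an open edge has weight `1` and closes it, and any other step has weight `K`. -/
noncomputable def walkSum (c K : ℝ) : ℕ → Finset α → Finset (Sym2 α) → α → ℝ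
  | 0, _, _, _ => 1
  | j + 1, S, O, u => ∑ w,
      if w ∉ S then c * walkSum c K j (insert w S) (insert s(u, w) O) w
      else if s(u, w) ∈ O then walkSum c K j S (O.erase s(u, w)) w
      else K * walkSum c K j S O w

theorem walkSum_nonneg {c K : ℝ} (hc : 0 ≤ c) (hK : 0 ≤ K) (j : ℕ) (S : Finset α)
    (O : Finset (Sym2 α)) (u : α) : 0 ≤ walkSum c K j S O u := by
  induction j generalizing S O u with
  | zero => simp [walkSum]
  | succ j ih =>
    refine Finset.sum_nonneg fun w _ => ?_
    split_ifs
    · exact ih ..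
    · exact mul_nonneg hK (ih ..)
    · exact mul_nonneg hc (ih ..)

theorem sum_eq_add_add_sum {u w : α} (h : u ≠ w) (f : α → ℕ) :
    ∑ v, f v = f u + f w + ∑ v ∈ (Finset.univ.erase u).erase w, f v := by
  rw [← Finset.add_sum_erase _ f (Finset.mem_univ u),
    ← Finset.add_sum_erase _ f (a := w) (by simp [h.symm]), add_assoc]

/-- After the step `w` has exactly one open edge, so it contributes nothing. The truncated degree at
`u` grows only if `u` already had two open edges, and then the indicator that `u` gives up pays for
it. -/
theorem excess_insert_le {O : Finset (Sym2 α)} {u w : α} (h : u ≠ w) (hw : ∀ e ∈ O, w ∉ e) :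
    excess (insert s(u, w) O) w ≤ excess O u := by
  have hO : s(u, w) ∉ O := fun h => hw _ h (by simp)
  have h0 : openDeg O w = 0 := by
    simpa [openDeg, Finset.filter_eq_empty_iff] using hw
  unfold excess
  rw [sum_eq_add_add_sum h, sum_eq_add_add_sum h (fun v => openDeg O v - 2)]
  have : ∑ v ∈ (Finset.univ.erase u).erase w, (openDeg (insert s(u, w) O) v - 2) =
      ∑ v ∈ (Finset.univ.erase u).erase w, (openDeg O v - 2) := by
    refine Finset.sum_congr rfl fun v hv => ?_
    simp only [Finset.mem_erase] at hv
    simp [openDeg_insert hO, hv.1, hv.2.1]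
  rw [this]
  simp only [openDeg_insert hO, h0]
  simp only [Sym2.mem_iff, true_or, or_true, if_true]
  split_ifs <;> omega

/-- If `w` keeps two open edges, its truncated degree has dropped by one, which pays for the
indicator it receives. The strict drop when `u` has a choice of edges to close is what pays for that
choice in `walkSum_le`. -/
theorem excess_erase_le {O : Finset (Sym2 α)} {u w : α} (h : u ≠ w) (hO : s(u, w) ∈ O) :
    excess (O.erase s(u, w)) w + (if 2 ≤ openDeg O u then 1 else 0) ≤ excess O u := by
  unfold excess
  rw [sum_eq_add_add_sum h, sum_eq_add_add_sum h (fun v => openDeg O v - 2)]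
  have : ∑ v ∈ (Finset.univ.erase u).erase w, (openDeg (O.erase s(u, w)) v - 2) =
      ∑ v ∈ (Finset.univ.erase u).erase w, (openDeg O v - 2) := by
    refine Finset.sum_congr rfl fun v hv => ?_
    simp only [Finset.mem_erase] at hv
    have := openDeg_erase hO v
    simp only [Sym2.mem_iff, hv.1, hv.2.1, or_self, if_false] at this
    omega
  rw [this]
  have hu := openDeg_erase hO u
  have hw := openDeg_erase hO w
  simp only [Sym2.mem_iff, true_or, or_true, if_true] at hu hw
  split_ifs <;> omega

theorem excess_le_add_one (O : Finset (Sym2 α)) (u w : α) : excess O w ≤ excess O u + 1 := by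
  unfold excess
  split_ifs <;> omega

theorem openDeg_le_excess (O : Finset (Sym2 α)) (u : α) (h : 2 ≤ openDeg O u) :
    openDeg O u ≤ excess O u + 1 := by
  have := Finset.single_le_sum (f := fun v => openDeg O v - 2) (fun _ _ => Nat.zero_le _)
    (Finset.mem_univ u)
  simp only [excess, h, if_true]
  omega

theorem card_filter_mk_mem_le (O : Finset (Sym2 α)) (u : α) :
    (Finset.univ.filter fun w => s(u, w) ∈ O).card ≤ openDeg O u := by
  refine Finset.card_le_card_of_injOn (fun w => s(u, w)) (fun w hw => ?_) ?_
  · simpa using hw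
  · intro a _ b _ hab
    exact Sym2.congr_right.1 hab

/-- A potential argument, with a factor M + 1 per unit of `excess`. Per step, new vertices
contribute at most 1 in total because n c ≤ 1. Closing steps contribute at most 1, since a real
choice lowers the excess. The at most M remaining steps have weight K and raise the excess by at
most one. The number M bounds both the visited vertices and the excess over the whole walk. -/
theorem walkSum_le {c K : ℝ} (hc : 0 ≤ c) (hK : 0 ≤ K) (hN : Fintype.card α * c ≤ 1) (M j : ℕ)
    (S : Finset α) (O : Finset (Sym2 α)) (u : α) (hu : u ∈ S) (hOS : ∀ e ∈ O, ∀ v ∈ e, v ∈ S)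
    (hO : ∀ e ∈ O, ¬ e.IsDiag) (hS : S.card + j ≤ M) (hE : excess O u + j ≤ M) :
    walkSum c K j S O u ≤ (2 + M * K * (M + 1)) ^ j * ((M : ℝ) + 1) ^ excess O u := by
  induction j generalizing S O u with
  | zero =>
    simp only [walkSum, pow_zero, one_mul]
    exact one_le_pow₀ (by simp)
  | succ j ih =>
    set a : ℝ := (M : ℝ) + 1 with ha
    set L : ℝ := 2 + M * K * a with hL
    have ha1 : 1 ≤ a := by simp [ha]
    have hL0 : 0 ≤ L := by positivity
    have key : ∀ w, (if w ∉ S then c * walkSum c K j (insert w S) (insert s(u, w) O) w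
        else if s(u, w) ∈ O then walkSum c K j S (O.erase s(u, w)) w
        else K * walkSum c K j S O w) ≤ c * (L ^ j * a ^ excess O u)
          + (if s(u, w) ∈ O then (if 2 ≤ openDeg O u then L ^ j * a ^ (excess O u - 1)
              else L ^ j * a ^ excess O u) else 0)
          + (if w ∈ S then K * (L ^ j * a ^ (excess O u + 1)) else 0) := by
      intro w
      have n1 : 0 ≤ c * (L ^ j * a ^ excess O u) := by positivity
      have n3 : 0 ≤ K * (L ^ j * a ^ (excess O u + 1)) := by positivity
      by_cases hw : w ∈ S
      · simp only [hw, not_true, if_false, if_true]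
        by_cases he : s(u, w) ∈ O
        · have hne : u ≠ w := fun h => hO _ he (by simp [h])
          have h1 := excess_erase_le hne he
          simp only [he, if_true]
          have h2 : walkSum c K j S (O.erase s(u, w)) w ≤
              L ^ j * a ^ excess (O.erase s(u, w)) w := by
            refine ih S _ w hw (fun e he => hOS e (Finset.mem_of_mem_erase he))
              (fun e he => hO e (Finset.mem_of_mem_erase he)) (by omega) ?_
            split_ifs at h1 <;> omega
          split_ifs with hd
          · rw [if_pos hd] at h1
            have : L ^ j * a ^ excess (O.erase s(u, w)) w ≤ L ^ j * a ^ (excess O u - 1) := by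
              gcongr
              omega
            linarith
          · rw [if_neg hd] at h1
            have : L ^ j * a ^ excess (O.erase s(u, w)) w ≤ L ^ j * a ^ (excess O u) := by
              gcongr
              omega
            linarith
        · simp only [he, if_false]
          have h1 := excess_le_add_one O u w
          have h2 := ih S O w hw hOS hO (by omega) (by omega)
          have h3 : walkSum c K j S O w ≤ L ^ j * a ^ (excess O u + 1) :=
            h2.trans (by gcongr)
          have := mul_le_mul_of_nonneg_left h3 hK
          linarith
      · have hne : u ≠ w := fun h => hw (h ▸ hu)
        have he : s(u, w) ∉ O := fun h => hw (hOS _ h w (by simp))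
        simp only [hw, not_false_eq_true, if_true, he, if_false, add_zero]
        have h1 := excess_insert_le hne (O := O) (fun e he hwe => hw (hOS e he w hwe))
        have h2 := ih (insert w S) (insert s(u, w) O) w (by simp) (by
            intro e he v hv
            rcases Finset.mem_insert.1 he with rfl | he
            · rcases Sym2.mem_iff.1 hv with rfl | rfl <;> simp [hu]
            · exact Finset.mem_insert_of_mem (hOS e he v hv)) (by
            intro e he
            rcases Finset.mem_insert.1 he with rfl | he
            · simpa using hne
            · exact hO e he) (by rw [Finset.card_insert_of_notMem hw]; omega) (by omega)
        refine mul_le_mul_of_nonneg_left (h2.trans ?_) hc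
        gcongr
    refine (Finset.sum_le_sum fun w _ => key w).trans ?_
    rw [Finset.sum_add_distrib, Finset.sum_add_distrib, Finset.sum_const, ← Finset.sum_filter,
      ← Finset.sum_filter, Finset.sum_const, Finset.sum_const]
    have hP : 0 ≤ L ^ j * a ^ excess O u := by positivity
    have t1 : (Finset.univ : Finset α).card • (c * (L ^ j * a ^ excess O u)) ≤
        L ^ j * a ^ excess O u := by
      rw [nsmul_eq_mul, ← mul_assoc]
      exact mul_le_of_le_one_left hP hN
    have t2 : (Finset.univ.filter fun w => s(u, w) ∈ O).card •
        (if 2 ≤ openDeg O u then L ^ j * a ^ (excess O u - 1)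
              else L ^ j * a ^ excess O u) ≤ L ^ j * a ^ excess O u := by
      have hcard := card_filter_mk_mem_le O u
      rw [nsmul_eq_mul]
      split_ifs with hd
      · have h1 := openDeg_le_excess O u hd
        have h2 : ((Finset.univ.filter fun w => s(u, w) ∈ O).card : ℝ) ≤ a := by
          rw [ha]; exact_mod_cast (by omega)
        have h3 : 1 ≤ excess O u := by omega
        calc _ ≤ a * (L ^ j * a ^ (excess O u - 1)) := by gcongr
          _ = L ^ j * a ^ (excess O u - 1 + 1) := by ring
          _ = _ := by rw [Nat.sub_add_cancel h3]
      · refine mul_le_of_le_one_left hP ?_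
        exact_mod_cast (by omega)
    have t3 : (Finset.univ.filter fun w => w ∈ S).card • (K * (L ^ j * a ^ (excess O u + 1))) ≤
        (M * K * a) * (L ^ j * a ^ excess O u) := by
      have : ((Finset.univ.filter fun w => w ∈ S).card : ℝ) ≤ M := by
        simp only [Finset.filter_univ_mem]
        exact_mod_cast (by omega)
      rw [nsmul_eq_mul]
      calc _ ≤ (M : ℝ) * (K * (L ^ j * a ^ (excess O u + 1))) := by gcongr
        _ = _ := by ring
    calc _ ≤ L ^ j * a ^ excess O u + L ^ j * a ^ excess O u +
        (M * K * a) * (L ^ j * a ^ excess O u) := by gcongr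
      _ = _ := by rw [hL]; ring

end Walks

/-! ### Moments of random symmetric matrices -/

/-- The bound for `E x ^ m`, where `x` is a centred variable with `E x ^ 2 ≤ c` and `|x| ≤ K`;
it is relaxed to `K` for `m = 1`. -/
def momentBound (c K : ℝ) : ℕ → ℝ
  | 0 => 1
  | 1 => K
  | m + 2 => c * K ^ m

theorem momentBound_nonneg {c K : ℝ} (hc : 0 ≤ c) (hK : 0 ≤ K) (m : ℕ) :
    0 ≤ momentBound c K m := by
  match m with
  | 0 => simp [momentBound]
  | 1 => simpa [momentBound]
  | m + 2 => simp only [momentBound]; positivity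

/-- The passage from exponent 1 to 2 is the only one that needs `c ≤ K ^ 2`; the relaxed value at 1
makes the first passage of an edge cost K. -/
theorem momentBound_succ_le {c K : ℝ} (hcK : c ≤ K ^ 2) (m : ℕ) :
    momentBound c K (m + 1) ≤ K * momentBound c K m := by
  match m with
  | 0 => simp [momentBound]
  | 1 => simpa [momentBound, sq] using hcK
  | m + 2 => simp only [momentBound, pow_succ]; linarith

theorem abs_integral_pow_le_momentBound {c K : ℝ} (hK : 0 ≤ K) (μ : Measure ℝ)
    [IsProbabilityMeasure μ] (h0 : ∫ x, x ∂μ = 0) (h2 : ∫ x, x ^ 2 ∂μ ≤ c)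
    (hb : ∀ᵐ x ∂μ, |x| ≤ K) (m : ℕ) :
    |∫ x, x ^ m ∂μ| ≤ momentBound c K m := by
  have hi : ∀ m : ℕ, Integrable (fun x : ℝ => x ^ m) μ := fun m =>
    Integrable.of_bound (by fun_prop) (K ^ m) (hb.mono fun x hx => by
      rw [norm_pow]; exact pow_le_pow_left₀ (norm_nonneg _) hx _)
  match m with
  | 0 => simp [momentBound]
  | 1 => simpa [momentBound, h0]
  | m + 2 =>
    simp only [momentBound]
    calc |∫ x, x ^ (m + 2) ∂μ| ≤ ∫ x, |x ^ (m + 2)| ∂μ := abs_integral_le_integral_abs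
      _ ≤ ∫ x, x ^ 2 * K ^ m ∂μ := by
        refine integral_mono_ae (hi _).abs ((hi 2).mul_const _) (hb.mono fun x hx => ?_)
        simp only
        rw [add_comm, pow_add, abs_mul, abs_of_nonneg (sq_nonneg x), abs_pow]
        gcongr
      _ = (∫ x, x ^ 2 ∂μ) * K ^ m := integral_mul_const ..
      _ ≤ _ := by gcongr

section Moments

variable {n : ℕ} {c K : ℝ} (μ : Sym2 (Fin n) → Measure ℝ) [∀ e, IsProbabilityMeasure (μ e)]

theorem ae_abs_le_of_pi (hb : ∀ e, ∀ᵐ x ∂μ e, |x| ≤ K) :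
    ∀ᵐ x ∂Measure.pi μ, ∀ e, |x e| ≤ K :=
  ae_all_iff.2 fun e => (Measure.quasiMeasurePreserving_eval μ e).ae (hb e)

theorem continuous_adj : Continuous (adj : (Sym2 (Fin n) → ℝ) → Matrix (Fin n) (Fin n) ℝ) := by
  unfold adj
  fun_prop

theorem integrable_of_continuous_of_pi (hb : ∀ e, ∀ᵐ x ∂μ e, |x| ≤ K)
    {E : Type*} [NormedAddCommGroup E] [SecondCountableTopology E]
    {F : (Sym2 (Fin n) → ℝ) → E} (hF : Continuous F) : Integrable F (Measure.pi μ) := by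
  have hc : IsCompact (Set.univ.pi fun _ : Sym2 (Fin n) => Set.Icc (-K) K) :=
    isCompact_univ_pi fun _ => isCompact_Icc
  obtain ⟨C, hC⟩ := hc.exists_bound_of_continuousOn hF.continuousOn
  refine Integrable.of_bound hF.aestronglyMeasurable C ((ae_abs_le_of_pi μ hb).mono fun x hx => ?_)
  exact hC x fun e _ => abs_le.1 (hx e)

/-- The recursion expands one step of the walk at a time and mirrors `walkSum`. An edge that leads
to a new vertex is charged c at once, in advance of its second traversal. The closing step is then
free, because exponent 2 is also worth c. Any other traversal costs at most K. That the walk ends at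
`v` is not exploited. -/
theorem abs_integral_prod_mul_pow_adj_le (hc : 0 ≤ c) (hK : 0 ≤ K) (hcK : c ≤ K ^ 2)
    (h0 : ∀ e, ∫ x, x ∂μ e = 0) (h2 : ∀ e, ∫ x, x ^ 2 ∂μ e ≤ c)
    (hb : ∀ e, ∀ᵐ x ∂μ e, |x| ≤ K) (j : ℕ) (m : Sym2 (Fin n) → ℕ) (S : Finset (Fin n))
    (O : Finset (Sym2 (Fin n))) (u v : Fin n) (hu : u ∈ S) (hO : ∀ e ∈ O, m e = 1)
    (hS : ∀ e, (∃ v ∈ e, v ∉ S) → m e = 0) :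
    |∫ x, (∏ e, x e ^ m e) * (adj x ^ j) u v ∂Measure.pi μ| ≤
      (∏ e, if e ∈ O then c else momentBound c K (m e)) * walkSum c K j S O u := by
  have hMB := momentBound_nonneg hc hK
  have hprod : ∀ (m : Sym2 (Fin n) → ℕ) (O : Finset (Sym2 (Fin n))),
      0 ≤ ∏ e, if e ∈ O then c else momentBound c K (m e) := fun m O =>
    Finset.prod_nonneg fun e _ => by
      split_ifs
      · exact hc
      · exact hMB _
  induction j generalizing m S O u with
  | zero =>
    have h1 : |∫ x, (∏ e, x e ^ m e) ∂Measure.pi μ| ≤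
        ∏ e, if e ∈ O then c else momentBound c K (m e) := by
      rw [integral_fintype_prod_eq_prod (fun e (y : ℝ) => y ^ m e), Finset.abs_prod]
      refine Finset.prod_le_prod (fun _ _ => abs_nonneg _) fun e _ => ?_
      split_ifs with he
      -- An edge that is never closed has exponent 1, so its factor is a mean and vanishes.
      · simpa [hO e he, h0] using hc
      · exact abs_integral_pow_le_momentBound hK _ (h0 e) (h2 e) (hb e) _
    simp only [pow_zero, walkSum, mul_one, Matrix.one_apply, mul_ite, mul_zero]
    split_ifs
    · exact h1
    · simpa using hprod m O
  | succ j ih =>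
    have hexp : ∀ x : Sym2 (Fin n) → ℝ, (∏ e, x e ^ m e) * (adj x ^ (j + 1)) u v =
        ∑ w, (∏ e, x e ^ (m + Pi.single s(u, w) 1 : Sym2 (Fin n) → ℕ) e) * (adj x ^ j) w v := by
      intro x
      rw [pow_succ', Matrix.mul_apply, Finset.mul_sum]
      refine Finset.sum_congr rfl fun w _ => ?_
      have : ∏ e, x e ^ (m + Pi.single s(u, w) 1 : Sym2 (Fin n) → ℕ) e =
          (∏ e, x e ^ m e) * x s(u, w) := by
        simp only [Pi.add_apply, pow_add, Finset.prod_mul_distrib]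
        congr 1
        rw [Finset.prod_eq_single s(u, w)]
        · simp
        · intro b _ hb
          simp [hb]
        · simp
      rw [this, adj, Matrix.of_apply]
      ring
    simp_rw [hexp]
    rw [integral_finsetSum _ (fun w _ => integrable_of_continuous_of_pi μ hb (by
      have := (continuous_adj (n := n)).pow j
      have h : Continuous fun x : Sym2 (Fin n) → ℝ => (adj x ^ j) w v :=
        (continuous_apply v).comp ((continuous_apply w).comp this)
      exact Continuous.mul (by fun_prop) h))]
    refine (Finset.abs_sum_le_sum_abs _ _).trans ?_
    rw [walkSum, Finset.mul_sum]
    refine Finset.sum_le_sum fun w _ => ?_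
    -- A step changes the factor of the edge s(u, w) alone, so comparing that one factor decides
    -- each of the three cases.
    have hupd : ∀ (O' : Finset (Sym2 (Fin n))), (∀ e, e ≠ s(u, w) → (e ∈ O' ↔ e ∈ O)) →
        ∀ t : ℝ, (if s(u, w) ∈ O' then c else momentBound c K (m s(u, w) + 1)) ≤
          (if s(u, w) ∈ O then c else momentBound c K (m s(u, w))) * t →
        (∏ e, if e ∈ O' then c else
            momentBound c K ((m + Pi.single s(u, w) 1 : Sym2 (Fin n) → ℕ) e)) ≤
          (∏ e, if e ∈ O then c else momentBound c K (m e)) * t := by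
      intro O' hO' t ht
      rw [← Finset.mul_prod_erase _ _ (Finset.mem_univ s(u, w)),
        ← Finset.mul_prod_erase _ (fun e => if e ∈ O then c else momentBound c K (m e))
          (Finset.mem_univ s(u, w))]
      have : ∏ e ∈ Finset.univ.erase s(u, w), (if e ∈ O' then c else
          momentBound c K ((m + Pi.single s(u, w) 1 : Sym2 (Fin n) → ℕ) e)) =
          ∏ e ∈ Finset.univ.erase s(u, w), (if e ∈ O then c else momentBound c K (m e)) := by
        refine Finset.prod_congr rfl fun e he => ?_
        have hne := (Finset.mem_erase.1 he).1
        simp [hO' e hne, hne]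
      rw [this, mul_right_comm]
      refine mul_le_mul_of_nonneg_right ?_ (Finset.prod_nonneg fun e _ => by
        split_ifs
        · exact hc
        · exact hMB _)
      simpa using ht
    by_cases hw : w ∈ S
    · have hS' : ∀ e, (∃ v ∈ e, v ∉ S) → (m + Pi.single s(u, w) 1 : Sym2 (Fin n) → ℕ) e = 0 := by
        intro e he
        have hne : e ≠ s(u, w) := by
          rintro rfl
          obtain ⟨v, hv, hvS⟩ := he
          rcases Sym2.mem_iff.1 hv with rfl | rfl
          · exact hvS hu
          · exact hvS hw
        simp [hS e he, hne]
      by_cases he : s(u, w) ∈ O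
      · simp only [hw, not_true, if_false, he, if_true]
        refine (ih (m + Pi.single s(u, w) 1) S (O.erase s(u, w)) w hw (fun e he => ?_) hS').trans ?_
        · obtain ⟨h1, h2⟩ := Finset.mem_erase.1 he
          simp [hO e h2, h1]
        · refine mul_le_mul_of_nonneg_right ?_ (walkSum_nonneg hc hK ..)
          have := hupd (O.erase s(u, w)) (fun e h => by simp [h]) 1
            (by simp [he, hO _ he, momentBound])
          simpa using this
      · simp only [hw, not_true, if_false, he]
        refine (ih (m + Pi.single s(u, w) 1) S O w hw (fun e h => ?_) hS').trans ?_
        · have hne : e ≠ s(u, w) := fun h' => he (h' ▸ h)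
          simp [hO e h, hne]
        · rw [← mul_assoc]
          refine mul_le_mul_of_nonneg_right ?_ (walkSum_nonneg hc hK ..)
          refine hupd O (fun e _ => Iff.rfl) K ?_
          simpa [he, mul_comm] using momentBound_succ_le hcK (m s(u, w))
    · have hm : m s(u, w) = 0 := hS _ ⟨w, by simp, hw⟩
      have he : s(u, w) ∉ O := fun h => by simp [hO _ h] at hm
      simp only [hw, not_false_eq_true, if_true]
      refine (ih (m + Pi.single s(u, w) 1) (insert w S) (insert s(u, w) O) w (by simp)
        (fun e h => ?_) (fun e h => ?_)).trans ?_
      · rcases eq_or_ne e s(u, w) with rfl | hne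
        · simp [hm]
        · simp [hO e (Finset.mem_of_mem_insert_of_ne h hne), hne]
      · obtain ⟨v, hv, hvS⟩ := h
        have hne : e ≠ s(u, w) := by
          rintro rfl
          rcases Sym2.mem_iff.1 hv with rfl | rfl
          · exact hvS (by simp [hu])
          · exact hvS (by simp)
        have := hS e ⟨v, hv, fun h => hvS (by simp [h])⟩
        simp [this, hne]
      · rw [← mul_assoc]
        refine mul_le_mul_of_nonneg_right ?_ (walkSum_nonneg hc hK ..)
        exact hupd _ (fun e h => by simp [h]) c (by simp [he, hm, momentBound])

/-- Sum over the n starting points, with no open edge and excess 0. A walk of k steps visits at most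
k + 1 vertices, which is the value of M. -/
theorem integral_trace_pow_adj_le (hc : 0 ≤ c) (hK : 0 ≤ K) (hcK : c ≤ K ^ 2)
    (hn : n * c ≤ 1) (h0 : ∀ e, ∫ x, x ∂μ e = 0) (h2 : ∀ e, ∫ x, x ^ 2 ∂μ e ≤ c)
    (hb : ∀ e, ∀ᵐ x ∂μ e, |x| ≤ K) (k : ℕ) :
    ∫ x, (adj x ^ k).trace ∂Measure.pi μ ≤ n * (2 + (k + 1) * K * (k + 2)) ^ k := by
  have hcont : ∀ u v : Fin n, Continuous fun x : Sym2 (Fin n) → ℝ => (adj x ^ k) u v :=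
    fun u v => (continuous_apply v).comp ((continuous_apply u).comp (continuous_adj.pow k))
  simp only [Matrix.trace, Matrix.diag]
  rw [integral_finsetSum _ fun u _ => integrable_of_continuous_of_pi μ hb (hcont u u)]
  calc _ ≤ ∑ u : Fin n, (2 + (k + 1) * K * (k + 2)) ^ k := by
        refine Finset.sum_le_sum fun u _ => (le_abs_self _).trans ?_
        have h := abs_integral_prod_mul_pow_adj_le μ hc hK hcK h0 h2 hb k 0 {u} ∅ u u
          (by simp) (by simp) (by simp)
        have h' := walkSum_le hc hK (by simpa using hn) (k + 1) k {u} ∅ u (by simp) (by simp)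
          (by simp) (by simp [add_comm]) (by simp [excess, openDeg])
        have he : excess (∅ : Finset (Sym2 (Fin n))) u = 0 := by simp [excess, openDeg]
        simp only [Pi.zero_apply, pow_zero, Finset.prod_const_one, one_mul, Finset.notMem_empty,
          if_false, momentBound] at h
        rw [he, pow_zero, mul_one] at h'
        refine h.trans (h'.trans (le_of_eq ?_))
        push_cast
        ring
    _ = _ := by simp

end Moments

end WeightedChungLu

namespace WeightedChungLu

/-! ### Resolvents of real symmetric matrices -/

section Resolvent

open scoped Matrix.Norms.L2Operator

variable {ι : Type*} [Fintype ι] [DecidableEq ι]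

/-- The resolvent `(A - z)⁻¹` of a real matrix. -/
noncomputable def resolvent (A : Matrix ι ι ℝ) (z : ℂ) : Matrix ι ι ℂ :=
  (A.map Complex.ofReal - Matrix.scalar ι z)⁻¹

/-- The Stieltjes transform `(1 / n) tr (A - z)⁻¹` of the spectral distribution of `A`. -/
noncomputable def stieltjes (A : Matrix ι ι ℝ) (z : ℂ) : ℂ :=
  (Fintype.card ι : ℂ)⁻¹ * (resolvent A z).trace

theorem ofReal_sub_ne_zero {z : ℂ} (hz : 0 < z.im) (x : ℝ) : (x : ℂ) - z ≠ 0 := fun h => by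
  have := congrArg Complex.im h
  simp at this
  exact hz.ne' this

theorem norm_inv_ofReal_sub_le {z : ℂ} (hz : 0 < z.im) (x : ℝ) :
    ‖((x : ℂ) - z)⁻¹‖ ≤ z.im⁻¹ := by
  rw [norm_inv]
  refine inv_anti₀ hz ?_
  have := Complex.abs_im_le_norm ((x : ℂ) - z)
  simpa [abs_of_pos hz] using this

/-- Spectral decomposition of a real symmetric matrix, over `ℂ`. -/
theorem exists_unitary_map_ofReal {A : Matrix ι ι ℝ} (hA : A.IsHermitian) :
    ∃ V ∈ Matrix.unitaryGroup ι ℂ,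
      A.map Complex.ofReal = V * Matrix.diagonal (fun i => (hA.eigenvalues i : ℂ)) * star V := by
  set U := hA.eigenvectorUnitary.1 with hU
  have h1 : A = U * Matrix.diagonal hA.eigenvalues * star U := by
    conv_lhs => rw [hA.spectral_theorem, Unitary.conjStarAlgAut_apply]
    rfl
  have hstar : (star U).map Complex.ofReal = star (U.map Complex.ofReal) := by
    ext i j
    simp [Matrix.star_apply]
  have hmul : ∀ M N : Matrix ι ι ℝ, (M * N).map Complex.ofReal =
      M.map Complex.ofReal * N.map Complex.ofReal := fun M N =>
    Matrix.map_mul (f := Complex.ofRealHom)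
  refine ⟨U.map Complex.ofReal, ?_, ?_⟩
  · rw [Matrix.mem_unitaryGroup_iff, ← hstar, ← hmul, hU, Unitary.mul_star_self_of_mem (by simp)]
    ext i j
    simp [Matrix.one_apply]
    split_ifs <;> simp
  · conv_lhs => rw [h1]
    rw [hmul, hmul, hstar]
    congr 2
    ext i j
    simp [Matrix.diagonal_apply]
    split_ifs <;> simp

theorem resolvent_mul_and_eq {A : Matrix ι ι ℝ} (hA : A.IsHermitian) {z : ℂ} (hz : 0 < z.im) :
    (A.map Complex.ofReal - Matrix.scalar ι z) * resolvent A z = 1 ∧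
    ∃ V ∈ Matrix.unitaryGroup ι ℂ, resolvent A z =
      V * Matrix.diagonal (fun i => ((hA.eigenvalues i : ℂ) - z)⁻¹) * star V := by
  obtain ⟨V, hV, hAV⟩ := exists_unitary_map_ofReal hA
  have hV1 := Matrix.mem_unitaryGroup_iff.1 hV
  have hV2 := Matrix.mem_unitaryGroup_iff'.1 hV
  have h1 : A.map Complex.ofReal - Matrix.scalar ι z =
      V * Matrix.diagonal (fun i => (hA.eigenvalues i : ℂ) - z) * star V := by
    have : (Matrix.diagonal fun i => (hA.eigenvalues i : ℂ) - z) =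
        Matrix.diagonal (fun i => (hA.eigenvalues i : ℂ)) - Matrix.scalar ι z := by
      ext i j
      simp [Matrix.diagonal_apply]
      split_ifs <;> simp
    rw [this, mul_sub, sub_mul, ← hAV, ← (Matrix.scalar_commute z (fun _ => mul_comm _ _) V).eq,
      mul_assoc,
      hV1, mul_one]
  have h2 : (A.map Complex.ofReal - Matrix.scalar ι z) *
      (V * Matrix.diagonal (fun i => ((hA.eigenvalues i : ℂ) - z)⁻¹) * star V) = 1 := by
    rw [h1]
    calc _ = V * (Matrix.diagonal (fun i => (hA.eigenvalues i : ℂ) - z) * (star V * V) *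
          Matrix.diagonal (fun i => ((hA.eigenvalues i : ℂ) - z)⁻¹)) * star V := by
          simp only [mul_assoc]
      _ = 1 := by
        rw [hV2, mul_one, Matrix.diagonal_mul_diagonal]
        simp [mul_inv_cancel₀ (ofReal_sub_ne_zero hz _), hV1]
  have h3 : resolvent A z = V * Matrix.diagonal (fun i => ((hA.eigenvalues i : ℂ) - z)⁻¹) *
      star V := Matrix.inv_eq_right_inv h2
  exact ⟨h3 ▸ h2, V, hV, h3⟩

theorem sub_mul_resolvent {A : Matrix ι ι ℝ} (hA : A.IsHermitian) {z : ℂ} (hz : 0 < z.im) :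
    (A.map Complex.ofReal - Matrix.scalar ι z) * resolvent A z = 1 :=
  (resolvent_mul_and_eq hA hz).1

theorem resolvent_mul_sub {A : Matrix ι ι ℝ} (hA : A.IsHermitian) {z : ℂ} (hz : 0 < z.im) :
    resolvent A z * (A.map Complex.ofReal - Matrix.scalar ι z) = 1 :=
  mul_eq_one_comm.1 (sub_mul_resolvent hA hz)

theorem trace_resolvent {A : Matrix ι ι ℝ} (hA : A.IsHermitian) {z : ℂ} (hz : 0 < z.im) :
    (resolvent A z).trace = ∑ i, ((hA.eigenvalues i : ℂ) - z)⁻¹ := by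
  obtain ⟨V, hV, h⟩ := (resolvent_mul_and_eq hA hz).2
  rw [h, Matrix.trace_mul_comm, ← mul_assoc, Matrix.mem_unitaryGroup_iff'.1 hV, one_mul,
    Matrix.trace_diagonal]

theorem norm_resolvent_le {A : Matrix ι ι ℝ} (hA : A.IsHermitian) {z : ℂ} (hz : 0 < z.im) :
    ‖resolvent A z‖ ≤ z.im⁻¹ := by
  obtain ⟨V, hV, h⟩ := (resolvent_mul_and_eq hA hz).2
  rw [h]
  have hV' : star V ∈ Matrix.unitaryGroup ι ℂ := Unitary.star_mem hV
  calc _ ≤ ‖Matrix.diagonal (fun i => ((hA.eigenvalues i : ℂ) - z)⁻¹)‖ := by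
        rw [CStarRing.norm_mul_mem_unitary _ hV', CStarRing.norm_mem_unitary_mul _ hV]
    _ ≤ _ := by
      rw [Matrix.l2_opNorm_diagonal]
      exact (pi_norm_le_iff_of_nonneg (inv_nonneg.2 hz.le)).2 fun i => norm_inv_ofReal_sub_le hz _

theorem resolvent_sub {A B : Matrix ι ι ℝ} (hA : A.IsHermitian) (hB : B.IsHermitian) {z : ℂ}
    (hz : 0 < z.im) : resolvent A z - resolvent B z =
      resolvent A z * (B - A).map Complex.ofReal * resolvent B z := by
  have : (B - A).map Complex.ofReal =
      (B.map Complex.ofReal - Matrix.scalar ι z) - (A.map Complex.ofReal - Matrix.scalar ι z) := by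
    ext i j
    simp
  rw [this, mul_sub, sub_mul, mul_assoc, sub_mul_resolvent hB hz, resolvent_mul_sub hA hz]
  simp

theorem sum_norm_sq_col_le (G : Matrix ι ι ℂ) (j : ι) : ∑ i, ‖G i j‖ ^ 2 ≤ ‖G‖ ^ 2 := by
  have h := Matrix.l2_opNorm_mulVec G (EuclideanSpace.single j 1)
  rw [PiLp.norm_single, norm_one, mul_one, EuclideanSpace.norm_eq] at h
  have h2 := Real.sqrt_le_iff.1 h
  simpa using h2.2

theorem norm_apply_le_norm (G : Matrix ι ι ℂ) (i j : ι) : ‖G i j‖ ≤ ‖G‖ := by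
  have h1 := Finset.single_le_sum (f := fun i => ‖G i j‖ ^ 2) (fun _ _ => by positivity)
    (Finset.mem_univ i)
  exact (sq_le_sq₀ (norm_nonneg _) (norm_nonneg _)).1 (h1.trans (sum_norm_sq_col_le G j))

theorem rank_add_le_rank_add_rank {κ K : Type*} [Fintype κ] [Field K] (A B : Matrix κ κ K) :
    (A + B).rank ≤ A.rank + B.rank := by
  unfold Matrix.rank
  rw [Matrix.mulVecLin_add]
  refine (Submodule.finrank_mono ?_).trans (Submodule.finrank_add_le_finrank_add_finrank _ _)
  rintro _ ⟨x, rfl⟩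
  exact Submodule.add_mem_sup ⟨x, rfl⟩ ⟨x, rfl⟩

/-- The trace may be computed on the range of the operator. An orthonormal basis of the range has
`G.rank` elements, each contributing at most the operator norm. -/
theorem norm_trace_le_rank_mul_norm (G : Matrix ι ι ℂ) : ‖G.trace‖ ≤ G.rank * ‖G‖ := by
  set f : EuclideanSpace ℂ ι →ₗ[ℂ] EuclideanSpace ℂ ι := G.toEuclideanLin with hf
  have hfn : ∀ x, ‖f x‖ ≤ ‖G‖ * ‖x‖ := fun x => Matrix.l2_opNorm_mulVec G x
  have htr : LinearMap.trace ℂ _ f = G.trace := by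
    rw [hf, Matrix.toEuclideanLin_eq_toLin_orthonormal, Matrix.trace_toLin_eq]
  have hrk : Module.finrank ℂ (LinearMap.range f) = G.rank := by
    rw [hf, Matrix.toEuclideanLin_eq_toLin_orthonormal]
    exact (Matrix.rank_eq_finrank_range_toLin G (EuclideanSpace.basisFun ι ℂ).toBasis
      (EuclideanSpace.basisFun ι ℂ).toBasis).symm
  rw [← htr, ← LinearMap.trace_restrict_eq_of_forall_mem (LinearMap.range f) f (fun x => ⟨x, rfl⟩),
    LinearMap.trace_eq_sum_inner _ (stdOrthonormalBasis ℂ (LinearMap.range f))]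
  refine (norm_sum_le _ _).trans ?_
  rw [← hrk, ← nsmul_eq_mul]
  refine (Finset.sum_le_card_nsmul _ _ ‖G‖ fun i _ => ?_).trans_eq (by simp)
  refine (norm_inner_le_norm _ _).trans ?_
  rw [(stdOrthonormalBasis ℂ (LinearMap.range f)).norm_eq_one, one_mul]
  refine (hfn _).trans ?_
  have := (stdOrthonormalBasis ℂ (LinearMap.range f)).norm_eq_one i
  rw [Submodule.coe_norm] at this
  rw [Submodule.subtype_apply, this, mul_one]

theorem norm_stieltjes_le {A : Matrix ι ι ℝ} (hA : A.IsHermitian) {z : ℂ} (hz : 0 < z.im) :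
    ‖stieltjes A z‖ ≤ z.im⁻¹ := by
  rw [stieltjes, norm_mul, norm_inv, Complex.norm_natCast, trace_resolvent hA hz]
  have h : ‖∑ i, ((hA.eigenvalues i : ℂ) - z)⁻¹‖ ≤ Fintype.card ι * z.im⁻¹ := by
    refine (norm_sum_le _ _).trans ?_
    refine (Finset.sum_le_sum fun i _ => norm_inv_ofReal_sub_le hz _).trans ?_
    simp
  rcases (Fintype.card ι).eq_zero_or_pos with h0 | h0
  · simp [h0, hz.le]
  · have : (0 : ℝ) < Fintype.card ι := by exact_mod_cast h0
    calc _ ≤ (Fintype.card ι : ℝ)⁻¹ * (Fintype.card ι * z.im⁻¹) := by gcongr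
      _ = _ := by field_simp

/-- By the resolvent identity the difference of the resolvents has rank at most that of B - A, and
its norm is at most 2 / Im z whatever the size of B - A. -/
theorem norm_stieltjes_sub_le_rank {A B : Matrix ι ι ℝ} (hA : A.IsHermitian) (hB : B.IsHermitian)
    {z : ℂ} (hz : 0 < z.im) : ‖stieltjes A z - stieltjes B z‖ ≤
      2 * z.im⁻¹ * (((B - A).map Complex.ofReal).rank / Fintype.card ι) := by
  rw [stieltjes, stieltjes, ← mul_sub, ← Matrix.trace_sub, norm_mul, norm_inv,
    Complex.norm_natCast]
  have h1 := norm_trace_le_rank_mul_norm (resolvent A z - resolvent B z)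
  have h2 : (resolvent A z - resolvent B z).rank ≤ ((B - A).map Complex.ofReal).rank := by
    rw [resolvent_sub hA hB hz]
    exact (Matrix.rank_mul_le_left _ _).trans (Matrix.rank_mul_le_right _ _)
  have h3 : ‖resolvent A z - resolvent B z‖ ≤ 2 * z.im⁻¹ := by
    refine (norm_sub_le _ _).trans ?_
    linarith [norm_resolvent_le hA hz, norm_resolvent_le hB hz]
  calc _ ≤ (Fintype.card ι : ℝ)⁻¹ * (((B - A).map Complex.ofReal).rank * (2 * z.im⁻¹)) := by
        gcongr
        refine h1.trans ?_
        gcongr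
    _ = _ := by ring

/-- Cyclicity turns the trace into that of (B - A) times a product of two resolvents. Cauchy–Schwarz
applies, and the columns of that product have norm at most (Im z)⁻². -/
theorem norm_stieltjes_sub_le_sqrt {A B : Matrix ι ι ℝ} (hA : A.IsHermitian) (hB : B.IsHermitian)
    {z : ℂ} (hz : 0 < z.im) : ‖stieltjes A z - stieltjes B z‖ ≤
      z.im⁻¹ ^ 2 * √((∑ i, ∑ j, ((B - A) i j) ^ 2) / Fintype.card ι) := by
  rw [stieltjes, stieltjes, ← mul_sub, ← Matrix.trace_sub, norm_mul, norm_inv,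
    Complex.norm_natCast, resolvent_sub hA hB hz, mul_assoc, Matrix.trace_mul_comm, mul_assoc]
  set G := resolvent B z * resolvent A z with hG
  have hGn : ‖G‖ ≤ z.im⁻¹ ^ 2 := by
    rw [hG, sq]
    refine (norm_mul_le _ _).trans ?_
    have := norm_resolvent_le hA hz
    have := norm_resolvent_le hB hz
    gcongr
  set N : ℝ := (Fintype.card ι : ℝ) with hN
  set F : ℝ := ∑ i, ∑ j, ((B - A) i j) ^ 2 with hF
  have hF0 : 0 ≤ F := by positivity
  have hGF : ∑ j, ∑ i, ‖G i j‖ ^ 2 ≤ N * (z.im⁻¹ ^ 2) ^ 2 := by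
    calc _ ≤ ∑ j : ι, (z.im⁻¹ ^ 2) ^ 2 := Finset.sum_le_sum fun j _ =>
          (sum_norm_sq_col_le G j).trans (by gcongr)
      _ = _ := by simp [hN]
  have hi : 0 < z.im⁻¹ ^ 2 := by positivity
  have key : ‖((B - A).map Complex.ofReal * G).trace‖ ≤ √F * √(N * (z.im⁻¹ ^ 2) ^ 2) := by
    rw [Matrix.trace]
    simp only [Matrix.diag, Matrix.mul_apply, Matrix.map_apply]
    calc _ ≤ ∑ i, ∑ j, |(B - A) i j| * ‖G j i‖ := by
          refine (norm_sum_le _ _).trans (Finset.sum_le_sum fun i _ => (norm_sum_le _ _).trans ?_)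
          simp only [norm_mul, Complex.norm_real, Real.norm_eq_abs, le_refl]
      _ = ∑ p : ι × ι, |(B - A) p.1 p.2| * ‖G p.2 p.1‖ := by rw [Fintype.sum_prod_type]
      _ ≤ √(∑ p : ι × ι, |(B - A) p.1 p.2| ^ 2) * √(∑ p : ι × ι, ‖G p.2 p.1‖ ^ 2) :=
          Real.sum_mul_le_sqrt_mul_sqrt _ _ _
      _ ≤ _ := by
        rw [Fintype.sum_prod_type, Fintype.sum_prod_type]
        simp only [sq_abs]
        gcongr
  rcases (Fintype.card ι).eq_zero_or_pos with h0 | h0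
  · simp [hN, h0]
  · have hN0 : 0 < N := by rw [hN]; exact_mod_cast h0
    calc _ ≤ N⁻¹ * (√F * √(N * (z.im⁻¹ ^ 2) ^ 2)) := by gcongr
      _ = _ := by
        rw [Real.sqrt_mul hN0.le, Real.sqrt_sq hi.le, Real.sqrt_div hF0]
        have := Real.sqrt_pos.2 hN0
        field_simp
        rw [Real.sq_sqrt hN0.le, mul_comm]

end Resolvent

end WeightedChungLu

namespace WeightedChungLu

/-! ### The self-consistent equation for the Stieltjes transform -/

section SelfConsistent

open scoped Matrix.Norms.L2Operator ComplexConjugate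

variable {n : ℕ}

theorem adj_isHermitian (x : Sym2 (Fin n) → ℝ) : (adj x).IsHermitian := by
  ext i j
  simp [adj, Sym2.eq_swap (a := j) (b := i)]

theorem continuous_resolvent_adj {z : ℂ} (hz : 0 < z.im) :
    Continuous fun x : Sym2 (Fin n) → ℝ => resolvent (adj x) z := by
  have h1 : Continuous fun x : Sym2 (Fin n) → ℝ =>
      (adj x).map Complex.ofReal - Matrix.scalar (Fin n) z :=
    (continuous_adj.matrix_map Complex.continuous_ofReal).sub continuous_const
  unfold resolvent
  simp only [Matrix.inv_def, Ring.inverse_eq_inv']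
  refine (h1.matrix_det.inv₀ fun x => ?_).smul h1.matrix_adjugate
  exact ((Matrix.isUnit_iff_isUnit_det _).1
    (IsUnit.of_mul_eq_one _ (sub_mul_resolvent (adj_isHermitian x) hz))).ne_zero

theorem continuous_resolvent_adj_apply {z : ℂ} (hz : 0 < z.im) (i j : Fin n) :
    Continuous fun x : Sym2 (Fin n) → ℝ => resolvent (adj x) z i j :=
  (continuous_apply j).comp ((continuous_apply i).comp (continuous_resolvent_adj hz))

theorem continuous_stieltjes_adj {z : ℂ} (hz : 0 < z.im) :
    Continuous fun x : Sym2 (Fin n) → ℝ => stieltjes (adj x) z :=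
  continuous_const.mul (continuous_resolvent_adj hz).matrix_trace

theorem map_adj_single (i j : Fin n) (t : ℝ) :
    (adj (Pi.single s(i, j) t)).map Complex.ofReal =
      Matrix.single i j (t : ℂ) + if i = j then 0 else Matrix.single j i (t : ℂ) := by
  ext a b
  simp only [adj, Matrix.map_apply, Matrix.of_apply, Pi.single_apply, Matrix.add_apply,
    Matrix.single_apply]
  by_cases hij : i = j
  · subst hij
    by_cases h : i = a ∧ i = b
    · simp [← h.1, ← h.2]
    · have : s(a, b) ≠ s(i, i) := by
        intro h'
        rcases Sym2.eq_iff.1 h' with ⟨rfl, rfl⟩ | ⟨rfl, rfl⟩ <;> simp at h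
      simp [h, this]
  · simp only [hij, if_false, Matrix.single_apply]
    by_cases h1 : i = a ∧ j = b
    · obtain ⟨rfl, rfl⟩ := h1
      simp [hij]
    · by_cases h2 : j = a ∧ i = b
      · obtain ⟨rfl, rfl⟩ := h2
        simp [hij, Sym2.eq_swap]
      · have : s(a, b) ≠ s(i, j) := by
          intro h'
          rcases Sym2.eq_iff.1 h' with ⟨rfl, rfl⟩ | ⟨rfl, rfl⟩
          · simp at h1
          · simp at h2
        simp [h1, h2, this]

theorem mul_map_adj_single_mul_apply (R S : Matrix (Fin n) (Fin n) ℂ) (i j k l : Fin n) (t : ℝ) :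
    (R * (adj (Pi.single s(i, j) t)).map Complex.ofReal * S) k l =
      t * (R k i * S j l + if i = j then 0 else R k j * S i l) := by
  have key : ∀ a b : Fin n, (R * Matrix.single a b (t : ℂ) * S) k l = t * (R k a * S b l) := by
    intro a b
    rw [Matrix.mul_apply, Finset.sum_eq_single b]
    · simp
      ring
    · intro c _ hc
      simp [hc]
    · simp
  rw [map_adj_single, mul_add, add_mul, Matrix.add_apply, key]
  split_ifs with h
  · simp
  · rw [key]
    ring

theorem adj_sub_adj_update (x : Sym2 (Fin n) → ℝ) (e : Sym2 (Fin n)) :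
    adj x - adj (Function.update x e 0) = adj (Pi.single e (x e)) := by
  ext a b
  simp only [adj, Matrix.sub_apply, Matrix.of_apply]
  by_cases h : s(a, b) = e
  · simp [h]
  · simp [h]

/-- The resolvent identity for a perturbation in one unordered pair. A diagonal pair occupies a
single position of the matrix, whence the case distinction. -/
theorem resolvent_sub_update_apply (x : Sym2 (Fin n) → ℝ) (i j k l : Fin n) {z : ℂ}
    (hz : 0 < z.im) :
    resolvent (adj x) z k l - resolvent (adj (Function.update x s(i, j) 0)) z k l =
      -(x s(i, j) * (resolvent (adj x) z k i *
          resolvent (adj (Function.update x s(i, j) 0)) z j l +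
        if i = j then 0 else resolvent (adj x) z k j *
          resolvent (adj (Function.update x s(i, j) 0)) z i l)) := by
  rw [← Matrix.sub_apply, resolvent_sub (adj_isHermitian _) (adj_isHermitian _) hz,
    ← neg_sub (adj x), adj_sub_adj_update]
  have : (-adj (Pi.single s(i, j) (x s(i, j)))).map Complex.ofReal =
      -(adj (Pi.single s(i, j) (x s(i, j)))).map Complex.ofReal := by
    ext
    simp
  rw [this, mul_neg, neg_mul, Matrix.neg_apply, mul_map_adj_single_mul_apply]

theorem norm_resolvent_apply_le {A : Matrix (Fin n) (Fin n) ℝ} (hA : A.IsHermitian) {z : ℂ}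
    (hz : 0 < z.im) (i j : Fin n) : ‖resolvent A z i j‖ ≤ z.im⁻¹ :=
  (norm_apply_le_norm _ _ _).trans (norm_resolvent_le hA hz)

theorem norm_resolvent_sub_update_le (x : Sym2 (Fin n) → ℝ) (i j k l : Fin n) {z : ℂ}
    (hz : 0 < z.im) :
    ‖resolvent (adj x) z k l - resolvent (adj (Function.update x s(i, j) 0)) z k l‖ ≤
      |x s(i, j)| * (2 * z.im⁻¹ ^ 2) := by
  have h : ∀ (y : Sym2 (Fin n) → ℝ) a b, ‖resolvent (adj y) z a b‖ ≤ z.im⁻¹ := fun y =>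
    norm_resolvent_apply_le (adj_isHermitian y) hz
  have hb : 0 ≤ z.im⁻¹ := inv_nonneg.2 hz.le
  rw [resolvent_sub_update_apply x i j k l hz, norm_neg, norm_mul, Complex.norm_real,
    Real.norm_eq_abs]
  refine mul_le_mul_of_nonneg_left ((norm_add_le _ _).trans ?_) (abs_nonneg _)
  have h1 : ∀ (y y' : Sym2 (Fin n) → ℝ) a b a' b',
      ‖resolvent (adj y) z a b * resolvent (adj y') z a' b'‖ ≤ z.im⁻¹ ^ 2 := by
    intro y y' a b a' b'
    rw [norm_mul, sq]
    exact mul_le_mul (h _ _ _) (h _ _ _) (norm_nonneg _) hb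
  have h2 := h1 x (Function.update x s(i, j) 0) k i j l
  split_ifs
  · rw [norm_zero]
    nlinarith [sq_nonneg z.im⁻¹]
  · have h3 := h1 x (Function.update x s(i, j) 0) k j i l
    linarith

/-- In the trace, the sum over the diagonal reassembles into entries of a product of two resolvents.
These are bounded independently of n, so the factor 1/n of the normalized trace survives. -/
theorem norm_stieltjes_sub_update_le (x : Sym2 (Fin n) → ℝ) (i j : Fin n) {z : ℂ}
    (hz : 0 < z.im) :
    ‖stieltjes (adj x) z - stieltjes (adj (Function.update x s(i, j) 0)) z‖ ≤
      |x s(i, j)| * (2 * z.im⁻¹ ^ 2) / n := by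
  set x0 := Function.update x s(i, j) 0 with hx0
  set R := resolvent (adj x) z with hR
  set R0 := resolvent (adj x0) z with hR0
  have hb : 0 ≤ z.im⁻¹ := inv_nonneg.2 hz.le
  have h1 : (R - R0).trace = -(x s(i, j) * ((R0 * R) j i + if i = j then 0 else (R0 * R) i j)) := by
    rw [Matrix.trace]
    simp only [Matrix.diag, Matrix.sub_apply, hR, hR0, hx0]
    simp_rw [resolvent_sub_update_apply x i j _ _ hz]
    rw [Finset.sum_neg_distrib, ← Finset.mul_sum, Finset.sum_add_distrib]
    congr 3
    · rw [Matrix.mul_apply]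
      exact Finset.sum_congr rfl fun _ _ => mul_comm _ _
    · split_ifs
      · simp
      · rw [Matrix.mul_apply]
        exact Finset.sum_congr rfl fun _ _ => mul_comm _ _
  have h2 : ∀ a b, ‖(R0 * R) a b‖ ≤ z.im⁻¹ ^ 2 := by
    intro a b
    refine (norm_apply_le_norm _ _ _).trans ((norm_mul_le _ _).trans ?_)
    rw [sq]
    exact mul_le_mul (norm_resolvent_le (adj_isHermitian _) hz)
      (norm_resolvent_le (adj_isHermitian _) hz) (norm_nonneg _) hb
  rw [stieltjes, stieltjes, ← mul_sub, ← Matrix.trace_sub, h1, norm_mul, norm_inv,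
    Complex.norm_natCast, Fintype.card_fin, norm_neg, norm_mul, Complex.norm_real,
    Real.norm_eq_abs, div_eq_inv_mul]
  gcongr
  refine (norm_add_le _ _).trans ?_
  have h3 := h2 j i
  split_ifs
  · rw [norm_zero]
    nlinarith [sq_nonneg z.im⁻¹]
  · have h4 := h2 i j
    linarith

/-- The failure of `s` to solve the equation `s² / 4 + z s + 1 = 0` of the Stieltjes transform of
the semicircle law. -/
noncomputable def defect (z s : ℂ) : ℂ := s ^ 2 / 4 + z * s + 1

theorem norm_defect_sub_le {z s t : ℂ} {b : ℝ} (hs : ‖s‖ ≤ b) (ht : ‖t‖ ≤ b) :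
    ‖defect z s - defect z t‖ ≤ (b / 2 + ‖z‖) * ‖s - t‖ := by
  have : defect z s - defect z t = ((s + t) / 4 + z) * (s - t) := by
    unfold defect
    ring
  rw [this, norm_mul]
  gcongr
  refine (norm_add_le _ _).trans ?_
  rw [norm_div]
  have := norm_add_le s t
  norm_num
  linarith

theorem norm_defect_le {z s : ℂ} {b : ℝ} (hs : ‖s‖ ≤ b) :
    ‖defect z s‖ ≤ b ^ 2 / 4 + ‖z‖ * b + 1 := by
  unfold defect
  refine (norm_add₃_le ..).trans ?_
  rw [norm_div, norm_pow, norm_mul, norm_one]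
  norm_num
  gcongr

variable (μ : Sym2 (Fin n) → Measure ℝ) [∀ e, IsProbabilityMeasure (μ e)]

/-- The coordinate `e` is independent of the family of all others, and with that coordinate reset to
0 the second factor depends only on those. -/
theorem integral_mul_update (e : Sym2 (Fin n)) {φ : ℝ → ℂ} (hφ : Measurable φ)
    {F : (Sym2 (Fin n) → ℝ) → ℂ} (hF : Measurable F) :
    ∫ x, φ (x e) * F (Function.update x e 0) ∂Measure.pi μ =
      (∫ t, φ t ∂μ e) * ∫ x, F (Function.update x e 0) ∂Measure.pi μ := by
  have hind : ProbabilityTheory.iIndepFun (fun i (x : Sym2 (Fin n) → ℝ) => x i) (Measure.pi μ) :=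
    ProbabilityTheory.iIndepFun_pi (X := fun _ t => t) fun _ => aemeasurable_id
  have h2 := hind.indepFun_finset {e} (Finset.univ.erase e) (by simp)
    (fun i => measurable_pi_apply i)
  let G : (({e} : Finset (Sym2 (Fin n))) → ℝ) → ℂ := fun y => φ (y ⟨e, by simp⟩)
  let H : (↥(Finset.univ.erase e) → ℝ) → ℂ := fun y =>
    F fun k => if h : k = e then 0 else y ⟨k, by simp [h]⟩
  have hG : Measurable G := hφ.comp (measurable_pi_apply _)
  have hH : Measurable H := by
    refine hF.comp (measurable_pi_lambda _ fun k => ?_)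
    by_cases h : k = e
    · simp only [h, dite_true]
      exact measurable_const
    · simp only [h, dite_false]
      exact measurable_pi_apply _
  have hHF : ∀ x : Sym2 (Fin n) → ℝ,
      H (fun i => x i) = F (Function.update x e 0) := by
    intro x
    simp only [H]
    congr 1
    ext k
    by_cases h : k = e
    · simp [h]
    · simp [h]
  have h3 := h2.integral_fun_comp_mul_comp (f := G) (g := H)
    (measurable_pi_lambda _ fun i => measurable_pi_apply _).aemeasurable
    (measurable_pi_lambda _ fun i => measurable_pi_apply _).aemeasurable
    hG.aestronglyMeasurable hH.aestronglyMeasurable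
  simp only [hHF, G] at h3
  rw [h3]
  congr 1
  exact integral_comp_eval (X := fun _ : Sym2 (Fin n) => ℝ) (μ := μ) (i := e) (f := φ)
    hφ.aestronglyMeasurable

end SelfConsistent

end WeightedChungLu

namespace WeightedChungLu

/-! ### First-order expansion in a single matrix entry -/

section SelfConsistent

open scoped Matrix.Norms.L2Operator ComplexConjugate

variable {n : ℕ}

/-- The derivative of the resolvent entry `(j, i)` in the direction of the entry `{i, j}`,
up to sign. -/
noncomputable def pairTerm (R : Matrix (Fin n) (Fin n) ℂ) (i j : Fin n) : ℂ :=
  R j i * R j i + if i = j then 0 else R j j * R i i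

/-- With t the entry in question, the first bound is the remainder after the terms of order t and
t². The defect depends on t only to order t/n, which gives t²/n, and a second use of the resolvent
identity gives |t|³. The second bound is the cost of returning from `x0` to `x` in the coefficient
of t². -/
theorem norm_expansion_le (x : Sym2 (Fin n) → ℝ) (i j : Fin n) {z : ℂ} (hz : 0 < z.im) {b q : ℝ}
    (hb : b = z.im⁻¹) (hq : q = b ^ 2 / 4 + ‖z‖ * b + 1) {x0 : Sym2 (Fin n) → ℝ}
    (hx0 : x0 = Function.update x s(i, j) 0) :
    ‖(x s(i, j) : ℂ) * (conj (defect z (stieltjes (adj x) z)) * resolvent (adj x) z j i)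
      - x s(i, j) * (conj (defect z (stieltjes (adj x0) z)) * resolvent (adj x0) z j i)
      + (x s(i, j) : ℂ) ^ 2 *
        (conj (defect z (stieltjes (adj x0) z)) * pairTerm (resolvent (adj x0) z) i j)‖ ≤
      x s(i, j) ^ 2 * ((b / 2 + ‖z‖) * (2 * b ^ 2 / n) * b + |x s(i, j)| * (4 * b ^ 3 * q)) ∧
    ‖conj (defect z (stieltjes (adj x) z)) * pairTerm (resolvent (adj x) z) i j
      - conj (defect z (stieltjes (adj x0) z)) * pairTerm (resolvent (adj x0) z) i j‖ ≤
      |x s(i, j)| * ((b / 2 + ‖z‖) * (2 * b ^ 2 / n) * (2 * b ^ 2) + 8 * b ^ 3 * q) := by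
  set R := resolvent (adj x) z with hR
  set R0 := resolvent (adj x0) z with hR0
  set Q := defect z (stieltjes (adj x) z) with hQ
  set Q0 := defect z (stieltjes (adj x0) z) with hQ0
  set t := x s(i, j) with ht
  have hb0 : 0 ≤ b := hb ▸ inv_nonneg.2 hz.le
  have hq0 : 0 ≤ q := by rw [hq]; positivity
  have hRb : ∀ a c, ‖R a c‖ ≤ b := fun a c =>
    hb ▸ norm_resolvent_apply_le (adj_isHermitian x) hz a c
  have hR0b : ∀ a c, ‖R0 a c‖ ≤ b := fun a c =>
    hb ▸ norm_resolvent_apply_le (adj_isHermitian x0) hz a c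
  have hRR0 : ∀ a c, ‖R a c - R0 a c‖ ≤ |t| * (2 * b ^ 2) := fun a c => by
    rw [hb, hR0, hx0]
    exact norm_resolvent_sub_update_le x i j a c hz
  have hsb : ‖stieltjes (adj x) z‖ ≤ b := hb ▸ norm_stieltjes_le (adj_isHermitian x) hz
  have hs0b : ‖stieltjes (adj x0) z‖ ≤ b := hb ▸ norm_stieltjes_le (adj_isHermitian x0) hz
  have hQ0n : ‖Q0‖ ≤ q := hq ▸ norm_defect_le hs0b
  have hQQ0 : ‖conj Q - conj Q0‖ ≤ |t| * ((b / 2 + ‖z‖) * (2 * b ^ 2 / n)) := by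
    rw [← map_sub, RCLike.norm_conj]
    refine (norm_defect_sub_le hsb hs0b).trans ?_
    have := norm_stieltjes_sub_update_le x i j hz
    rw [← hx0, ← hb, ← ht] at this
    calc _ ≤ (b / 2 + ‖z‖) * (|t| * (2 * b ^ 2) / n) := by gcongr
      _ = _ := by ring
  have hQ0c : ‖conj Q0‖ ≤ q := by rwa [RCLike.norm_conj]
  have habs : |t| * |t| = t ^ 2 := by rw [← abs_mul, ← sq, abs_of_nonneg (sq_nonneg t)]
  have hmul : ∀ a c d f, ‖R0 a c * R0 d f‖ ≤ b ^ 2 := fun a c d f => by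
    rw [norm_mul, sq]
    exact mul_le_mul (hR0b _ _) (hR0b _ _) (norm_nonneg _) hb0
  have hmulR : ∀ a c d f, ‖R a c * R d f‖ ≤ b ^ 2 := fun a c d f => by
    rw [norm_mul, sq]
    exact mul_le_mul (hRb _ _) (hRb _ _) (norm_nonneg _) hb0
  have hdm : ∀ a c d f, ‖(R a c - R0 a c) * R0 d f‖ ≤ |t| * (2 * b ^ 3) := fun a c d f => by
    rw [norm_mul]
    calc _ ≤ (|t| * (2 * b ^ 2)) * b := mul_le_mul (hRR0 _ _) (hR0b _ _) (norm_nonneg _)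
            (by positivity)
      _ = _ := by ring
  have hdm' : ∀ a c d f, ‖R a c * (R d f - R0 d f)‖ ≤ |t| * (2 * b ^ 3) := fun a c d f => by
    rw [norm_mul]
    calc _ ≤ b * (|t| * (2 * b ^ 2)) := mul_le_mul (hRb _ _) (hRR0 _ _) (norm_nonneg _)
            (by positivity)
      _ = _ := by ring
  constructor
  · have hexp : (t : ℂ) * (conj Q * R j i) - t * (conj Q0 * R0 j i) +
        (t : ℂ) ^ 2 * (conj Q0 * pairTerm R0 i j) =
        t * ((conj Q - conj Q0) * R j i) - (t : ℂ) ^ 2 * (conj Q0 *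
          ((R j i - R0 j i) * R0 j i + if i = j then 0 else (R j j - R0 j j) * R0 i i)) := by
      have h := resolvent_sub_update_apply x i j j i hz
      rw [← hx0, ← hR, ← hR0, ← ht] at h
      -- The identity is exact and has R only once in each product; replacing that R by R0 leaves
      -- the terms with R - R0.
      have h' : R j i = R0 j i - t * (R j i * R0 j i + if i = j then 0 else R j j * R0 i i) := by
        linear_combination h
      unfold pairTerm
      split_ifs at h' ⊢
      · linear_combination (t : ℂ) * conj Q0 * h'
      · linear_combination (t : ℂ) * conj Q0 * h'
    rw [hexp]
    refine (norm_sub_le _ _).trans ?_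
    have e1 : ‖(t : ℂ) * ((conj Q - conj Q0) * R j i)‖ ≤
        t ^ 2 * ((b / 2 + ‖z‖) * (2 * b ^ 2 / n) * b) := by
      rw [norm_mul, norm_mul, Complex.norm_real, Real.norm_eq_abs]
      calc _ ≤ |t| * ((|t| * ((b / 2 + ‖z‖) * (2 * b ^ 2 / n))) * b) := by
            refine mul_le_mul_of_nonneg_left ?_ (abs_nonneg _)
            exact mul_le_mul hQQ0 (hRb _ _) (norm_nonneg _) (by positivity)
        _ = (|t| * |t|) * ((b / 2 + ‖z‖) * (2 * b ^ 2 / n) * b) := by ring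
        _ = _ := by rw [habs]
    have e2 : ‖(R j i - R0 j i) * R0 j i + if i = j then 0 else (R j j - R0 j j) * R0 i i‖ ≤
        |t| * (4 * b ^ 3) := by
      refine (norm_add_le _ _).trans ?_
      have h1 := hdm j i j i
      split_ifs
      · rw [norm_zero]
        have : 0 ≤ |t| * b ^ 3 := by positivity
        linarith
      · have h2 := hdm j j i i
        linarith
    have e3 : ‖(t : ℂ) ^ 2 * (conj Q0 *
          ((R j i - R0 j i) * R0 j i + if i = j then 0 else (R j j - R0 j j) * R0 i i))‖ ≤
        t ^ 2 * (|t| * (4 * b ^ 3 * q)) := by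
      rw [norm_mul, norm_mul, norm_pow, Complex.norm_real, Real.norm_eq_abs, sq_abs]
      refine mul_le_mul_of_nonneg_left ?_ (sq_nonneg _)
      calc _ ≤ q * (|t| * (4 * b ^ 3)) := mul_le_mul hQ0c e2 (norm_nonneg _) hq0
        _ = _ := by ring
    linarith
  · have hexp : conj Q * pairTerm R i j - conj Q0 * pairTerm R0 i j =
        (conj Q - conj Q0) * pairTerm R i j + conj Q0 * (pairTerm R i j - pairTerm R0 i j) := by
      ring
    rw [hexp]
    refine (norm_add_le _ _).trans ?_
    have e1 : ‖pairTerm R i j‖ ≤ 2 * b ^ 2 := by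
      unfold pairTerm
      refine (norm_add_le _ _).trans ?_
      have h1 := hmulR j i j i
      split_ifs
      · rw [norm_zero]
        nlinarith [sq_nonneg b]
      · have h2 := hmulR j j i i
        linarith
    have e2 : ‖pairTerm R i j - pairTerm R0 i j‖ ≤ |t| * (8 * b ^ 3) := by
      have h1 : ∀ a c d f, ‖R a c * R d f - R0 a c * R0 d f‖ ≤ |t| * (4 * b ^ 3) := by
        intro a c d f
        have : R a c * R d f - R0 a c * R0 d f =
            (R a c - R0 a c) * R0 d f + R a c * (R d f - R0 d f) := by ring
        rw [this]
        refine (norm_add_le _ _).trans ?_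
        linarith [hdm a c d f, hdm' a c d f]
      unfold pairTerm
      rw [add_sub_add_comm]
      refine (norm_add_le _ _).trans ?_
      have h2 := h1 j i j i
      split_ifs
      · rw [sub_zero, norm_zero]
        have : 0 ≤ |t| * b ^ 3 := by positivity
        linarith
      · have h3 := h1 j j i i
        linarith
    rw [norm_mul, norm_mul]
    calc _ ≤ (|t| * ((b / 2 + ‖z‖) * (2 * b ^ 2 / n))) * (2 * b ^ 2) + q * (|t| * (8 * b ^ 3)) := by
          refine add_le_add (mul_le_mul hQQ0 e1 (norm_nonneg _) (by positivity))
            (mul_le_mul hQ0c e2 (norm_nonneg _) hq0)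
      _ = _ := by ring

variable (μ : Sym2 (Fin n) → Measure ℝ) [∀ e, IsProbabilityMeasure (μ e)]

theorem continuous_defect_stieltjes {z : ℂ} (hz : 0 < z.im) :
    Continuous fun x : Sym2 (Fin n) → ℝ => defect z (stieltjes (adj x) z) := by
  have := continuous_stieltjes_adj (n := n) hz
  unfold defect
  fun_prop

theorem continuous_pairTerm {z : ℂ} (hz : 0 < z.im) (i j : Fin n) :
    Continuous fun x : Sym2 (Fin n) → ℝ => pairTerm (resolvent (adj x) z) i j := by
  have := fun a b => continuous_resolvent_adj_apply (n := n) hz a b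
  unfold pairTerm
  split_ifs
  · exact ((this j i).mul (this j i)).add continuous_const
  · exact ((this j i).mul (this j i)).add ((this j j).mul (this i i))

/-- An approximate integration by parts: for a small centred entry of variance v, multiplication by
the entry acts in mean like v times the derivative in its direction. The error carries the factor v,
so it remains small after summation over all n² positions. -/
theorem norm_integral_pair_le {K : ℝ} (hK1 : K ≤ 1)
    (h0 : ∀ e, ∫ x, x ∂μ e = 0) (hbd : ∀ e, ∀ᵐ x ∂μ e, |x| ≤ K) {z : ℂ} (hz : 0 < z.im)
    {b q : ℝ} (hb : b = z.im⁻¹) (hq : q = b ^ 2 / 4 + ‖z‖ * b + 1) (i j : Fin n) :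
    ‖∫ x, ((x s(i, j) : ℂ) *
        (conj (defect z (stieltjes (adj x) z)) * resolvent (adj x) z j i)) ∂Measure.pi μ
      + ((∫ t, t ^ 2 ∂μ s(i, j) : ℝ) : ℂ) * ∫ x, conj (defect z (stieltjes (adj x) z)) *
        pairTerm (resolvent (adj x) z) i j ∂Measure.pi μ‖ ≤
      (∫ t, t ^ 2 ∂μ s(i, j)) *
        ((12 * b ^ 3 * q + (b / 2 + ‖z‖) * (2 * b ^ 3 + 4 * b ^ 4)) * (K + 1 / n)) := by
  set e := s(i, j) with he
  set v := ∫ t, t ^ 2 ∂μ e with hv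
  have hb0 : 0 ≤ b := hb ▸ inv_nonneg.2 hz.le
  have hq0 : 0 ≤ q := by rw [hq]; positivity
  have hv0 : 0 ≤ v := integral_nonneg fun t => sq_nonneg t
  set up : (Sym2 (Fin n) → ℝ) → (Sym2 (Fin n) → ℝ) := fun x => Function.update x e 0 with hup
  have hupc : Continuous up := continuous_id.update e continuous_const
  set Q : (Sym2 (Fin n) → ℝ) → ℂ := fun x => conj (defect z (stieltjes (adj x) z)) with hQ
  have hQc : Continuous Q := Complex.continuous_conj.comp (continuous_defect_stieltjes hz)
  set r : (Sym2 (Fin n) → ℝ) → ℂ := fun x => resolvent (adj x) z j i with hr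
  have hrc : Continuous r := continuous_resolvent_adj_apply hz j i
  set D : (Sym2 (Fin n) → ℝ) → ℂ := fun x => pairTerm (resolvent (adj x) z) i j with hD
  have hDc : Continuous D := continuous_pairTerm hz i j
  have hxc : Continuous fun x : Sym2 (Fin n) → ℝ => (x e : ℂ) := by fun_prop
  have int : ∀ {F : (Sym2 (Fin n) → ℝ) → ℂ}, Continuous F → Integrable F (Measure.pi μ) :=
    fun hF => integrable_of_continuous_of_pi μ hbd hF
  -- The zeroth-order term vanishes by independence and centring; the second-order one, next,
  -- produces the variance.
  have a1 : ∫ x, (x e : ℂ) * (Q (up x) * r (up x)) ∂Measure.pi μ = 0 := by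
    have := integral_mul_update μ e (φ := fun t => (t : ℂ)) Complex.measurable_ofReal
      (F := fun x => Q x * r x) (hQc.mul hrc).measurable
    rw [this, integral_complex_ofReal, h0]
    simp
  have a2 : ∫ x, (x e : ℂ) ^ 2 * (Q (up x) * D (up x)) ∂Measure.pi μ =
      v * ∫ x, Q (up x) * D (up x) ∂Measure.pi μ := by
    have := integral_mul_update μ e (φ := fun t => (t : ℂ) ^ 2)
      (Complex.measurable_ofReal.pow_const 2)
      (F := fun x => Q x * D x) (hQc.mul hDc).measurable
    rw [this, hv, ← integral_complex_ofReal]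
    simp [hup]
  have i1 : Integrable (fun x => (x e : ℂ) * (Q x * r x)) (Measure.pi μ) := int (by fun_prop)
  have i2 : Integrable (fun x => (x e : ℂ) * (Q (up x) * r (up x))) (Measure.pi μ) :=
    int (by fun_prop)
  have i3 : Integrable (fun x => (x e : ℂ) ^ 2 * (Q (up x) * D (up x))) (Measure.pi μ) :=
    int (by fun_prop)
  have i4 : Integrable (fun x => Q x * D x) (Measure.pi μ) := int (by fun_prop)
  have i5 : Integrable (fun x => Q (up x) * D (up x)) (Measure.pi μ) := int (by fun_prop)
  have split : ∫ x, (x e : ℂ) * (Q x * r x) ∂Measure.pi μ + v * ∫ x, Q x * D x ∂Measure.pi μ =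
      ∫ x, ((x e : ℂ) * (Q x * r x) - (x e : ℂ) * (Q (up x) * r (up x)) +
        (x e : ℂ) ^ 2 * (Q (up x) * D (up x))) ∂Measure.pi μ +
      v * ∫ x, (Q x * D x - Q (up x) * D (up x)) ∂Measure.pi μ := by
    have i12 : Integrable (fun x => (x e : ℂ) * (Q x * r x) - (x e : ℂ) * (Q (up x) * r (up x)))
      (Measure.pi μ) := i1.sub i2
    rw [integral_add i12 i3, integral_sub i1 i2, a1, a2, integral_sub i4 i5]
    ring
  rw [split]
  have hae : ∀ᵐ x ∂Measure.pi μ, |x e| ≤ K := (ae_abs_le_of_pi μ hbd).mono fun x hx => hx e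
  set β := b / 2 + ‖z‖ with hβ
  have hβ0 : 0 ≤ β := by positivity
  have hK : 0 ≤ K := by
    obtain ⟨x, hx⟩ := hae.exists
    exact (abs_nonneg _).trans hx
  have b1 : ‖∫ x, ((x e : ℂ) * (Q x * r x) - (x e : ℂ) * (Q (up x) * r (up x)) +
        (x e : ℂ) ^ 2 * (Q (up x) * D (up x))) ∂Measure.pi μ‖ ≤
      v * (β * (2 * b ^ 2 / n) * b + K * (4 * b ^ 3 * q)) := by
    have hve : v = ∫ x, (x e) ^ 2 ∂Measure.pi μ := by
      rw [hv]
      exact (integral_comp_eval (X := fun _ : Sym2 (Fin n) => ℝ) (μ := μ) (i := e)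
        (f := fun t : ℝ => t ^ 2) (by fun_prop)).symm
    rw [hve, ← integral_mul_const]
    refine norm_integral_le_of_norm_le
      ((integrable_of_continuous_of_pi μ hbd (by fun_prop)).mul_const _) (hae.mono fun x hx => ?_)
    refine ((norm_expansion_le x i j hz hb hq rfl).1).trans ?_
    gcongr
  have b2 : ‖∫ x, (Q x * D x - Q (up x) * D (up x)) ∂Measure.pi μ‖ ≤
      K * (β * (2 * b ^ 2 / n) * (2 * b ^ 2) + 8 * b ^ 3 * q) := by
    refine (norm_integral_le_of_norm_le_const (C := K * (β * (2 * b ^ 2 / n) * (2 * b ^ 2) +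
      8 * b ^ 3 * q)) (hae.mono fun x hx => ?_)).trans (by simp)
    refine ((norm_expansion_le x i j hz hb hq rfl).2).trans ?_
    gcongr
  refine (norm_add_le _ _).trans ?_
  rw [norm_mul, Complex.norm_real, Real.norm_of_nonneg hv0]
  calc _ ≤ v * (β * (2 * b ^ 2 / n) * b + K * (4 * b ^ 3 * q)) +
        v * (K * (β * (2 * b ^ 2 / n) * (2 * b ^ 2) + 8 * b ^ 3 * q)) := by gcongr
    _ = v * (K * (12 * b ^ 3 * q) + (β * (2 * b ^ 3) + K * (β * (4 * b ^ 4))) * (1 / n)) := by ring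
    _ ≤ v * (K * (12 * b ^ 3 * q) + (β * (2 * b ^ 3) + 1 * (β * (4 * b ^ 4))) * (1 / n)) := by
      gcongr
    _ ≤ v * (K * (12 * b ^ 3 * q + β * (2 * b ^ 3 + 4 * b ^ 4)) +
        (12 * b ^ 3 * q + β * (2 * b ^ 3 + 4 * b ^ 4)) * (1 / n)) := by
      gcongr v * (K * ?_ + ?_ * (1 / n))
      · exact le_add_of_nonneg_right (by positivity)
      · have : 0 ≤ 12 * b ^ 3 * q := by positivity
        linarith
    _ = _ := by ring

/-- The normalized trace of (A - z) R = 1. -/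
theorem norm_one_add_mul_stieltjes_eq (hn : 0 < n) (x : Sym2 (Fin n) → ℝ) {z : ℂ}
    (hz : 0 < z.im) : z * stieltjes (adj x) z + 1 =
      (n : ℂ)⁻¹ * ∑ i, ∑ j, (x s(i, j) : ℂ) * resolvent (adj x) z j i := by
  have hn' : (n : ℂ) ≠ 0 := by exact_mod_cast hn.ne'
  have h1 : (adj x).map Complex.ofReal * resolvent (adj x) z =
      1 + z • resolvent (adj x) z := by
    have := sub_mul_resolvent (adj_isHermitian x) hz
    rw [sub_mul, sub_eq_iff_eq_add] at this
    rw [this]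
    congr 1
    ext a b
    simp
  have h2 := congrArg Matrix.trace h1
  rw [Matrix.trace_add, Matrix.trace_one, Matrix.trace_smul, Fintype.card_fin] at h2
  have h3 : ((adj x).map Complex.ofReal * resolvent (adj x) z).trace =
      ∑ i, ∑ j, (x s(i, j) : ℂ) * resolvent (adj x) z j i := by
    simp [Matrix.trace, Matrix.mul_apply, adj]
  rw [← h3, h2, stieltjes, Fintype.card_fin, mul_add, inv_mul_cancel₀ hn', smul_eq_mul]
  ring

theorem stieltjes_sq_eq (x : Sym2 (Fin n) → ℝ) (z : ℂ) : stieltjes (adj x) z ^ 2 / 4 =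
    (n : ℂ)⁻¹ * ∑ i, ∑ j, (1 / (4 * n)) * (resolvent (adj x) z j j * resolvent (adj x) z i i) := by
  simp_rw [← Finset.mul_sum, ← Finset.sum_mul]
  rw [← Finset.mul_sum, stieltjes, Fintype.card_fin]
  simp only [Matrix.trace, Matrix.diag]
  ring

theorem norm_pairTerm_sub_le (R : Matrix (Fin n) (Fin n) ℂ) (i j : Fin n) :
    ‖pairTerm R i j - R j j * R i i‖ ≤ ‖R j i‖ ^ 2 := by
  unfold pairTerm
  split_ifs with h
  · subst h
    simp
  · rw [add_sub_cancel_right, norm_mul, sq]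

/-- The Stieltjes transform of a random symmetric matrix with small centred entries of variance
close to `1 / (4 n)` almost solves the equation of the semicircle law of radius `1`. -/
theorem integral_norm_defect_sq_le (hn : 0 < n) {K θ : ℝ} (hK1 : K ≤ 1)
    (h0 : ∀ e, ∫ x, x ∂μ e = 0) (h2 : ∀ e, ∫ x, x ^ 2 ∂μ e ≤ 1 / (4 * n))
    (hθ : (n : ℝ)⁻¹ * ∑ i : Fin n, ∑ j : Fin n, (1 / (4 * n) - ∫ x, x ^ 2 ∂μ s(i, j)) ≤ θ)
    (hbd : ∀ e, ∀ᵐ x ∂μ e, |x| ≤ K) {z : ℂ} (hz : 0 < z.im)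
    {b q : ℝ} (hb : b = z.im⁻¹) (hq : q = b ^ 2 / 4 + ‖z‖ * b + 1) :
    ∫ x, ‖defect z (stieltjes (adj x) z)‖ ^ 2 ∂Measure.pi μ ≤
      (12 * b ^ 3 * q + (b / 2 + ‖z‖) * (2 * b ^ 3 + 4 * b ^ 4) + q * b ^ 2) *
        (K + 1 / n + θ) := by
  have hn0 : (0 : ℝ) < n := by exact_mod_cast hn
  have hb0 : 0 ≤ b := hb ▸ inv_nonneg.2 hz.le
  have hq0 : 0 ≤ q := by rw [hq]; positivity
  set v : Sym2 (Fin n) → ℝ := fun e => ∫ x, x ^ 2 ∂μ e with hv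
  have hv0 : ∀ e, 0 ≤ v e := fun e => integral_nonneg fun t => sq_nonneg t
  have hv4 : ∀ e, v e ≤ 1 / (4 * n) := h2
  have hK : 0 ≤ K := by
    obtain ⟨x, hx⟩ := (hbd s(⟨0, hn⟩, ⟨0, hn⟩)).exists
    exact (abs_nonneg _).trans hx
  have hθ0 : 0 ≤ θ := le_trans (mul_nonneg (by positivity) (Finset.sum_nonneg fun i _ =>
    Finset.sum_nonneg fun j _ => sub_nonneg.2 (hv4 _))) hθ
  set R := fun x : Sym2 (Fin n) → ℝ => resolvent (adj x) z with hR
  set Q := fun x : Sym2 (Fin n) → ℝ => defect z (stieltjes (adj x) z) with hQ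
  have hQc : Continuous Q := continuous_defect_stieltjes hz
  have hRc : ∀ i j, Continuous fun x => R x i j := fun i j => continuous_resolvent_adj_apply hz i j
  have hDc : ∀ i j, Continuous fun x => pairTerm (R x) i j := fun i j => continuous_pairTerm hz i j
  have hQn : ∀ x, ‖conj (Q x)‖ ≤ q := fun x => by
    rw [RCLike.norm_conj, hq]
    exact norm_defect_le (hb ▸ norm_stieltjes_le (adj_isHermitian x) hz)
  have int : ∀ {F : (Sym2 (Fin n) → ℝ) → ℂ}, Continuous F → Integrable F (Measure.pi μ) :=
    fun hF => integrable_of_continuous_of_pi μ hbd hF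
  -- Two discrepancies are collected here: the variances against 1/(4n), and `pairTerm` against the
  -- product of diagonal entries whose double sum is s²/4. The latter is the sum of the squared
  -- resolvent entries at worst, of which each column has only a bounded amount.
  set Err : (Sym2 (Fin n) → ℝ) → ℂ := fun x => (n : ℂ)⁻¹ * ∑ i, ∑ j,
    (((1 / (4 * n) - v s(i, j) : ℝ) : ℂ) * (R x j j * R x i i) -
      v s(i, j) * (pairTerm (R x) i j - R x j j * R x i i)) with hErr
  have hErrc : Continuous Err := by
    simp only [hErr]
    refine continuous_const.mul (continuous_finsetSum _ fun i _ =>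
      continuous_finsetSum _ fun j _ => ?_)
    have := hRc j j
    have := hRc i i
    have := hDc i j
    fun_prop
  have hErrn : ∀ x, ‖Err x‖ ≤ b ^ 2 * (θ + 1 / n) := by
    intro x
    have hRb : ∀ a c, ‖R x a c‖ ≤ b := fun a c => by
      rw [hb]
      exact norm_resolvent_apply_le (adj_isHermitian x) hz a c
    have hRs : ∀ i, ∑ j, ‖R x j i‖ ^ 2 ≤ b ^ 2 := fun i =>
      (sum_norm_sq_col_le _ i).trans (by
        rw [hb]
        have := norm_resolvent_le (adj_isHermitian x) hz
        gcongr)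
    rw [hErr]
    simp only [norm_mul, norm_inv, Complex.norm_natCast]
    calc _ ≤ (n : ℝ)⁻¹ * ∑ i, ∑ j, ((1 / (4 * n) - v s(i, j)) * b ^ 2 +
          1 / (4 * n) * ‖R x j i‖ ^ 2) := by
          gcongr
          refine (norm_sum_le _ _).trans (Finset.sum_le_sum fun i _ => (norm_sum_le _ _).trans
            (Finset.sum_le_sum fun j _ => (norm_sub_le _ _).trans ?_))
          rw [norm_mul, norm_mul, norm_mul, Complex.norm_real, Complex.norm_real,
            Real.norm_of_nonneg (sub_nonneg.2 (hv4 _)), Real.norm_of_nonneg (hv0 _)]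
          refine add_le_add (mul_le_mul_of_nonneg_left ?_ (sub_nonneg.2 (hv4 _)))
            (mul_le_mul (hv4 _) (norm_pairTerm_sub_le _ _ _) (norm_nonneg _) (by positivity))
          rw [sq]
          exact mul_le_mul (hRb _ _) (hRb _ _) (norm_nonneg _) hb0
      _ = b ^ 2 * ((n : ℝ)⁻¹ * ∑ i : Fin n, ∑ j : Fin n, (1 / (4 * n) - v s(i, j))) +
          (n : ℝ)⁻¹ * (1 / (4 * n)) * ∑ i, ∑ j, ‖R x j i‖ ^ 2 := by
          simp only [Finset.sum_add_distrib, ← Finset.sum_mul, ← Finset.mul_sum]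
          ring
      _ ≤ b ^ 2 * θ + (n : ℝ)⁻¹ * (1 / (4 * n)) * ∑ i : Fin n, b ^ 2 := by
          gcongr with i
          exact hRs i
      _ = b ^ 2 * (θ + (1 / 4) * (1 / n)) := by
          simp
          field_simp
      _ ≤ _ := by
          gcongr
          have : 0 ≤ 1 / (n : ℝ) := by positivity
          linarith
  -- Only one factor of |Q|² is expanded. The conjugate of Q stays as a part of the function that is
  -- integrated against the entry, which yields the second moment without a separate concentration
  -- argument.
  have hpt : ∀ x, ((‖Q x‖ ^ 2 : ℝ) : ℂ) = (n : ℂ)⁻¹ * (∑ i, ∑ j,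
      ((x s(i, j) : ℂ) * (conj (Q x) * R x j i) +
        v s(i, j) * (conj (Q x) * pairTerm (R x) i j))) + conj (Q x) * Err x := by
    intro x
    have e1 : ((‖Q x‖ ^ 2 : ℝ) : ℂ) = conj (Q x) * Q x := by
      rw [Complex.conj_mul']
      norm_cast
    have e2 : Q x = (n : ℂ)⁻¹ * (∑ i, ∑ j, (x s(i, j) : ℂ) * R x j i) +
        (n : ℂ)⁻¹ * (∑ i, ∑ j, (1 / (4 * n)) * (R x j j * R x i i)) := by
      rw [← stieltjes_sq_eq, ← norm_one_add_mul_stieltjes_eq hn x hz]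
      simp only [hQ, defect]
      ring
    rw [e1]
    generalize conj (Q x) = c
    rw [e2]
    simp only [hErr]
    rw [← mul_add, mul_left_comm c, mul_left_comm c, ← mul_add]
    congr 1
    simp only [Finset.mul_sum, ← Finset.sum_add_distrib]
    refine Finset.sum_congr rfl fun i _ => Finset.sum_congr rfl fun j _ => ?_
    push_cast
    ring
  set C := 12 * b ^ 3 * q + (b / 2 + ‖z‖) * (2 * b ^ 3 + 4 * b ^ 4) with hC
  have hC0 : 0 ≤ C := by positivity
  have hfin : ((∫ x, ‖Q x‖ ^ 2 ∂Measure.pi μ : ℝ) : ℂ) = (n : ℂ)⁻¹ * (∑ i, ∑ j,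
      (∫ x, (x s(i, j) : ℂ) * (conj (Q x) * R x j i) ∂Measure.pi μ +
        v s(i, j) * ∫ x, conj (Q x) * pairTerm (R x) i j ∂Measure.pi μ)) +
      ∫ x, conj (Q x) * Err x ∂Measure.pi μ := by
    have hcQ : Continuous fun x => conj (Q x) := Complex.continuous_conj.comp hQc
    have hF1 : ∀ i j, Continuous fun x : Sym2 (Fin n) → ℝ =>
        (x s(i, j) : ℂ) * (conj (Q x) * R x j i) := fun i j => by
      have := hRc j i
      fun_prop
    have hF2 : ∀ i j, Continuous fun x : Sym2 (Fin n) → ℝ =>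
        (v s(i, j) : ℂ) * (conj (Q x) * pairTerm (R x) i j) := fun i j => by
      have := hDc i j
      fun_prop
    rw [← integral_complex_ofReal]
    simp_rw [hpt]
    have hF12 : ∀ i, Continuous fun x : Sym2 (Fin n) → ℝ => ∑ j,
        ((x s(i, j) : ℂ) * (conj (Q x) * R x j i) +
          v s(i, j) * (conj (Q x) * pairTerm (R x) i j)) :=
      fun i => continuous_finsetSum _ fun j _ => (hF1 i j).add (hF2 i j)
    have hS : Integrable (fun x : Sym2 (Fin n) → ℝ => (n : ℂ)⁻¹ * ∑ i, ∑ j,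
        ((x s(i, j) : ℂ) * (conj (Q x) * R x j i) +
          v s(i, j) * (conj (Q x) * pairTerm (R x) i j))) (Measure.pi μ) :=
      int (continuous_const.mul (continuous_finsetSum _ fun i _ => hF12 i))
    have hE : Integrable (fun x => conj (Q x) * Err x) (Measure.pi μ) := int (hcQ.mul hErrc)
    rw [integral_add hS hE, integral_const_mul, integral_finsetSum _ fun i _ => int (hF12 i)]
    congr 2
    refine Finset.sum_congr rfl fun i _ => ?_
    refine (integral_finsetSum _ fun j _ => int ((hF1 i j).add (hF2 i j))).trans ?_
    refine Finset.sum_congr rfl fun j _ => ?_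
    refine (integral_add (int (hF1 i j)) (int (hF2 i j))).trans ?_
    rw [integral_const_mul]
  have hnn : 0 ≤ ∫ x, ‖Q x‖ ^ 2 ∂Measure.pi μ := integral_nonneg fun x => by positivity
  calc ∫ x, ‖Q x‖ ^ 2 ∂Measure.pi μ = ‖((∫ x, ‖Q x‖ ^ 2 ∂Measure.pi μ : ℝ) : ℂ)‖ := by
        rw [Complex.norm_real, Real.norm_of_nonneg hnn]
    _ ≤ (n : ℝ)⁻¹ * (∑ i : Fin n, ∑ j : Fin n, v s(i, j) * (C * (K + 1 / n))) +
        q * (b ^ 2 * (θ + 1 / n)) := by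
        rw [hfin]
        refine (norm_add_le _ _).trans (add_le_add ?_ ?_)
        · rw [norm_mul, norm_inv, Complex.norm_natCast]
          gcongr
          refine (norm_sum_le _ _).trans (Finset.sum_le_sum fun i _ => (norm_sum_le _ _).trans
            (Finset.sum_le_sum fun j _ => ?_))
          exact norm_integral_pair_le μ hK1 h0 hbd hz hb hq i j
        · refine (norm_integral_le_of_norm_le_const (C := q * (b ^ 2 * (θ + 1 / n)))
            (ae_of_all _ fun x => ?_)).trans (by simp)
          rw [norm_mul]
          exact mul_le_mul (hQn x) (hErrn x) (norm_nonneg _) hq0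
    _ ≤ (n : ℝ)⁻¹ * (∑ i : Fin n, ∑ j : Fin n, 1 / (4 * n) * (C * (K + 1 / n))) +
        q * (b ^ 2 * (θ + 1 / n)) := by
        gcongr with i _ j _
        exact hv4 _
    _ = (1 / 4) * (C * (K + 1 / n)) + q * b ^ 2 * (θ + 1 / n) := by
        simp
        field_simp
    _ ≤ C * (K + 1 / n + θ) + q * b ^ 2 * (K + 1 / n + θ) := by
        have h1 : 0 ≤ C * (K + 1 / n) := by positivity
        have h2 : 0 ≤ C * θ := by positivity
        have h3 : 0 ≤ q * b ^ 2 * K := by positivity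
        nlinarith
    _ = _ := by ring

end SelfConsistent

end WeightedChungLu

namespace WeightedChungLu

/-! ### From Stieltjes transforms to linear statistics -/

/-- With y = s/2 + E and a² = E² - 1, the quadratic is (y - a)(y + a), so y is within √κ of a root.
Inside the spectrum a is imaginary, and since Im y ≥ 0, being close to the lower root forces both to
be small. Outside, a is real and Im y itself is small. -/
theorem abs_im_sub_sqrt_le {s : ℂ} {E κ : ℝ} (hs : 0 ≤ s.im)
    (h : ‖s ^ 2 / 4 + E * s + 1‖ ≤ κ) : |s.im - 2 * √(1 - E ^ 2)| ≤ 2 * √κ := by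
  set y : ℂ := s / 2 + E with hy
  have hyim : y.im = s.im / 2 := by simp [hy]
  have hκ : 0 ≤ κ := (norm_nonneg _).trans h
  have key : ∀ a : ℂ, a ^ 2 = (E : ℂ) ^ 2 - 1 → ‖y - a‖ ≤ √κ ∨ ‖y + a‖ ≤ √κ := by
    intro a ha
    have hprod : (y - a) * (y + a) = s ^ 2 / 4 + E * s + 1 := by
      have : (y - a) * (y + a) = y ^ 2 - a ^ 2 := by ring
      rw [this, ha, hy]
      ring
    by_contra! hcon
    have h1 : κ < ‖y - a‖ * ‖y + a‖ := by
      calc κ = √κ * √κ := (Real.mul_self_sqrt hκ).symm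
        _ < _ := mul_lt_mul'' hcon.1 hcon.2 (Real.sqrt_nonneg _) (Real.sqrt_nonneg _)
    rw [← norm_mul, hprod] at h1
    exact absurd h (not_le.2 h1)
  rcases le_or_gt (E ^ 2) 1 with hE | hE
  · set β := √(1 - E ^ 2) with hβ
    have hβ0 : 0 ≤ β := Real.sqrt_nonneg _
    have hβ2 : β ^ 2 = 1 - E ^ 2 := Real.sq_sqrt (by linarith)
    have ha : ((β : ℂ) * Complex.I) ^ 2 = (E : ℂ) ^ 2 - 1 := by
      have : ((β : ℂ)) ^ 2 = 1 - (E : ℂ) ^ 2 := by exact_mod_cast hβ2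
      rw [mul_pow, Complex.I_sq, this]
      ring
    rcases key _ ha with h1 | h1
    · have h2 := (Complex.abs_im_le_norm _).trans h1
      simp [hyim] at h2
      rw [abs_le] at h2 ⊢
      constructor <;> linarith
    · have h2 := (Complex.abs_im_le_norm _).trans h1
      simp [hyim] at h2
      rw [abs_le] at h2 ⊢
      constructor <;> linarith
  · have h0 : √(1 - E ^ 2) = 0 := Real.sqrt_eq_zero_of_nonpos (by linarith)
    have hc2 : (√(E ^ 2 - 1)) ^ 2 = E ^ 2 - 1 := Real.sq_sqrt (by linarith)
    have ha : ((√(E ^ 2 - 1) : ℝ) : ℂ) ^ 2 = (E : ℂ) ^ 2 - 1 := by exact_mod_cast hc2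
    rw [h0, mul_zero, sub_zero]
    rcases key _ ha with h1 | h1
    · have h2 := (Complex.abs_im_le_norm _).trans h1
      simp [hyim] at h2
      rw [abs_le] at h2 ⊢
      constructor <;> linarith
    · have h2 := (Complex.abs_im_le_norm _).trans h1
      simp [hyim] at h2
      rw [abs_le] at h2 ⊢
      constructor <;> linarith

/-- Moves the spectral parameter from E + iη to the real point E, at the cost η ‖s‖. The resulting
bound is linear in the defect, so that only its mean is needed later. -/
theorem abs_im_sub_sqrt_le_of_defect {s : ℂ} {E η B δ : ℝ} (hs : 0 ≤ s.im) (hη : 0 < η)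
    (hη1 : η ≤ 1) (hE : |E| ≤ B) (hδ : 0 < δ) :
    |s.im - 2 * √(1 - E ^ 2)| ≤
      2 * √(η * (4 * B + 9)) + 2 * δ + (10 / δ) * ‖defect (E + η * Complex.I) s‖ := by
  set Q := ‖defect (E + η * Complex.I) s‖ with hQ
  have hQ0 : 0 ≤ Q := norm_nonneg _
  have hB : 0 ≤ B := (abs_nonneg _).trans hE
  have hz : ‖(E + η * Complex.I : ℂ)‖ ≤ B + 1 := by
    refine (norm_add_le _ _).trans ?_
    rw [norm_mul, Complex.norm_real, Complex.norm_real, Complex.norm_I, mul_one,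
      Real.norm_eq_abs, Real.norm_eq_abs, abs_of_pos hη]
    linarith
  -- The equation itself bounds s: otherwise the term s²/4 would outweigh all the others. The
  -- trivial bound 1/η would be useless here, since s gets multiplied by η.
  have hsb : ‖s‖ ≤ 4 * Q + 4 * B + 9 := by
    by_contra! hcon
    have h1 : ‖s‖ ^ 2 / 4 ≤ Q + (B + 1) * ‖s‖ + 1 := by
      have : s ^ 2 / 4 = defect (E + η * Complex.I) s - (E + η * Complex.I) * s - 1 := by
        unfold defect
        ring
      have h2 : ‖s ^ 2 / 4‖ ≤ Q + (B + 1) * ‖s‖ + 1 := by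
        rw [this]
        refine (norm_sub_le _ _).trans ?_
        have := norm_sub_le (defect (E + η * Complex.I) s) ((E + η * Complex.I) * s)
        rw [norm_mul] at this
        have := mul_le_mul_of_nonneg_right hz (norm_nonneg s)
        rw [norm_one]
        linarith
      rw [norm_div, norm_pow] at h2
      norm_num at h2
      exact h2
    nlinarith
  have hκ : ‖s ^ 2 / 4 + E * s + 1‖ ≤ 5 * Q + η * (4 * B + 9) := by
    have : s ^ 2 / 4 + E * s + 1 = defect (E + η * Complex.I) s - η * Complex.I * s := by
      unfold defect
      ring
    rw [this]
    refine (norm_sub_le _ _).trans ?_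
    rw [norm_mul, norm_mul, Complex.norm_real, Complex.norm_I, Real.norm_eq_abs, abs_of_pos hη,
      mul_one]
    have h1 := mul_le_mul_of_nonneg_left hsb hη.le
    have h2 := mul_le_mul_of_nonneg_right hη1 hQ0
    nlinarith
  refine (abs_im_sub_sqrt_le hs hκ).trans ?_
  have h1 : √(5 * Q + η * (4 * B + 9)) ≤ √(5 * Q) + √(η * (4 * B + 9)) := by
    rw [Real.sqrt_le_left (by positivity), add_sq, Real.sq_sqrt (by positivity),
      Real.sq_sqrt (by positivity)]
    have : 0 ≤ 2 * √(5 * Q) * √(η * (4 * B + 9)) := by positivity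
    linarith
  have h2 : √(5 * Q) ≤ δ + (5 / δ) * Q := by
    rw [Real.sqrt_le_left (by positivity)]
    have : (δ + 5 / δ * Q) ^ 2 = δ ^ 2 + 10 * Q + (5 / δ * Q) ^ 2 := by
      field_simp
      ring
    rw [this]
    nlinarith [sq_nonneg δ, sq_nonneg (5 / δ * Q)]
  have h3 : (10 / δ) * Q = 2 * ((5 / δ) * Q) := by ring
  rw [h3]
  linarith

/-- The Stieltjes transform of the uniform distribution on a finite family of reals. -/
noncomputable def empStieltjes {ι : Type*} [Fintype ι] (lam : ι → ℝ) (z : ℂ) : ℂ :=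
  (Fintype.card ι : ℂ)⁻¹ * ∑ i, ((lam i : ℂ) - z)⁻¹

theorem im_inv_ofReal_sub (l E η : ℝ) :
    ((l : ℂ) - (E + η * Complex.I))⁻¹.im = η / ((E - l) ^ 2 + η ^ 2) := by
  rw [Complex.inv_im, Complex.normSq_apply]
  simp
  ring

theorem continuous_poisson {η : ℝ} (hη : 0 < η) (l : ℝ) :
    Continuous fun E : ℝ => η / ((E - l) ^ 2 + η ^ 2) :=
  continuous_const.div (by fun_prop) fun E => by positivity

/-- Poisson smoothing approximates a compactly supported continuous function uniformly. -/
theorem exists_forall_abs_sub_poisson_le {g : ℝ → ℝ} (hg : Continuous g)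
    (hc : HasCompactSupport g) {ε : ℝ} (hε : 0 < ε) :
    ∃ η₀ > 0, ∀ η, 0 < η → η < η₀ → ∀ l : ℝ,
      |g l - Real.pi⁻¹ * ∫ E, g E * (η / ((E - l) ^ 2 + η ^ 2))| ≤ ε := by
  obtain ⟨M, hM⟩ := hg.bounded_above_of_compact_support hc
  have hM0 : 0 ≤ M := (norm_nonneg _).trans (hM 0)
  have huc := hc.uniformContinuous_of_continuous hg
  obtain ⟨δ, hδ, hgδ⟩ := Metric.uniformContinuous_iff.1 huc (ε / 2) (by positivity)
  have hint : Integrable fun u : ℝ => (1 + u ^ 2)⁻¹ := integrable_inv_one_add_sq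
  have htail : Tendsto (fun A : ℝ => ∫ u : ℝ, Set.indicator {u | A ≤ |u|}
      (fun u => (1 + u ^ 2)⁻¹) u) atTop (𝓝 (∫ _ : ℝ, (0 : ℝ))) := by
    refine tendsto_integral_filter_of_dominated_convergence (fun u => (1 + u ^ 2)⁻¹)
      (Eventually.of_forall fun A => ?_) (Eventually.of_forall fun A => ae_of_all _ fun u => ?_)
      hint (ae_of_all _ fun u => ?_)
    · exact hint.aestronglyMeasurable.indicator (measurableSet_le measurable_const
        measurable_norm)
    · rw [Real.norm_of_nonneg (Set.indicator_nonneg (fun u _ => by positivity) u)]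
      exact Set.indicator_le_self' (fun _ _ => by positivity) u
    · refine tendsto_const_nhds.congr' ?_
      filter_upwards [eventually_gt_atTop |u|] with A hA
      rw [Set.indicator_of_notMem]
      simpa using hA
  rw [integral_zero] at htail
  -- The tail of the kernel is weighted by 2M, the largest possible oscillation of g; the extra 1 in
  -- the denominator guards against M = 0.
  have hev := htail.eventually (gt_mem_nhds (show (0 : ℝ) < ε / (2 * (2 * M + 1)) by positivity))
  obtain ⟨A, hA, hA1⟩ := (hev.and (eventually_gt_atTop 0)).exists
  refine ⟨δ / A, by positivity, fun η hη hη0 l => ?_⟩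
  -- The substitution E = l + η u makes the kernel independent of l and η, hence the estimate
  -- uniform in l.
  have hsub : ∫ E, g E * (η / ((E - l) ^ 2 + η ^ 2)) = ∫ u, g (l + η * u) * (1 + u ^ 2)⁻¹ := by
    have h1 := integral_add_left_eq_self (μ := volume)
      (fun E => g E * (η / ((E - l) ^ 2 + η ^ 2))) l
    have h2 := Measure.integral_comp_mul_left
      (fun E => g (l + E) * (η / ((l + E - l) ^ 2 + η ^ 2))) η
    rw [← h1]
    rw [abs_of_pos (inv_pos.2 hη), smul_eq_mul] at h2
    have h3 : ∫ x, g (l + x) * (η / ((l + x - l) ^ 2 + η ^ 2)) =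
        η * ∫ u, g (l + η * u) * (η / ((l + η * u - l) ^ 2 + η ^ 2)) := by
      rw [h2, mul_inv_cancel_left₀ hη.ne']
    rw [h3, ← integral_const_mul]
    refine integral_congr_ae (ae_of_all _ fun u => ?_)
    simp only [add_sub_cancel_left]
    field_simp
    ring_nf
  have hi1 : Integrable fun u : ℝ => g (l + η * u) * (1 + u ^ 2)⁻¹ :=
    hint.bdd_mul (by fun_prop) (ae_of_all _ fun u => hM _)
  have hgl : g l = Real.pi⁻¹ * ∫ u : ℝ, g l * (1 + u ^ 2)⁻¹ := by
    rw [integral_const_mul, integral_univ_inv_one_add_sq]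
    field_simp
  rw [hsub]
  conv_lhs => rw [hgl]
  rw [← mul_sub, ← integral_sub (hint.const_mul _) hi1, abs_mul,
    abs_of_pos (inv_pos.2 Real.pi_pos)]
  have hi2 : Integrable fun u : ℝ => 2 * M * Set.indicator {u | A ≤ |u|}
      (fun u => (1 + u ^ 2)⁻¹) u :=
    (hint.indicator (measurableSet_le measurable_const measurable_norm)).const_mul _
  have hbound : ‖∫ u : ℝ, (g l * (1 + u ^ 2)⁻¹ - g (l + η * u) * (1 + u ^ 2)⁻¹)‖ ≤
      ∫ u : ℝ, (ε / 2 * (1 + u ^ 2)⁻¹ + 2 * M * Set.indicator {u | A ≤ |u|}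
        (fun u => (1 + u ^ 2)⁻¹) u) := by
    refine norm_integral_le_of_norm_le ?_ (ae_of_all _ fun u => ?_)
    · exact (hint.const_mul _).add hi2
    · rw [← sub_mul, norm_mul, Real.norm_of_nonneg (by positivity : (0 : ℝ) ≤ (1 + u ^ 2)⁻¹)]
      have hp : (0 : ℝ) < (1 + u ^ 2)⁻¹ := by positivity
      by_cases hu : A ≤ |u|
      · rw [Set.indicator_of_mem (show u ∈ {u | A ≤ |u|} from hu), ← add_mul]
        refine mul_le_mul_of_nonneg_right ((norm_sub_le _ _).trans ?_) hp.le
        linarith [hM l, hM (l + η * u)]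
      · rw [Set.indicator_of_notMem (show u ∉ {u | A ≤ |u|} from hu), mul_zero, add_zero]
        refine mul_le_mul_of_nonneg_right ?_ hp.le
        have := hgδ (a := l) (b := l + η * u) (by
          rw [Real.dist_eq, sub_add_cancel_left, abs_neg, abs_mul, abs_of_pos hη]
          have h1 : |u| < A := not_le.1 hu
          calc η * |u| ≤ η * A := by gcongr
            _ < δ / A * A := by gcongr
            _ = δ := by field_simp)
        exact this.le
  rw [integral_add (hint.const_mul _) hi2, integral_const_mul, integral_const_mul,
    integral_univ_inv_one_add_sq, Real.norm_eq_abs] at hbound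
  have h3 : 2 * M * ∫ u : ℝ, Set.indicator {u | A ≤ |u|} (fun u => (1 + u ^ 2)⁻¹) u ≤ ε / 2 := by
    calc _ ≤ 2 * M * (ε / (2 * (2 * M + 1))) := by gcongr
      _ = (ε / 2) * (2 * M / (2 * M + 1)) := by field_simp
      _ ≤ (ε / 2) * 1 := by
        gcongr
        rw [div_le_one (by positivity)]
        linarith
      _ = _ := mul_one _
  calc _ ≤ Real.pi⁻¹ * (ε / 2 * Real.pi + ε / 2) := by gcongr; linarith
    _ = ε / 2 + Real.pi⁻¹ * (ε / 2) := by field_simp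
    _ ≤ ε / 2 + 1 * (ε / 2) := by
      gcongr
      exact inv_le_one_of_one_le₀ (by linarith [Real.pi_gt_three])
    _ = ε := by ring

end WeightedChungLu

namespace WeightedChungLu

/-! ### Linear statistics of finite families of reals -/

theorem im_empStieltjes {ι : Type*} [Fintype ι] (lam : ι → ℝ) (E η : ℝ) :
    (empStieltjes lam (E + η * Complex.I)).im =
      (Fintype.card ι : ℝ)⁻¹ * ∑ i, η / ((E - lam i) ^ 2 + η ^ 2) := by
  have : empStieltjes lam (E + η * Complex.I) = ((Fintype.card ι : ℝ)⁻¹ : ℝ) *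
      ∑ i, ((lam i : ℂ) - (E + η * Complex.I))⁻¹ := by
    simp [empStieltjes]
  rw [this, Complex.im_ofReal_mul, Complex.im_sum]
  simp_rw [im_inv_ofReal_sub]

theorem norm_empStieltjes_le {ι : Type*} [Fintype ι] (lam : ι → ℝ) {z : ℂ} (hz : 0 < z.im) :
    ‖empStieltjes lam z‖ ≤ z.im⁻¹ := by
  rw [empStieltjes, norm_mul, norm_inv, Complex.norm_natCast]
  have h : ‖∑ i, ((lam i : ℂ) - z)⁻¹‖ ≤ Fintype.card ι * z.im⁻¹ := by
    refine (norm_sum_le _ _).trans ?_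
    refine (Finset.sum_le_sum fun i _ => norm_inv_ofReal_sub_le hz _).trans ?_
    simp
  rcases (Fintype.card ι).eq_zero_or_pos with h0 | h0
  · simp [h0, hz.le]
  · have : (0 : ℝ) < Fintype.card ι := by exact_mod_cast h0
    calc _ ≤ (Fintype.card ι : ℝ)⁻¹ * (Fintype.card ι * z.im⁻¹) := by gcongr
      _ = _ := by field_simp

/-- The density of the semicircle law of radius `1`. -/
theorem semicircleDensity_zero_one (x : ℝ) :
    semicircleDensity 0 1 x = 2 / Real.pi * √(1 - x ^ 2) := by
  unfold semicircleDensity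
  split_ifs with h
  · norm_num
  · have : 1 - x ^ 2 ≤ 0 := by
      by_contra! h'
      have := abs_lt.1 ((sq_lt_one_iff_abs_lt_one x).1 (by linarith))
      exact h ⟨by linarith, by linarith⟩
    rw [Real.sqrt_eq_zero_of_nonpos this, mul_zero]

theorem continuous_semicircleDensity_zero_one : Continuous (semicircleDensity 0 1) := by
  rw [funext semicircleDensity_zero_one]
  fun_prop

theorem measurable_norm_defect_empStieltjes {Ω ι : Type*} [MeasurableSpace Ω] [Fintype ι]
    {lam : Ω → ι → ℝ} (hlam : ∀ i, Measurable fun w => lam w i) (η : ℝ) :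
    Measurable fun p : Ω × ℝ => ‖defect (p.2 + η * Complex.I)
      (empStieltjes (lam p.1) (p.2 + η * Complex.I))‖ := by
  have h1 : Measurable fun p : Ω × ℝ => ((p.2 : ℂ) + η * Complex.I) := by fun_prop
  have h2 : ∀ i, Measurable fun p : Ω × ℝ => ((lam p.1 i : ℝ) : ℂ) := fun i =>
    Complex.measurable_ofReal.comp ((hlam i).comp measurable_fst)
  have h3 : Measurable fun p : Ω × ℝ => empStieltjes (lam p.1) (p.2 + η * Complex.I) :=
    measurable_const.mul (Finset.measurable_sum _ fun i _ => ((h2 i).sub h1).inv)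
  exact ((((h3.pow_const 2).div_const 4).add (h1.mul h3)).add_const 1).norm

/-- Poisson smoothing of g at the points of the family equals π⁻¹ ∫ g Im s, and Im s is compared
with 2√(1 - E²), which is π times the semicircle density. The error is an integral over the support,
so it can be averaged over the randomness by Fubini. -/
theorem abs_linearStatistic_sub_le {ι : Type*} [Fintype ι] (lam : ι → ℝ) {g : ℝ → ℝ}
    (hg : Continuous g) (hc : HasCompactSupport g) {M B ε δ η : ℝ} (hM : ∀ x, |g x| ≤ M)
    (hB : ∀ x, B < |x| → g x = 0) (hη : 0 < η) (hη1 : η ≤ 1) (hδ : 0 < δ) (hε : 0 ≤ ε)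
    (happ : ∀ l : ℝ, |g l - Real.pi⁻¹ * ∫ E, g E * (η / ((E - l) ^ 2 + η ^ 2))| ≤ ε) :
    |(Fintype.card ι : ℝ)⁻¹ * ∑ i, g (lam i) - ∫ E, g E * semicircleDensity 0 1 E| ≤
      ε + Real.pi⁻¹ * ∫ E in Set.Icc (-B) B, M * (2 * √(η * (4 * B + 9)) + 2 * δ + (10 / δ) *
        ‖defect (E + η * Complex.I) (empStieltjes lam (E + η * Complex.I))‖) := by
  have hM0 : 0 ≤ M := (abs_nonneg _).trans (hM 0)
  have hgi : ∀ {f : ℝ → ℝ}, Continuous f → Integrable fun E => g E * f E := fun hf =>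
    (hg.mul hf).integrable_of_hasCompactSupport hc.mul_right
  have hcont : Continuous fun E : ℝ => (empStieltjes lam (E + η * Complex.I)).im := by
    simp_rw [im_empStieltjes]
    exact continuous_const.mul (continuous_finsetSum _ fun i _ => continuous_poisson hη _)
  have hsm : (Fintype.card ι : ℝ)⁻¹ * ∑ i, Real.pi⁻¹ *
      ∫ E, g E * (η / ((E - lam i) ^ 2 + η ^ 2)) =
      Real.pi⁻¹ * ∫ E, g E * (empStieltjes lam (E + η * Complex.I)).im := by
    rw [← Finset.mul_sum, ← integral_finsetSum _ fun i _ => hgi (continuous_poisson hη _),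
      mul_left_comm, ← integral_const_mul]
    congr 2
    ext E
    rw [im_empStieltjes, ← Finset.mul_sum]
    ring
  have h1 : |(Fintype.card ι : ℝ)⁻¹ * ∑ i, g (lam i) -
      Real.pi⁻¹ * ∫ E, g E * (empStieltjes lam (E + η * Complex.I)).im| ≤ ε := by
    rw [← hsm, ← mul_sub, ← Finset.sum_sub_distrib, abs_mul, abs_inv, Nat.abs_cast]
    have hs : |∑ i, (g (lam i) - Real.pi⁻¹ * ∫ E, g E * (η / ((E - lam i) ^ 2 + η ^ 2)))| ≤
        Fintype.card ι * ε := by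
      refine (Finset.abs_sum_le_sum_abs _ _).trans ((Finset.sum_le_sum fun i _ =>
        happ (lam i)).trans ?_)
      simp
    rcases (Fintype.card ι).eq_zero_or_pos with h0 | h0
    · simpa [h0] using hε
    · have : (0 : ℝ) < Fintype.card ι := by exact_mod_cast h0
      calc _ ≤ (Fintype.card ι : ℝ)⁻¹ * (Fintype.card ι * ε) := by gcongr
        _ = _ := by field_simp
  have h2 : |(Real.pi⁻¹ * ∫ E, g E * (empStieltjes lam (E + η * Complex.I)).im) -
      ∫ E, g E * semicircleDensity 0 1 E| ≤
      Real.pi⁻¹ * ∫ E in Set.Icc (-B) B, M * (2 * √(η * (4 * B + 9)) + 2 * δ + (10 / δ) *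
        ‖defect (E + η * Complex.I) (empStieltjes lam (E + η * Complex.I))‖) := by
    have e1 : ∫ E, g E * semicircleDensity 0 1 E =
        Real.pi⁻¹ * ∫ E, g E * (2 * √(1 - E ^ 2)) := by
      rw [← integral_const_mul]
      congr 1
      ext E
      rw [semicircleDensity_zero_one]
      ring
    rw [e1, ← mul_sub, ← integral_sub (hgi hcont) (hgi (by fun_prop)), abs_mul,
      abs_of_pos (inv_pos.2 Real.pi_pos)]
    refine mul_le_mul_of_nonneg_left ?_ (inv_nonneg.2 Real.pi_pos.le)
    have e2 : ∫ E, (g E * (empStieltjes lam (E + η * Complex.I)).im - g E * (2 * √(1 - E ^ 2))) =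
        ∫ E in Set.Icc (-B) B,
          (g E * (empStieltjes lam (E + η * Complex.I)).im - g E * (2 * √(1 - E ^ 2))) := by
      refine (setIntegral_eq_integral_of_forall_compl_eq_zero fun x hx => ?_).symm
      rw [hB x (by
        by_contra! h
        exact hx (abs_le.1 h))]
      simp
    rw [e2, ← Real.norm_eq_abs]
    refine norm_integral_le_of_norm_le ?_ ((ae_restrict_mem measurableSet_Icc).mono fun E hE => ?_)
    · refine Continuous.integrableOn_Icc ?_
      have hz : ∀ E : ℝ, ∀ i, ((lam i : ℂ) - (E + η * Complex.I)) ≠ 0 := fun E i =>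
        ofReal_sub_ne_zero (by simpa using hη) _
      have : Continuous fun E : ℝ => empStieltjes lam (E + η * Complex.I) :=
        continuous_const.mul (continuous_finsetSum _ fun i _ =>
          Continuous.inv₀ (by fun_prop) fun E => hz E i)
      unfold defect
      fun_prop
    · rw [← mul_sub, norm_mul, Real.norm_eq_abs, Real.norm_eq_abs]
      refine mul_le_mul (hM E) ?_ (abs_nonneg _) hM0
      refine abs_im_sub_sqrt_le_of_defect ?_ hη hη1 (abs_le.2 hE) hδ
      rw [im_empStieltjes]
      positivity
  calc _ ≤ _ := abs_sub_le _ (Real.pi⁻¹ * ∫ E, g E * (empStieltjes lam (E + η * Complex.I)).im) _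
    _ ≤ _ := add_le_add h1 h2

/-- If the Stieltjes transforms of random families of reals almost solve the equation of the
semicircle law, then their linear statistics converge in `L¹`. -/
theorem tendsto_integral_abs_linearStatistic {Ω : ℕ → Type*} [∀ n, MeasurableSpace (Ω n)]
    (P : ∀ n, Measure (Ω n)) [∀ n, IsProbabilityMeasure (P n)] (lam : ∀ n, Ω n → Fin n → ℝ)
    (hlam : ∀ n i, Measurable fun w => lam n w i)
    (h : ∀ η : ℝ, 0 < η → ∀ B ε : ℝ, 0 < ε → ∀ᶠ n in atTop, ∀ E : ℝ, |E| ≤ B →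
      ∫ w, ‖defect (E + η * Complex.I) (empStieltjes (lam n w) (E + η * Complex.I))‖ ∂P n ≤ ε)
    {g : ℝ → ℝ} (hg : Continuous g) (hc : HasCompactSupport g) :
    Tendsto (fun n => ∫ w, |(n : ℝ)⁻¹ * ∑ i, g (lam n w i) -
      ∫ E, g E * semicircleDensity 0 1 E| ∂P n) atTop (𝓝 0) := by
  obtain ⟨M, hM'⟩ := hg.bounded_above_of_compact_support hc
  have hM : ∀ x, |g x| ≤ M := hM'
  have hM0 : 0 ≤ M := (abs_nonneg _).trans (hM 0)
  obtain ⟨B, hB0, hB⟩ : ∃ B : ℝ, 0 ≤ B ∧ ∀ x, B < |x| → g x = 0 := by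
    obtain ⟨B, hB⟩ := hc.isBounded.subset_closedBall (0 : ℝ)
    refine ⟨max B 0, le_max_right _ _, fun x hx => ?_⟩
    by_contra hne
    have := hB (subset_tsupport g hne)
    rw [mem_closedBall_zero_iff, Real.norm_eq_abs] at this
    exact absurd (hx.trans_le this) (not_lt.2 (le_max_left _ _))
  rw [Metric.tendsto_atTop]
  intro ε hε
  set c : ℝ := Real.pi⁻¹ * M * (2 * B) + 1 with hcdef
  have hπ : 0 < Real.pi⁻¹ := inv_pos.2 Real.pi_pos
  have hc0 : 0 < c := by positivity
  obtain ⟨η₀, hη₀, happ⟩ := exists_forall_abs_sub_poisson_le hg hc (show 0 < ε / 8 by positivity)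
  obtain ⟨η, ⟨hη, hηlt, hη1⟩, hηs⟩ : ∃ η : ℝ, (0 < η ∧ η < η₀ ∧ η ≤ 1) ∧
      2 * √(η * (4 * B + 9)) ≤ ε / 8 / c := by
    have ht : Tendsto (fun η : ℝ => 2 * √(η * (4 * B + 9))) (𝓝[>] 0) (𝓝 0) := by
      have : Continuous fun η : ℝ => 2 * √(η * (4 * B + 9)) := by fun_prop
      have := this.tendsto 0
      simp only [zero_mul, Real.sqrt_zero, mul_zero] at this
      exact this.mono_left nhdsWithin_le_nhds
    have h1 := ht.eventually (gt_mem_nhds (show 0 < ε / 8 / c by positivity))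
    have h2 : ∀ᶠ η in 𝓝[>] (0 : ℝ), η ∈ Set.Ioo 0 (min η₀ 1) :=
      Ioo_mem_nhdsGT (lt_min hη₀ one_pos)
    obtain ⟨η, hη1, hη2⟩ := (h1.and h2).exists
    exact ⟨η, ⟨hη2.1, hη2.2.trans_le (min_le_left _ _), (hη2.2.trans_le (min_le_right _ _)).le⟩,
      hη1.le⟩
  -- With this choice the smoothing term, the term 2δ and the defect term each cost at most ε / 8 /
  -- c, and c dominates the factor π⁻¹ M (2B) in front of the integral.
  set δ : ℝ := ε / 16 / c with hδdef
  have hδ : 0 < δ := by positivity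
  obtain ⟨N, hN⟩ := eventually_atTop.1 (h η hη B (ε / 8 / c * (δ / 10)) (by positivity))
  refine ⟨N, fun n hn => ?_⟩
  have hzim : ∀ E : ℝ, ((E : ℂ) + η * Complex.I).im = η := fun E => by simp
  rw [Real.dist_eq, sub_zero, abs_of_nonneg (integral_nonneg fun w => abs_nonneg _)]
  set q : Ω n → ℝ → ℝ := fun w E =>
    ‖defect (E + η * Complex.I) (empStieltjes (lam n w) (E + η * Complex.I))‖ with hq
  have hqm : Measurable (Function.uncurry q) := measurable_norm_defect_empStieltjes (hlam n) η
  have hqint : Integrable (Function.uncurry q) ((P n).prod (volume.restrict (Set.Icc (-B) B))) := by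
    refine Integrable.of_bound hqm.aestronglyMeasurable
      (η⁻¹ ^ 2 / 4 + (B + 1) * η⁻¹ + 1) ?_
    have hae : ∀ᵐ p : Ω n × ℝ ∂((P n).prod (volume.restrict (Set.Icc (-B) B))),
        p.2 ∈ Set.Icc (-B) B :=
      (Measure.quasiMeasurePreserving_snd (μ := P n)
        (ν := volume.restrict (Set.Icc (-B) B))).ae (ae_restrict_mem measurableSet_Icc)
    refine hae.mono fun p hp => ?_
    simp only [Function.uncurry, hq, norm_norm]
    have h1 := norm_empStieltjes_le (lam n p.1) (z := p.2 + η * Complex.I) (by simpa using hη)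
    rw [hzim] at h1
    refine (norm_defect_le h1).trans ?_
    have h2 : ‖(p.2 + η * Complex.I : ℂ)‖ ≤ B + 1 := by
      refine (norm_add_le _ _).trans ?_
      rw [norm_mul, Complex.norm_real, Complex.norm_real, Complex.norm_I, mul_one,
        Real.norm_eq_abs, Real.norm_eq_abs, abs_of_pos hη]
      exact add_le_add (abs_le.2 hp) hη1
    gcongr
  set a : ℝ := 2 * √(η * (4 * B + 9)) + 2 * δ with ha
  have hpt : ∀ w, |(n : ℝ)⁻¹ * ∑ i, g (lam n w i) - ∫ E, g E * semicircleDensity 0 1 E| ≤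
      ε / 8 + Real.pi⁻¹ * ∫ E in Set.Icc (-B) B, M * (a + (10 / δ) * q w E) := by
    intro w
    have := abs_linearStatistic_sub_le (lam n w) hg hc hM hB hη hη1 hδ (ε := ε / 8) (by positivity)
      (happ η hη hηlt)
    simpa using this
  have hint2 : Integrable (fun p : Ω n × ℝ => M * (a + (10 / δ) * q p.1 p.2))
      ((P n).prod (volume.restrict (Set.Icc (-B) B))) :=
    ((integrable_const a).add (hqint.const_mul _)).const_mul _
  have hint3 : Integrable (fun w => ∫ E in Set.Icc (-B) B, M * (a + (10 / δ) * q w E)) (P n) :=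
    hint2.integral_prod_left
  have hvol : (volume.restrict (Set.Icc (-B) B)).real Set.univ = 2 * B := by
    rw [measureReal_restrict_apply_univ, Real.volume_real_Icc_of_le (by linarith)]
    ring
  calc ∫ w, |(n : ℝ)⁻¹ * ∑ i, g (lam n w i) - ∫ E, g E * semicircleDensity 0 1 E| ∂P n
      ≤ ∫ w, (ε / 8 + Real.pi⁻¹ * ∫ E in Set.Icc (-B) B, M * (a + (10 / δ) * q w E)) ∂P n :=
        integral_mono_of_nonneg (ae_of_all _ fun w => abs_nonneg _)
          ((integrable_const _).add (hint3.const_mul _)) (ae_of_all _ hpt)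
    _ = ε / 8 + Real.pi⁻¹ * ∫ E in Set.Icc (-B) B, ∫ w, M * (a + (10 / δ) * q w E) ∂P n := by
        rw [integral_add (integrable_const _) (hint3.const_mul _), integral_const_mul,
          integral_integral_swap hint2]
        simp
    _ ≤ ε / 8 + Real.pi⁻¹ * ∫ E in Set.Icc (-B) B, M * (a + ε / 8 / c) := by
        gcongr 1
        refine mul_le_mul_of_nonneg_left ?_ hπ.le
        refine integral_mono_ae hint2.integral_prod_right (integrable_const _)
          ((ae_restrict_mem measurableSet_Icc).mono fun E hE => ?_)
        have hqE : Integrable (fun w => q w E) (P n) := by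
          refine Integrable.of_bound
            (hqm.comp (measurable_id.prodMk measurable_const)).aestronglyMeasurable
            (η⁻¹ ^ 2 / 4 + ‖(E + η * Complex.I : ℂ)‖ * η⁻¹ + 1) (ae_of_all _ fun w => ?_)
          simp only [hq, norm_norm]
          have h1 := norm_empStieltjes_le (lam n w) (z := E + η * Complex.I) (by simpa using hη)
          rw [hzim] at h1
          exact norm_defect_le h1
        simp only
        rw [integral_const_mul, integral_add (integrable_const _) (hqE.const_mul _),
          integral_const_mul]
        simp only [integral_const, probReal_univ, one_smul]
        refine mul_le_mul_of_nonneg_left ?_ hM0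
        have := hN n hn E (abs_le.2 hE)
        have h5 : 10 / δ * ∫ w, q w E ∂P n ≤ 10 / δ * (ε / 8 / c * (δ / 10)) := by gcongr
        have h6 : 10 / δ * (ε / 8 / c * (δ / 10)) = ε / 8 / c := by field_simp
        linarith
    _ = ε / 8 + (Real.pi⁻¹ * M * (2 * B)) * (a + ε / 8 / c) := by
        rw [integral_const, hvol, smul_eq_mul]
        ring
    _ ≤ ε / 8 + c * (3 * (ε / 8 / c)) := by
        gcongr
        · rw [hcdef]
          linarith
        · have : 2 * δ = ε / 8 / c := by
            rw [hδdef]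
            ring
          linarith
    _ = ε / 2 := by
        field_simp
        ring
    _ < ε := by linarith

end WeightedChungLu

namespace WeightedChungLu

/-! ### Ordered eigenvalues -/

section Eigenvalues

variable {ι : Type*} [Fintype ι]

theorem dotProduct_self_eq_sum_repr_sq (b : OrthonormalBasis (Fin (Fintype.card ι)) ℝ
    (EuclideanSpace ℝ ι)) (x : EuclideanSpace ℝ ι) : x.ofLp ⬝ᵥ x.ofLp = ∑ i, b.repr x i ^ 2 := by
  have h1 : x.ofLp ⬝ᵥ x.ofLp = inner ℝ x x := by
    rw [EuclideanSpace.inner_eq_star_dotProduct]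
    simp
  rw [h1, ← b.repr.inner_map_map, EuclideanSpace.inner_eq_star_dotProduct, dotProduct]
  refine Finset.sum_congr rfl fun i _ => ?_
  simp [sq]

theorem exists_ne_zero_of_card_lt {κ : Type*} [Fintype κ]
    (hκ : Fintype.card κ < Fintype.card ι) (f : κ → EuclideanSpace ℝ ι →ₗ[ℝ] ℝ) :
    ∃ x : EuclideanSpace ℝ ι, x ≠ 0 ∧ ∀ k, f k x = 0 := by
  have h : LinearMap.ker (LinearMap.pi f) ≠ ⊥ :=
    LinearMap.ker_ne_bot_of_finrank_lt (by simpa using hκ)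
  obtain ⟨x, hx, hx0⟩ := Submodule.exists_mem_ne_zero_of_ne_bot h
  refine ⟨x, hx0, fun k => ?_⟩
  have := congrFun (LinearMap.mem_ker.1 hx) k
  simpa using this

theorem dotProduct_self_pos {x : EuclideanSpace ℝ ι} (hx : x ≠ 0) : 0 < x.ofLp ⬝ᵥ x.ofLp := by
  have h1 : x.ofLp ⬝ᵥ x.ofLp = inner ℝ x x := by
    rw [EuclideanSpace.inner_eq_star_dotProduct]
    simp
  rw [h1]
  exact real_inner_self_pos.2 hx

variable [DecidableEq ι]

/-- The quadratic form of a real symmetric matrix in coordinates that diagonalize it. -/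
theorem exists_orthonormalBasis_dotProduct_mulVec {A : Matrix ι ι ℝ} (hA : A.IsHermitian) :
    ∃ b : OrthonormalBasis (Fin (Fintype.card ι)) ℝ (EuclideanSpace ℝ ι),
      ∀ x : EuclideanSpace ℝ ι,
        x.ofLp ⬝ᵥ A.mulVec x.ofLp = ∑ i, hA.eigenvalues₀ i * b.repr x i ^ 2 := by
  have hT := Matrix.isSymmetric_toEuclideanLin_iff.mpr hA
  refine ⟨hT.eigenvectorBasis finrank_euclideanSpace, fun x => ?_⟩
  set b := hT.eigenvectorBasis finrank_euclideanSpace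
  have h1 : x.ofLp ⬝ᵥ A.mulVec x.ofLp = inner ℝ (A.toEuclideanLin x) x := by
    rw [EuclideanSpace.inner_eq_star_dotProduct]
    simp [Matrix.toLpLin_apply]
  rw [h1, ← b.repr.inner_map_map, EuclideanSpace.inner_eq_star_dotProduct, dotProduct]
  refine Finset.sum_congr rfl fun i _ => ?_
  have := hT.eigenvectorBasis_apply_self_apply finrank_euclideanSpace x i
  simp only [star_trivial, Pi.star_apply]
  rw [this]
  simp only [Matrix.IsHermitian.eigenvalues₀, RCLike.ofReal_real_eq_id, id]
  ring

/-- Weyl's inequality by counting dimensions. One condition for each index other than k leaves a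
nonzero x that lies in the span of the top eigenvectors of A up to k and of the bottom ones of B
from k on. -/
theorem eigenvalues₀_le_add {A B : Matrix ι ι ℝ} (hA : A.IsHermitian) (hB : B.IsHermitian)
    {ε : ℝ} (h : ∀ x : ι → ℝ, x ⬝ᵥ A.mulVec x ≤ x ⬝ᵥ B.mulVec x + ε * (x ⬝ᵥ x))
    (k : Fin (Fintype.card ι)) : hA.eigenvalues₀ k ≤ hB.eigenvalues₀ k + ε := by
  obtain ⟨a, ha⟩ := exists_orthonormalBasis_dotProduct_mulVec hA
  obtain ⟨b, hb⟩ := exists_orthonormalBasis_dotProduct_mulVec hB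
  obtain ⟨x, hx0, hx⟩ := exists_ne_zero_of_card_lt (ι := ι) (κ := {i // i ≠ k})
    (by
      rw [Fintype.card_subtype_compl, Fintype.card_subtype_eq, Fintype.card_fin]
      have := k.pos
      omega)
    (fun i => if i.1 < k then
        (LinearMap.proj i.1).comp ((WithLp.linearEquiv 2 ℝ _).toLinearMap.comp
          b.repr.toLinearEquiv.toLinearMap)
      else (LinearMap.proj i.1).comp ((WithLp.linearEquiv 2 ℝ _).toLinearMap.comp
          a.repr.toLinearEquiv.toLinearMap))
  have hxb : ∀ i, i < k → b.repr x i = 0 := fun i hi => by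
    have := hx ⟨i, hi.ne⟩
    simpa [hi] using this
  have hxa : ∀ i, k < i → a.repr x i = 0 := fun i hi => by
    have := hx ⟨i, hi.ne'⟩
    simpa [hi.le.not_gt] using this
  have h1 : hA.eigenvalues₀ k * (x.ofLp ⬝ᵥ x.ofLp) ≤ x.ofLp ⬝ᵥ A.mulVec x.ofLp := by
    rw [ha, dotProduct_self_eq_sum_repr_sq a, Finset.mul_sum]
    refine Finset.sum_le_sum fun i _ => ?_
    rcases le_or_gt i k with hi | hi
    · exact mul_le_mul_of_nonneg_right (hA.eigenvalues₀_antitone hi) (sq_nonneg _)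
    · simp [hxa i hi]
  have h2 : x.ofLp ⬝ᵥ B.mulVec x.ofLp ≤ hB.eigenvalues₀ k * (x.ofLp ⬝ᵥ x.ofLp) := by
    rw [hb, dotProduct_self_eq_sum_repr_sq b, Finset.mul_sum]
    refine Finset.sum_le_sum fun i _ => ?_
    rcases lt_or_ge i k with hi | hi
    · simp [hxb i hi]
    · exact mul_le_mul_of_nonneg_right (hB.eigenvalues₀_antitone hi) (sq_nonneg _)
  have h3 := dotProduct_self_pos hx0
  have h4 := h x.ofLp
  have : hA.eigenvalues₀ k * (x.ofLp ⬝ᵥ x.ofLp) ≤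
      (hB.eigenvalues₀ k + ε) * (x.ofLp ⬝ᵥ x.ofLp) := by linarith
  exact le_of_mul_le_mul_right this h3

/-- All eigenvalues but the smallest are at least `t` if the quadratic form is at least `t` on a
hyperplane. -/
theorem le_eigenvalues₀_of_hyperplane {A : Matrix ι ι ℝ} (hA : A.IsHermitian) {t : ℝ} (u : ι → ℝ)
    (h : ∀ x : ι → ℝ, u ⬝ᵥ x = 0 → t * (x ⬝ᵥ x) ≤ x ⬝ᵥ A.mulVec x)
    (k : Fin (Fintype.card ι)) (hk : k.val + 1 < Fintype.card ι) : t ≤ hA.eigenvalues₀ k := by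
  obtain ⟨b, hb⟩ := exists_orthonormalBasis_dotProduct_mulVec hA
  -- The conditions are orthogonality to the first k eigenvectors and, for `none`, to u. That is k +
  -- 1 conditions, fewer than the dimension because k is not the last index.
  obtain ⟨x, hx0, hx⟩ := exists_ne_zero_of_card_lt (ι := ι) (κ := Option {i // i < k})
    (by
      rw [Fintype.card_option, Fintype.card_of_subtype (Finset.Iio k) (by simp), Fin.card_Iio]
      exact hk)
    (fun i => i.elim (innerSL ℝ (WithLp.toLp 2 u)).toLinearMap
      fun i => (LinearMap.proj i.1).comp ((WithLp.linearEquiv 2 ℝ _).toLinearMap.comp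
          b.repr.toLinearEquiv.toLinearMap))
  have hxb : ∀ i, i < k → b.repr x i = 0 := fun i hi => by
    simpa using hx (some ⟨i, hi⟩)
  have hxu : u ⬝ᵥ x.ofLp = 0 := by
    have := hx none
    simpa [EuclideanSpace.inner_eq_star_dotProduct, dotProduct_comm] using this
  have h2 : x.ofLp ⬝ᵥ A.mulVec x.ofLp ≤ hA.eigenvalues₀ k * (x.ofLp ⬝ᵥ x.ofLp) := by
    rw [hb, dotProduct_self_eq_sum_repr_sq b, Finset.mul_sum]
    refine Finset.sum_le_sum fun i _ => ?_
    rcases lt_or_ge i k with hi | hi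
    · simp [hxb i hi]
    · exact mul_le_mul_of_nonneg_right (hA.eigenvalues₀_antitone hi) (sq_nonneg _)
  exact le_of_mul_le_mul_right ((h _ hxu).trans h2) (dotProduct_self_pos hx0)

theorem eigenvalues₀_le_of_forall {A : Matrix ι ι ℝ} (hA : A.IsHermitian) {t : ℝ}
    (h : ∀ x : ι → ℝ, x ⬝ᵥ A.mulVec x ≤ t * (x ⬝ᵥ x)) (k : Fin (Fintype.card ι)) :
    hA.eigenvalues₀ k ≤ t := by
  obtain ⟨b, hb⟩ := exists_orthonormalBasis_dotProduct_mulVec hA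
  have h1 := hb (b k)
  have h2 := dotProduct_self_eq_sum_repr_sq b (b k)
  have h3 : ∀ i, b.repr (b k) i = if i = k then 1 else 0 := fun i => by
    rw [b.repr_self, PiLp.single_apply]
  simp only [h3] at h1 h2
  simp at h1 h2
  have := h (b k).ofLp
  rw [h1, h2] at this
  linarith

/-- A crude entrywise form of Weyl's bound, enough for continuity and hence measurability of the
ordered eigenvalues. -/
theorem abs_eigenvalues₀_sub_le {A B : Matrix ι ι ℝ} (hA : A.IsHermitian) (hB : B.IsHermitian)
    (k : Fin (Fintype.card ι)) :
    |hA.eigenvalues₀ k - hB.eigenvalues₀ k| ≤ ∑ i, ∑ j, |A i j - B i j| := by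
  have key : ∀ {A B : Matrix ι ι ℝ} (x : ι → ℝ),
      x ⬝ᵥ A.mulVec x ≤ x ⬝ᵥ B.mulVec x + (∑ i, ∑ j, |A i j - B i j|) * (x ⬝ᵥ x) := by
    intro A B x
    have h1 : x ⬝ᵥ A.mulVec x - x ⬝ᵥ B.mulVec x = ∑ i, ∑ j, (A i j - B i j) * (x i * x j) := by
      simp only [dotProduct, Matrix.mulVec, Finset.mul_sum, ← Finset.sum_sub_distrib]
      exact Finset.sum_congr rfl fun i _ => Finset.sum_congr rfl fun j _ => by ring
    have h2 : ∑ i, ∑ j, (A i j - B i j) * (x i * x j) ≤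
        (∑ i, ∑ j, |A i j - B i j|) * (x ⬝ᵥ x) := by
      simp only [Finset.sum_mul]
      refine Finset.sum_le_sum fun i _ => Finset.sum_le_sum fun j _ => ?_
      refine (le_abs_self _).trans ?_
      rw [abs_mul]
      refine mul_le_mul_of_nonneg_left ?_ (abs_nonneg _)
      have hs : ∀ a, x a ^ 2 ≤ x ⬝ᵥ x := fun a => by
        rw [dotProduct]
        simp only [← sq]
        exact Finset.single_le_sum (f := fun a => x a ^ 2) (fun _ _ => sq_nonneg _)
          (Finset.mem_univ a)
      rw [abs_mul]
      nlinarith [hs i, hs j, sq_nonneg (|x i| - |x j|), sq_abs (x i), sq_abs (x j)]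
    linarith
  rw [abs_le]
  have h1 := eigenvalues₀_le_add hA hB (fun x => key x) k
  have h2 := eigenvalues₀_le_add hB hA (fun x => key x) k
  have h3 : ∑ i, ∑ j, |B i j - A i j| = ∑ i, ∑ j, |A i j - B i j| := by
    simp_rw [abs_sub_comm]
  rw [h3] at h2
  constructor <;> linarith

theorem continuous_eigenvalues₀ (k : Fin (Fintype.card ι)) :
    Continuous fun B : {B : ι → ι → ℝ // (Matrix.of B).IsHermitian} => B.2.eigenvalues₀ k := by
  rw [continuous_iff_continuousAt]
  intro B
  rw [ContinuousAt, tendsto_iff_dist_tendsto_zero]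
  have hij : ∀ i j, Continuous fun C : {B : ι → ι → ℝ // (Matrix.of B).IsHermitian} => C.1 i j :=
    fun i j => (continuous_apply j).comp ((continuous_apply i).comp continuous_subtype_val)
  have hc : Continuous fun C : {B : ι → ι → ℝ // (Matrix.of B).IsHermitian} =>
      ∑ i, ∑ j, |C.1 i j - B.1 i j| := by
    refine continuous_finsetSum _ fun i _ => continuous_finsetSum _ fun j _ => ?_
    exact continuous_abs.comp ((hij i j).sub continuous_const)
  have h0 := hc.tendsto B
  simp only [sub_self, abs_zero, Finset.sum_const_zero] at h0
  refine squeeze_zero (fun _ => dist_nonneg) (fun C => ?_) h0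
  rw [Real.dist_eq]
  exact abs_eigenvalues₀_sub_le C.2 B.2 k

theorem measurable_eigenvalues₀ {Ω : Type*} [MeasurableSpace Ω] {A : Ω → Matrix ι ι ℝ}
    (hA : ∀ w, (A w).IsHermitian) (hm : ∀ i j, Measurable fun w => A w i j)
    (k : Fin (Fintype.card ι)) : Measurable fun w => (hA w).eigenvalues₀ k := by
  have hG : Measurable fun w =>
      (⟨A w, hA w⟩ : {B : ι → ι → ℝ // (Matrix.of B).IsHermitian}) :=
    Measurable.subtype_mk (measurable_pi_lambda _ fun i => measurable_pi_lambda _ fun j => hm i j)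
  have := (continuous_eigenvalues₀ k).measurable.comp hG
  exact this

end Eigenvalues

/-! ### Spectrum of the normalized Laplacian -/

section Network

variable {n : ℕ}

theorem sum_eig (w : Sym2 (Fin n) → ℝ) {M : Type*} [AddCommMonoid M] (f : ℝ → M) :
    ∑ l, f (eig w l) = ∑ i, f ((normLap_isHermitian w).eigenvalues i) := by
  simp only [eig, Matrix.IsHermitian.eigenvalues]
  rw [Equiv.sum_comp ((Fintype.equivOfCardEq (Fintype.card_fin _)).symm)
    (fun i => f ((normLap_isHermitian w).eigenvalues₀ i))]
  exact Equiv.sum_comp (Fin.revPerm.trans (finCongr (Fintype.card_fin n).symm))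
    (fun i => f ((normLap_isHermitian w).eigenvalues₀ i))

theorem measurable_normLap_apply (i j : Fin n) :
    Measurable fun w : Sym2 (Fin n) → ℝ => normLap w i j := by
  have hd : ∀ i, Measurable fun w : Sym2 (Fin n) → ℝ => (√(deg w i))⁻¹ := fun i => by
    unfold deg adj
    simp only [Matrix.of_apply]
    fun_prop
  have h := hd i
  have h' := hd j
  simp only [normLap, invSqrtDeg, Matrix.sub_apply, Matrix.mul_diagonal, Matrix.diagonal_mul, adj,
    Matrix.of_apply]
  fun_prop

theorem measurable_eig (l : Fin n) : Measurable fun w : Sym2 (Fin n) → ℝ => eig w l :=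
  measurable_eigenvalues₀ normLap_isHermitian measurable_normLap_apply _

theorem measurable_empiricalLaw :
    Measurable (empiricalLaw : (Sym2 (Fin n) → ℝ) → Measure ℝ) := by
  refine Measure.measurable_of_measurable_coe _ fun s hs => ?_
  simp only [empiricalLaw, Measure.smul_apply, Measure.coe_finsetSum, Finset.sum_apply,
    Measure.dirac_apply' _ hs]
  have h : ∀ l : Fin n, Measurable fun w : Sym2 (Fin n) → ℝ =>
      s.indicator (1 : ℝ → ENNReal) (eig w l) := fun l =>
    (measurable_one.indicator hs).comp (measurable_eig l)
  have h' : Measurable fun w : Sym2 (Fin n) → ℝ => ∑ l : Fin n with 0 < l.val,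
      s.indicator (1 : ℝ → ENNReal) (eig w l) := Finset.measurable_sum _ fun l _ => h l
  exact h'.const_mul _

/-- The matrix `(N - 1) / r`. -/
noncomputable def scaledLap (w : Sym2 (Fin n) → ℝ) (r : ℝ) : Matrix (Fin n) (Fin n) ℝ :=
  r⁻¹ • (normLap w - 1)

theorem scaledLap_isHermitian (w : Sym2 (Fin n) → ℝ) (r : ℝ) : (scaledLap w r).IsHermitian :=
  ((normLap_isHermitian w).sub Matrix.isHermitian_one).smul (IsSelfAdjoint.all _)

theorem stieltjes_scaledLap (w : Sym2 (Fin n) → ℝ) {r : ℝ} (hr : 0 < r) {z : ℂ} (hz : 0 < z.im) :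
    stieltjes (scaledLap w r) z = empStieltjes (fun l => (eig w l - 1) / r) z := by
  have hr' : (r : ℂ) ≠ 0 := by exact_mod_cast hr.ne'
  set z' : ℂ := 1 + r * z with hz'
  have hz'im : 0 < z'.im := by
    simp [hz']
    positivity
  have h1 : (scaledLap w r).map Complex.ofReal - Matrix.scalar (Fin n) z =
      (r : ℂ)⁻¹ • ((normLap w).map Complex.ofReal - Matrix.scalar (Fin n) z') := by
    ext i j
    simp only [scaledLap, Matrix.sub_apply, Matrix.map_apply, Matrix.smul_apply, smul_eq_mul,
      Matrix.scalar_apply, Matrix.diagonal_apply, Matrix.one_apply, hz']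
    split_ifs <;> push_cast <;> field_simp <;> ring
  have h2 : resolvent (scaledLap w r) z = (r : ℂ) • resolvent (normLap w) z' := by
    refine Matrix.inv_eq_right_inv ?_
    rw [h1, Matrix.smul_mul, Matrix.mul_smul, smul_smul, inv_mul_cancel₀ hr', one_smul,
      sub_mul_resolvent (normLap_isHermitian w) hz'im]
  rw [stieltjes, empStieltjes, h2, Matrix.trace_smul, trace_resolvent (normLap_isHermitian w) hz'im,
    ← sum_eig w (fun x : ℝ => ((x : ℂ) - z')⁻¹), smul_eq_mul, Finset.mul_sum]
  congr 1
  refine Finset.sum_congr rfl fun l _ => ?_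
  have h3 : ((eig w l - 1 : ℝ) / r : ℂ) - z = (r : ℂ)⁻¹ * ((eig w l : ℂ) - z') := by
    rw [hz']
    push_cast
    field_simp
    ring
  rw [Complex.ofReal_div, h3, mul_inv, inv_inv]

/-- The lower bound is required on a hyperplane only, which leaves the smallest eigenvalue free;
this is exactly the one that the spectral radius omits. -/
theorem specRadius_le_of_forall {w : Sym2 (Fin n) → ℝ} {L : ℝ} (hL : 0 ≤ L) (u : Fin n → ℝ)
    (h1 : ∀ x : Fin n → ℝ, u ⬝ᵥ x = 0 → (1 - L) * (x ⬝ᵥ x) ≤ x ⬝ᵥ (normLap w).mulVec x)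
    (h2 : ∀ x : Fin n → ℝ, x ⬝ᵥ (normLap w).mulVec x ≤ (1 + L) * (x ⬝ᵥ x)) :
    specRadius w ≤ L := by
  refine Real.iSup_le (fun l => ?_) hL
  have hl := l.1.2
  -- Reversal of the order turns 0 < l into the condition that the descending index is not the last.
  have e1 := le_eigenvalues₀_of_hyperplane (normLap_isHermitian w) u h1
    (Fin.cast (Fintype.card_fin n).symm l.1.rev) (by
      have := l.2
      simp [Fin.val_rev]
      omega)
  have e2 := eigenvalues₀_le_of_forall (normLap_isHermitian w) h2
    (Fin.cast (Fintype.card_fin n).symm l.1.rev)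
  unfold eig
  rw [abs_le]
  constructor <;> linarith

theorem abs_one_sub_eig_le_specRadius (w : Sym2 (Fin n) → ℝ) {l : Fin n} (hl : 0 < l.val) :
    |1 - eig w l| ≤ specRadius w :=
  le_ciSup (f := fun l : {l : Fin n // 0 < l.val} => |1 - eig w l|)
    (Set.finite_range _).bddAbove ⟨l, hl⟩

end Network

end WeightedChungLu

namespace WeightedChungLu

/-! ### The weighted Chung–Lu model -/

/-- The standing assumptions on the expected degrees and on the law of the weights. -/
structure IsModel {n : ℕ} (ω : Fin n → ℝ) (ν : Measure ℝ) : Prop where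
  pos : ∀ i, 0 < ω i
  wmax_sq_le : wmax ω ^ 2 ≤ 1 / rho ω
  weight_mem : ∀ᵐ x ∂ν, 0 < x ∧ x ≤ 1

variable {n : ℕ} {ω : Fin n → ℝ} {ν : Measure ℝ}

theorem wmin_le (ω : Fin n → ℝ) (i : Fin n) : wmin ω ≤ ω i :=
  ciInf_le (Set.finite_range _).bddBelow i

theorem le_wmax (ω : Fin n → ℝ) (i : Fin n) : ω i ≤ wmax ω :=
  le_ciSup (Set.finite_range _).bddAbove i

theorem linkProb_mk (ω : Fin n → ℝ) (i j : Fin n) : linkProb ω s(i, j) = rho ω * ω i * ω j := rfl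

/-- `√(ω_i ω_j)` as a function of the unordered pair. -/
noncomputable def pairScale (ω : Fin n → ℝ) : Sym2 (Fin n) → ℝ :=
  Sym2.lift ⟨fun i j => √(ω i * ω j), fun i j => by simp only [mul_comm]⟩

theorem pairScale_mk (ω : Fin n → ℝ) (i j : Fin n) : pairScale ω s(i, j) = √(ω i * ω j) := rfl

/-- The centred and normalized weight of a link. -/
noncomputable def centredWeight (ω : Fin n → ℝ) (ν : Measure ℝ) (e : Sym2 (Fin n)) (x : ℝ) : ℝ :=
  -(x - moment ν 1 * linkProb ω e) / (moment ν 1 * pairScale ω e * limitRadius ω ν)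

/-- The parameter `κ = ω_avg / (E[W ^ 2] ω_min ^ 2)` that controls the size of the links. -/
noncomputable def sparsity (ω : Fin n → ℝ) (ν : Measure ℝ) : ℝ :=
  avg ω / (moment ν 2 * wmin ω ^ 2)

theorem measurable_centredWeight (e : Sym2 (Fin n)) : Measurable (centredWeight ω ν e) := by
  unfold centredWeight
  fun_prop

theorem continuous_centredWeight (e : Sym2 (Fin n)) : Continuous (centredWeight ω ν e) := by
  unfold centredWeight
  fun_prop

theorem wmin_le_avg (ω : Fin n → ℝ) (i : Fin n) : wmin ω ≤ avg ω := by
  have hn : (0 : ℝ) < n := by exact_mod_cast i.pos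
  rw [avg, le_div_iff₀ hn]
  have : ∑ _j : Fin n, wmin ω ≤ ∑ j, ω j := Finset.sum_le_sum fun j _ => wmin_le ω j
  simpa [mul_comm] using this

theorem continuous_deg (i : Fin n) : Continuous fun w : Sym2 (Fin n) → ℝ => deg w i := by
  simp only [deg, adj, Matrix.of_apply]
  fun_prop

namespace IsModel

theorem sum_pos (h : IsModel ω ν) (i : Fin n) : 0 < ∑ j, ω j :=
  Finset.sum_pos (fun j _ => h.pos j) ⟨i, Finset.mem_univ _⟩

theorem rho_pos (h : IsModel ω ν) (i : Fin n) : 0 < rho ω := one_div_pos.2 (h.sum_pos i)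

theorem avg_pos (h : IsModel ω ν)
    (i : Fin n) : 0 < avg ω := div_pos (h.sum_pos i) (by exact_mod_cast i.pos)

theorem wmin_pos (h : IsModel ω ν) (i : Fin n) : 0 < wmin ω := by
  have : Nonempty (Fin n) := ⟨i⟩
  obtain ⟨j, hj⟩ := exists_eq_ciInf_of_finite (f := ω)
  rw [wmin, ← hj]
  exact h.pos j

theorem linkProb_pos (h : IsModel ω ν) (e : Sym2 (Fin n)) : 0 < linkProb ω e := by
  induction e with
  | _ i j => exact mul_pos (mul_pos (h.rho_pos i) (h.pos i)) (h.pos j)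

theorem linkProb_le_one (h : IsModel ω ν) (e : Sym2 (Fin n)) : linkProb ω e ≤ 1 := by
  induction e with
  | _ i j =>
    have h1 := h.rho_pos i
    have h2 : ω i * ω j ≤ wmax ω ^ 2 := by
      rw [sq]
      exact mul_le_mul (le_wmax ω i) (le_wmax ω j) (h.pos j).le ((h.pos i).le.trans (le_wmax ω i))
    have h3 : ω i * ω j ≤ 1 / rho ω := h2.trans h.wmax_sq_le
    rw [le_div_iff₀ h1] at h3
    rw [linkProb_mk]
    linarith

theorem sum_linkProb (h : IsModel ω ν) (i : Fin n) : ∑ j, linkProb ω s(i, j) = ω i := by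
  simp only [linkProb_mk, ← Finset.mul_sum]
  rw [rho]
  have := h.sum_pos i
  field_simp

theorem pairScale_pos (h : IsModel ω ν) (e : Sym2 (Fin n)) : 0 < pairScale ω e := by
  induction e with
  | _ i j => exact Real.sqrt_pos.2 (mul_pos (h.pos i) (h.pos j))

theorem wmin_le_pairScale (h : IsModel ω ν) (e : Sym2 (Fin n)) : wmin ω ≤ pairScale ω e := by
  induction e with
  | _ i j =>
    refine Real.le_sqrt_of_sq_le ?_
    rw [sq]
    exact mul_le_mul (wmin_le ω i) (wmin_le ω j) (h.wmin_pos i).le (h.pos i).le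

theorem linkProb_eq (h : IsModel ω ν)
    (e : Sym2 (Fin n)) : linkProb ω e = pairScale ω e ^ 2 / (n * avg ω) := by
  induction e with
  | _ i j =>
    have hn : (n : ℝ) ≠ 0 := by exact_mod_cast i.pos.ne'
    rw [linkProb_mk, pairScale_mk, Real.sq_sqrt (mul_pos (h.pos i) (h.pos j)).le, rho, avg]
    field_simp

theorem ae_linkLaw (h : IsModel ω ν) (e : Sym2 (Fin n)) : ∀ᵐ x ∂linkLaw ω ν e, 0 ≤ x ∧ x ≤ 1 := by
  have h0 : ∀ᵐ x ∂ν, 0 ≤ x ∧ x ≤ 1 := by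
    filter_upwards [h.weight_mem] with x hx
    exact ⟨hx.1.le, hx.2⟩
  have h1 : ∀ᵐ x ∂(Measure.dirac (0 : ℝ)), 0 ≤ x ∧ x ≤ 1 := by
    rw [ae_dirac_iff (by measurability)]
    simp
  rw [linkLaw, ae_add_measure_iff]
  exact ⟨Measure.ae_smul_measure h0 _, Measure.ae_smul_measure h1 _⟩

theorem integral_linkLaw (h : IsModel ω ν) (e : Sym2 (Fin n)) {f : ℝ → ℝ} (hf : Integrable f ν) :
    ∫ x, f x ∂linkLaw ω ν e =
      linkProb ω e * ∫ x, f x ∂ν + (1 - linkProb ω e) * f 0 := by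
  have h1 := h.linkProb_pos e
  have h2 := h.linkProb_le_one e
  rw [linkLaw, integral_add_measure (hf.smul_measure ENNReal.ofReal_ne_top)
    ((integrable_dirac (by simp)).smul_measure ENNReal.ofReal_ne_top),
    integral_smul_measure, integral_smul_measure, ENNReal.toReal_ofReal h1.le,
    ENNReal.toReal_ofReal (by linarith)]
  simp

variable [IsProbabilityMeasure ν]

theorem integrable_pow (h : IsModel ω ν) (m : ℕ) : Integrable (fun x => x ^ m) ν := by
  refine (integrable_const (1 : ℝ)).mono' (by fun_prop) ?_
  filter_upwards [h.weight_mem] with x hx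
  rw [Real.norm_eq_abs, abs_of_nonneg (pow_nonneg hx.1.le _)]
  exact pow_le_one₀ hx.1.le hx.2

theorem moment_pos (h : IsModel ω ν) (m : ℕ) : 0 < moment ν m := by
  rw [moment, integral_pos_iff_support_of_nonneg_ae _ (h.integrable_pow m)]
  · have : Function.support (fun x : ℝ => x ^ m) =ᵐ[ν] Set.univ := by
      rw [eventuallyEq_univ]
      filter_upwards [h.weight_mem] with x hx
      exact (pow_pos hx.1 m).ne'
    rw [measure_congr this]
    simp
  · filter_upwards [h.weight_mem] with x hx
    exact (pow_pos hx.1 m).le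

theorem moment_one_le_one (h : IsModel ω ν) : moment ν 1 ≤ 1 := by
  have : moment ν 1 ≤ ∫ _x, (1 : ℝ) ∂ν := by
    refine integral_mono_ae (h.integrable_pow 1) (integrable_const _) ?_
    filter_upwards [h.weight_mem] with x hx
    simpa using hx.2
  simpa using this

theorem moment_two_le (h : IsModel ω ν) : moment ν 2 ≤ moment ν 1 := by
  refine integral_mono_ae (h.integrable_pow 2) (h.integrable_pow 1) ?_
  filter_upwards [h.weight_mem] with x hx
  exact pow_le_pow_of_le_one hx.1.le hx.2 one_le_two

theorem moment_one_sq_le (h : IsModel ω ν) : moment ν 1 ^ 2 ≤ moment ν 2 := by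
  have h1 : 0 ≤ ∫ x, (x ^ 2 - 2 * moment ν 1 * x ^ 1 + moment ν 1 ^ 2) ∂ν := by
    refine integral_nonneg fun x => ?_
    have := sq_nonneg (x - moment ν 1)
    simp only [Pi.zero_apply]
    nlinarith
  have i1 : Integrable (fun x : ℝ => x ^ 2 - 2 * moment ν 1 * x ^ 1) ν :=
    (h.integrable_pow 2).sub ((h.integrable_pow 1).const_mul _)
  rw [integral_add i1 (integrable_const _), integral_sub (h.integrable_pow 2)
    ((h.integrable_pow 1).const_mul _), integral_const_mul] at h1
  simp only [integral_const, probReal_univ, smul_eq_mul, one_mul] at h1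
  change 0 ≤ moment ν 2 - 2 * moment ν 1 * moment ν 1 + moment ν 1 ^ 2 at h1
  nlinarith

theorem limitRadius_pos (h : IsModel ω ν) (i : Fin n) : 0 < limitRadius ω ν :=
  mul_pos (div_pos two_pos (Real.sqrt_pos.2 (h.avg_pos i)))
    (div_pos (Real.sqrt_pos.2 (h.moment_pos 2)) (h.moment_pos 1))

theorem limitRadius_sq (h : IsModel ω ν) (i : Fin n) :
    limitRadius ω ν ^ 2 = 4 * moment ν 2 / (avg ω * moment ν 1 ^ 2) := by
  rw [limitRadius, mul_pow, div_pow, div_pow, Real.sq_sqrt (h.avg_pos i).le,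
    Real.sq_sqrt (h.moment_pos 2).le]
  have := h.avg_pos i
  have := h.moment_pos 1
  field_simp
  ring

theorem isProbabilityMeasure_linkLaw (h : IsModel ω ν) (e : Sym2 (Fin n)) :
    IsProbabilityMeasure (linkLaw ω ν e) := by
  constructor
  have h1 := h.linkProb_pos e
  have h2 := h.linkProb_le_one e
  simp only [linkLaw, Measure.add_apply, Measure.smul_apply, measure_univ, smul_eq_mul, mul_one]
  rw [← ENNReal.ofReal_add h1.le (by linarith)]
  simp

theorem integral_linkLaw_pow (h : IsModel ω ν) (e : Sym2 (Fin n)) {m : ℕ} (hm : m ≠ 0) :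
    ∫ x, x ^ m ∂linkLaw ω ν e = linkProb ω e * moment ν m := by
  rw [h.integral_linkLaw e (h.integrable_pow m), zero_pow hm, mul_zero, add_zero, moment]

theorem integrable_linkLaw_pow (h : IsModel ω ν) (e : Sym2 (Fin n)) (m : ℕ) :
    Integrable (fun x => x ^ m) (linkLaw ω ν e) := by
  have := h.isProbabilityMeasure_linkLaw e
  refine (integrable_const (1 : ℝ)).mono' (by fun_prop) ?_
  filter_upwards [h.ae_linkLaw e] with x hx
  rw [Real.norm_eq_abs, abs_of_nonneg (pow_nonneg hx.1 _)]
  exact pow_le_one₀ hx.1 hx.2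

/-- The second moment of a centred link. -/
theorem integral_linkLaw_sub_sq (h : IsModel ω ν) (e : Sym2 (Fin n)) :
    ∫ x, (x - moment ν 1 * linkProb ω e) ^ 2 ∂linkLaw ω ν e =
      linkProb ω e * moment ν 2 - (linkProb ω e * moment ν 1) ^ 2 := by
  have := h.isProbabilityMeasure_linkLaw e
  have e1 : ∀ x : ℝ, (x - moment ν 1 * linkProb ω e) ^ 2 =
      x ^ 2 - 2 * (moment ν 1 * linkProb ω e) * x ^ 1 + (moment ν 1 * linkProb ω e) ^ 2 :=
    fun x => by ring
  simp only [e1]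
  have i1 : Integrable (fun x : ℝ => x ^ 2 - 2 * (moment ν 1 * linkProb ω e) * x ^ 1)
      (linkLaw ω ν e) := (h.integrable_linkLaw_pow e 2).sub
        ((h.integrable_linkLaw_pow e 1).const_mul _)
  rw [integral_add i1 (integrable_const _), integral_sub (h.integrable_linkLaw_pow e 2)
    ((h.integrable_linkLaw_pow e 1).const_mul _), integral_const_mul,
    h.integral_linkLaw_pow e two_ne_zero, h.integral_linkLaw_pow e one_ne_zero]
  simp only [integral_const, probReal_univ, smul_eq_mul, one_mul]
  ring

theorem integral_linkLaw_sub (h : IsModel ω ν) (e : Sym2 (Fin n)) :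
    ∫ x, (x - moment ν 1 * linkProb ω e) ∂linkLaw ω ν e = 0 := by
  have := h.isProbabilityMeasure_linkLaw e
  have h1 := h.integral_linkLaw_pow e one_ne_zero
  have h2 := h.integrable_linkLaw_pow e 1
  simp only [pow_one] at h1 h2
  rw [integral_sub h2 (integrable_const _), h1]
  simp [mul_comm]

theorem integral_centredWeight (h : IsModel ω ν) (e : Sym2 (Fin n)) :
    ∫ x, centredWeight ω ν e x ∂linkLaw ω ν e = 0 := by
  simp only [centredWeight]
  rw [integral_div, integral_neg, h.integral_linkLaw_sub]
  simp

/-- The normalization is chosen so that ω_i ω_j cancels: the leading variance is 1/(4n) for every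
pair although the links are inhomogeneous. -/
theorem integral_centredWeight_sq (h : IsModel ω ν) (e : Sym2 (Fin n)) :
    ∫ x, centredWeight ω ν e x ^ 2 ∂linkLaw ω ν e =
      1 / (4 * n) * (1 - linkProb ω e * (moment ν 1 ^ 2 / moment ν 2)) := by
  have hi : 0 < n := by
    induction e with
    | _ i j => exact i.pos
  have hn : (0 : ℝ) < n := by exact_mod_cast hi
  simp only [centredWeight, div_pow, neg_sq]
  rw [integral_div, h.integral_linkLaw_sub_sq, mul_pow, mul_pow, h.limitRadius_sq ⟨0, hi⟩,
    h.linkProb_eq]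
  have h1 := h.moment_pos 1
  have h2 := h.moment_pos 2
  have h3 := h.pairScale_pos e
  have h4 := h.avg_pos ⟨0, hi⟩
  field_simp

theorem sparsity_pos (h : IsModel ω ν) (i : Fin n) : 0 < sparsity ω ν :=
  div_pos (h.avg_pos i) (mul_pos (h.moment_pos 2) (pow_pos (h.wmin_pos i) 2))

/-- The numerator is at most 1 as weights and means lie in [0, 1], and the denominator is at least
ω_min E[W] r̃, whose inverse is √κ/2. -/
theorem ae_abs_centredWeight_le (h : IsModel ω ν) (e : Sym2 (Fin n)) :
    ∀ᵐ x ∂linkLaw ω ν e, |centredWeight ω ν e x| ≤ √(sparsity ω ν) / 2 := by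
  have hi : 0 < n := by
    induction e with
    | _ i j => exact i.pos
  have i : Fin n := ⟨0, hi⟩
  have h1 := h.moment_pos 1
  have h2 := h.moment_pos 2
  have h3 := h.pairScale_pos e
  have h4 := h.avg_pos i
  have h5 := h.wmin_pos i
  have h6 := h.limitRadius_pos i
  have h7 := h.linkProb_pos e
  have h8 := h.linkProb_le_one e
  have h9 := h.moment_one_le_one
  filter_upwards [h.ae_linkLaw e] with x hx
  have e1 : |x - moment ν 1 * linkProb ω e| ≤ 1 := by
    rw [abs_le]
    constructor <;> nlinarith
  rw [centredWeight, abs_div, abs_neg, abs_of_pos (by positivity : 0 < moment ν 1 * pairScale ω e *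
    limitRadius ω ν)]
  have e2 : moment ν 1 * limitRadius ω ν = 2 * √(moment ν 2) / √(avg ω) := by
    rw [limitRadius]
    field_simp
  have e3 : √(sparsity ω ν) / 2 = 1 / (wmin ω * (moment ν 1 * limitRadius ω ν)) := by
    rw [e2, sparsity, Real.sqrt_div h4.le, Real.sqrt_mul h2.le, Real.sqrt_sq h5.le]
    have := Real.sqrt_pos.2 h2
    have := Real.sqrt_pos.2 h4
    field_simp
  rw [e3]
  refine div_le_div₀ zero_le_one e1 (by positivity) ?_
  have := h.wmin_le_pairScale e
  have e4 : 0 < moment ν 1 * limitRadius ω ν := by positivity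
  nlinarith

/-! ### The centred matrix -/

theorem isProbabilityMeasure_networkLaw (h : IsModel ω ν)
    : IsProbabilityMeasure (networkLaw ω ν) := by
  have := h.isProbabilityMeasure_linkLaw
  unfold networkLaw
  infer_instance

theorem map_networkLaw (h : IsModel ω ν) {f : Sym2 (Fin n) → ℝ → ℝ} (hf : ∀ e, Measurable (f e)) :
    (networkLaw ω ν).map (fun w e => f e (w e)) = Measure.pi fun e => (linkLaw ω ν e).map (f e) := by
  have := h.isProbabilityMeasure_linkLaw
  have : ∀ e, IsProbabilityMeasure ((linkLaw ω ν e).map (f e)) := fun e =>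
    Measure.isProbabilityMeasure_map (hf e).aemeasurable
  exact Measure.pi_map_pi fun e => (hf e).aemeasurable

theorem integral_networkLaw_comp (h : IsModel ω ν) {f : Sym2 (Fin n) → ℝ → ℝ}
    (hf : ∀ e, Measurable (f e)) {F : (Sym2 (Fin n) → ℝ) → ℝ} (hF : Continuous F) :
    ∫ w, F (fun e => f e (w e)) ∂networkLaw ω ν =
      ∫ x, F x ∂Measure.pi fun e => (linkLaw ω ν e).map (f e) := by
  rw [← h.map_networkLaw hf, integral_map]
  · exact (measurable_pi_lambda _ fun e => (hf e).comp (measurable_pi_apply e)).aemeasurable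
  · exact hF.aestronglyMeasurable

theorem integral_eval (h : IsModel ω ν) (e : Sym2 (Fin n)) {f : ℝ → ℝ} (hf : Continuous f) :
    ∫ w, f (w e) ∂networkLaw ω ν = ∫ x, f x ∂linkLaw ω ν e := by
  have := h.isProbabilityMeasure_linkLaw
  have h1 := measurePreserving_eval (fun e => linkLaw ω ν e) e
  rw [← h1.map_eq, integral_map h1.measurable.aemeasurable hf.aestronglyMeasurable]
  rfl

theorem integrable_networkLaw (h : IsModel ω ν) {F : (Sym2 (Fin n) → ℝ) → ℝ} (hF : Continuous F) :
    Integrable F (networkLaw ω ν) := by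
  have := h.isProbabilityMeasure_linkLaw
  refine integrable_of_continuous_of_pi (K := 1) _ (fun e => ?_) hF
  filter_upwards [h.ae_linkLaw e] with x hx
  rw [abs_of_nonneg hx.1]
  exact hx.2

/-- The empirical mean of the squared entries of the centred matrix is at most `1 / 4`. -/
theorem integral_sum_centredWeight_sq_le (h : IsModel ω ν) (i : Fin n) :
    ∫ w, (∑ i, ∑ j, centredWeight ω ν s(i, j) (w s(i, j)) ^ 2) / n ∂networkLaw ω ν ≤ 1 / 4 := by
  have hn : (0 : ℝ) < n := by exact_mod_cast i.pos
  have hc := fun e => continuous_centredWeight (ω := ω) (ν := ν) e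
  have hc' : ∀ i j, Continuous fun w : Sym2 (Fin n) → ℝ =>
      centredWeight ω ν s(i, j) (w s(i, j)) ^ 2 := fun i j =>
    ((hc s(i, j)).comp (continuous_apply _)).pow 2
  rw [integral_div, integral_finsetSum _ fun i _ => h.integrable_networkLaw
    (continuous_finsetSum _ fun j _ => hc' i j)]
  have h1 : ∀ i, ∫ w, ∑ j, centredWeight ω ν s(i, j) (w s(i, j)) ^ 2 ∂networkLaw ω ν ≤ 1 / 4 := by
    intro i
    rw [integral_finsetSum _ fun j _ => h.integrable_networkLaw (hc' i j)]
    have h2 : ∀ j, ∫ w, centredWeight ω ν s(i, j) (w s(i, j)) ^ 2 ∂networkLaw ω ν ≤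
        1 / (4 * n) := by
      intro j
      rw [h.integral_eval s(i, j) (f := fun x => centredWeight ω ν s(i, j) x ^ 2) ((hc _).pow 2),
        h.integral_centredWeight_sq]
      have h3 : 0 ≤ linkProb ω s(i, j) * (moment ν 1 ^ 2 / moment ν 2) :=
        mul_nonneg (h.linkProb_pos _).le (div_nonneg (sq_nonneg _) (h.moment_pos 2).le)
      exact mul_le_of_le_one_right (by positivity) (by linarith)
    refine (Finset.sum_le_sum fun j _ => h2 j).trans ?_
    simp
    field_simp
    norm_num
  rw [div_le_iff₀ hn]
  refine (Finset.sum_le_sum fun i _ => h1 i).trans ?_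
  simp
  linarith

/-- The Stieltjes transform of the centred matrix nearly solves the semicircle equation. -/
theorem integral_norm_defect_sq_le (h : IsModel ω ν)
    (hn : 0 < n) (hK : sparsity ω ν ≤ 1) {z : ℂ} (hz : 0 < z.im)
    {b q : ℝ} (hb : b = z.im⁻¹) (hq : q = b ^ 2 / 4 + ‖z‖ * b + 1) :
    ∫ w, ‖defect z (stieltjes (adj fun e => centredWeight ω ν e (w e)) z)‖ ^ 2 ∂networkLaw ω ν ≤
      (12 * b ^ 3 * q + (b / 2 + ‖z‖) * (2 * b ^ 3 + 4 * b ^ 4) + q * b ^ 2) *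
        (√(sparsity ω ν) / 2 + 1 / n + avg ω / (4 * n)) := by
  have := h.isProbabilityMeasure_linkLaw
  have : ∀ e, IsProbabilityMeasure ((linkLaw ω ν e).map (centredWeight ω ν e)) := fun e =>
    Measure.isProbabilityMeasure_map (measurable_centredWeight e).aemeasurable
  have hn' : (0 : ℝ) < n := by exact_mod_cast hn
  have hm := fun e => (measurable_centredWeight (ω := ω) (ν := ν) e)
  have hratio : moment ν 1 ^ 2 / moment ν 2 ≤ 1 :=
    div_le_one_of_le₀ h.moment_one_sq_le (h.moment_pos 2).le
  have hratio0 : 0 ≤ moment ν 1 ^ 2 / moment ν 2 :=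
    div_nonneg (sq_nonneg _) (h.moment_pos 2).le
  have h2 : ∀ e, ∫ x, x ^ 2 ∂(linkLaw ω ν e).map (centredWeight ω ν e) =
      1 / (4 * n) * (1 - linkProb ω e * (moment ν 1 ^ 2 / moment ν 2)) := fun e => by
    rw [integral_map (hm e).aemeasurable (by fun_prop), h.integral_centredWeight_sq]
  rw [h.integral_networkLaw_comp hm
    (F := fun x => ‖defect z (stieltjes (adj x) z)‖ ^ 2)
      ((continuous_norm.comp (continuous_defect_stieltjes hz)).pow 2)]
  refine WeightedChungLu.integral_norm_defect_sq_le (K := √(sparsity ω ν) / 2) _ hn ?_ ?_ ?_ ?_ ?_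
    hz hb hq
  · have := Real.sqrt_le_one.2 hK
    linarith
  · intro e
    rw [integral_map (hm e).aemeasurable (by fun_prop)]
    exact h.integral_centredWeight e
  · intro e
    rw [h2]
    have h3 := mul_nonneg (h.linkProb_pos e).le hratio0
    exact mul_le_of_le_one_right (by positivity) (by linarith)
  · have h4 : ∀ i j : Fin n, 1 / (4 * n) - ∫ x, x ^ 2 ∂(linkLaw ω ν s(i, j)).map
        (centredWeight ω ν s(i, j)) ≤ 1 / (4 * n) * linkProb ω s(i, j) := by
      intro i j
      rw [h2]
      have h5 : linkProb ω s(i, j) * (moment ν 1 ^ 2 / moment ν 2) ≤ linkProb ω s(i, j) :=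
        mul_le_of_le_one_right (h.linkProb_pos _).le hratio
      have h6 : (0 : ℝ) ≤ 1 / (4 * n) := by positivity
      nlinarith
    -- The deficit of each variance is at most p_ij / (4n), and the link probabilities of a row sum
    -- to ω_i, whence the total ω_avg / (4n) after normalization.
    have h7 : ∑ i : Fin n, ∑ j : Fin n, (1 / (4 * n) - ∫ x, x ^ 2 ∂(linkLaw ω ν s(i, j)).map
        (centredWeight ω ν s(i, j))) ≤ 1 / (4 * n) * ∑ i, ω i := by
      rw [Finset.mul_sum]
      refine Finset.sum_le_sum fun i _ => (Finset.sum_le_sum fun j _ => h4 i j).trans ?_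
      rw [← Finset.mul_sum, h.sum_linkProb]
    refine (mul_le_mul_of_nonneg_left h7 (by positivity)).trans (le_of_eq ?_)
    rw [avg]
    field_simp
  · intro e
    rw [ae_map_iff (hm e).aemeasurable (measurableSet_le (by fun_prop) measurable_const)]
    exact h.ae_abs_centredWeight_le e

/-! ### Degrees -/

theorem iIndepFun_eval (h : IsModel ω ν) :
    ProbabilityTheory.iIndepFun (fun e (w : Sym2 (Fin n) → ℝ) => w e) (networkLaw ω ν) := by
  have := h.isProbabilityMeasure_linkLaw
  exact ProbabilityTheory.iIndepFun_pi (μ := fun e => linkLaw ω ν e) (X := fun _ x => x)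
    fun _ => aemeasurable_id

theorem iIndepFun_row (h : IsModel ω ν) (i : Fin n) :
    ProbabilityTheory.iIndepFun (fun j (w : Sym2 (Fin n) → ℝ) => w s(i, j)) (networkLaw ω ν) :=
  h.iIndepFun_eval.precomp (g := fun j => s(i, j)) fun _ _ hj => Sym2.congr_right.1 hj

theorem integral_deg (h : IsModel ω ν) (i : Fin n) :
    ∫ w, deg w i ∂networkLaw ω ν = moment ν 1 * ω i := by
  simp only [deg, adj, Matrix.of_apply]
  rw [integral_finsetSum _ fun j _ => h.integrable_networkLaw (continuous_apply _)]
  have h1 : ∀ j, ∫ w, w s(i, j) ∂networkLaw ω ν = linkProb ω s(i, j) * moment ν 1 := fun j => by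
    have := h.integral_linkLaw_pow s(i, j) one_ne_zero
    simp only [pow_one] at this
    rw [← this]
    exact h.integral_eval s(i, j) (f := fun x => x) continuous_id
  simp only [h1]
  rw [← Finset.sum_mul, h.sum_linkProb, mul_comm]

theorem variance_deg_le (h : IsModel ω ν) (i : Fin n) :
    ProbabilityTheory.variance (fun w => deg w i) (networkLaw ω ν) ≤ moment ν 2 * ω i := by
  have := h.isProbabilityMeasure_networkLaw
  have h1 : (fun w : Sym2 (Fin n) → ℝ => deg w i) = ∑ j, fun w => w s(i, j) := by
    ext w
    simp [deg, adj]
  have hL : ∀ j, MemLp (fun w : Sym2 (Fin n) → ℝ => w s(i, j)) 2 (networkLaw ω ν) := fun j => by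
    refine (memLp_two_iff_integrable_sq (measurable_pi_apply _).aestronglyMeasurable).2 ?_
    exact h.integrable_networkLaw (by fun_prop)
  rw [h1, ProbabilityTheory.IndepFun.variance_sum (fun j _ => hL j)
    (fun j _ k _ hjk => (h.iIndepFun_row i).indepFun hjk), ← h.sum_linkProb i, Finset.mul_sum]
  refine Finset.sum_le_sum fun j _ => ?_
  refine (ProbabilityTheory.variance_le_expectation_sq
    (measurable_pi_apply _).aestronglyMeasurable).trans (le_of_eq ?_)
  rw [mul_comm, ← h.integral_linkLaw_pow s(i, j) two_ne_zero]
  exact h.integral_eval s(i, j) (f := fun x => x ^ 2) (by fun_prop)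

/-- Chebyshev's bound for the weighted degrees. -/
theorem integral_deg_sub_sq_le (h : IsModel ω ν) (i : Fin n) :
    ∫ w, (deg w i / (moment ν 1 * ω i) - 1) ^ 2 ∂networkLaw ω ν ≤ sparsity ω ν := by
  have := h.isProbabilityMeasure_networkLaw
  have h1 := h.moment_pos 1
  have h2 := h.moment_pos 2
  have h3 := h.pos i
  have h4 := h.wmin_pos i
  have h5 := wmin_le_avg ω i
  have e1 : ∀ w : Sym2 (Fin n) → ℝ, (deg w i / (moment ν 1 * ω i) - 1) ^ 2 =
      (deg w i - moment ν 1 * ω i) ^ 2 / (moment ν 1 * ω i) ^ 2 := fun w => by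
    field_simp
  simp only [e1]
  have e2 := h.variance_deg_le i
  rw [ProbabilityTheory.variance_eq_integral (continuous_deg i).aemeasurable,
    h.integral_deg] at e2
  rw [integral_div, sparsity, div_le_div_iff₀ (by positivity) (by positivity)]
  -- The inequalities E[W²] ≤ E[W], ω_min ≤ ω_avg and ω_min ≤ ω_i together replace the natural bound
  -- E[W²] / (E[W]² ω_i) by κ.
  have e3 : moment ν 2 * ω i * (moment ν 2 * wmin ω ^ 2) ≤ avg ω * (moment ν 1 * ω i) ^ 2 := by
    have e4 : moment ν 2 ^ 2 ≤ moment ν 1 ^ 2 := pow_le_pow_left₀ h2.le h.moment_two_le 2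
    have e5 : wmin ω ^ 2 ≤ avg ω * ω i := by
      rw [sq]
      exact mul_le_mul h5 (wmin_le ω i) h4.le (h4.le.trans h5)
    calc moment ν 2 * ω i * (moment ν 2 * wmin ω ^ 2) = moment ν 2 ^ 2 * (ω i * wmin ω ^ 2) := by
          ring
      _ ≤ moment ν 1 ^ 2 * (ω i * (avg ω * ω i)) := by gcongr
      _ = _ := by ring
  exact (mul_le_mul_of_nonneg_right e2 (by positivity)).trans e3

end IsModel

end WeightedChungLu

namespace WeightedChungLu

/-! ### Replacing the degrees by their means -/

/-- Interpolate by the matrix S X S, where S is T reset to 1 at the bad indices. It differs from Y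
by rank at most 1 + 2 |bad|, and from X by entries (1 - S_i S_j) X_ij of modulus at most (τ² +
2τ)|X_ij| ≤ 3τ |X_ij|. No bound on T at bad indices is needed, so vertices of degree 0 are covered.
-/
theorem norm_stieltjes_diagonal_mul_sub_le {ι : Type*} [Fintype ι] [DecidableEq ι]
    {X Y : Matrix ι ι ℝ} (hX : X.IsHermitian) (hY : Y.IsHermitian) (T a : ι → ℝ) (c : ℝ)
    (h : ∀ i j, Y i j = T i * X i j * T j - c * a i * a j) {τ : ℝ} (hτ0 : 0 ≤ τ) (hτ : τ ≤ 1)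
    (bad : Finset ι) (hbad : ∀ i ∉ bad, |T i - 1| ≤ τ) {z : ℂ} (hz : 0 < z.im) :
    ‖stieltjes Y z - stieltjes X z‖ ≤
      2 * z.im⁻¹ * ((1 + 2 * bad.card) / Fintype.card ι) +
        z.im⁻¹ ^ 2 * (3 * τ * √((∑ i, ∑ j, X i j ^ 2) / Fintype.card ι)) := by
  classical
  set S : ι → ℝ := fun i => if i ∈ bad then 1 else T i with hS
  have hS1 : ∀ i, |S i - 1| ≤ τ := fun i => by
    by_cases hi : i ∈ bad
    · simp [hS, hi, hτ0]
    · simpa [hS, hi] using hbad i hi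
  set M : Matrix ι ι ℝ := Matrix.of fun i j => S i * X i j * S j with hMdef
  have hsymm : ∀ i j, X j i = X i j := fun i j => by
    have := hX.apply i j
    simpa using this
  have hM : M.IsHermitian := by
    ext i j
    simp only [hMdef, Matrix.conjTranspose_apply, Matrix.of_apply, star_trivial, hsymm i j]
    ring
  have h1 : ‖stieltjes Y z - stieltjes M z‖ ≤
      2 * z.im⁻¹ * ((1 + 2 * bad.card) / Fintype.card ι) := by
    refine (norm_stieltjes_sub_le_rank hY hM hz).trans ?_
    have e1 : (M - Y).map Complex.ofReal =
        Matrix.diagonal (fun i => ((S i - T i : ℝ) : ℂ)) *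
          (X.map Complex.ofReal * Matrix.diagonal (fun i => (S i : ℂ))) +
        (Matrix.diagonal (fun i => (T i : ℂ)) * X.map Complex.ofReal) *
          Matrix.diagonal (fun i => ((S i - T i : ℝ) : ℂ)) +
        Matrix.vecMulVec (fun i => ((c * a i : ℝ) : ℂ)) (fun i => (a i : ℂ)) := by
      ext i j
      simp only [hMdef, Matrix.map_apply, Matrix.sub_apply, Matrix.of_apply, h, Matrix.add_apply,
        Matrix.diagonal_mul, Matrix.mul_diagonal, Matrix.vecMulVec_apply]
      push_cast
      ring
    have e2 : (Matrix.diagonal (fun i => ((S i - T i : ℝ) : ℂ))).rank ≤ bad.card := by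
      rw [Matrix.rank_diagonal, Fintype.card_subtype]
      refine Finset.card_le_card fun i hi => ?_
      by_contra hib
      simp [hS, hib] at hi
    have e3 : ((M - Y).map Complex.ofReal).rank ≤ bad.card + bad.card + 1 := by
      rw [e1]
      refine (rank_add_le_rank_add_rank _ _).trans (add_le_add ?_ (Matrix.rank_vecMulVec_le _ _))
      exact (rank_add_le_rank_add_rank _ _).trans (add_le_add
        ((Matrix.rank_mul_le_left _ _).trans e2) ((Matrix.rank_mul_le_right _ _).trans e2))
    have e4 : (((M - Y).map Complex.ofReal).rank : ℝ) ≤ 1 + 2 * bad.card := by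
      have : (((M - Y).map Complex.ofReal).rank : ℝ) ≤ ((bad.card + bad.card + 1 : ℕ) : ℝ) := by
        exact_mod_cast e3
      push_cast at this
      linarith
    have := inv_nonneg.2 hz.le
    gcongr
  have h2 : ‖stieltjes M z - stieltjes X z‖ ≤
      z.im⁻¹ ^ 2 * (3 * τ * √((∑ i, ∑ j, X i j ^ 2) / Fintype.card ι)) := by
    refine (norm_stieltjes_sub_le_sqrt hM hX hz).trans ?_
    refine mul_le_mul_of_nonneg_left ?_ (by positivity)
    rw [← Real.sqrt_sq (by positivity : 0 ≤ 3 * τ), ← Real.sqrt_mul (sq_nonneg _), ← mul_div_assoc]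
    refine Real.sqrt_le_sqrt (div_le_div_of_nonneg_right ?_ (Nat.cast_nonneg _))
    rw [Finset.mul_sum]
    refine Finset.sum_le_sum fun i _ => ?_
    rw [Finset.mul_sum]
    refine Finset.sum_le_sum fun j _ => ?_
    have e1 : (X - M) i j = (1 - S i * S j) * X i j := by
      simp only [hMdef, Matrix.sub_apply, Matrix.of_apply]
      ring
    rw [e1, mul_pow]
    refine mul_le_mul_of_nonneg_right ?_ (sq_nonneg _)
    rw [← sq_abs (1 - S i * S j)]
    refine pow_le_pow_left₀ (abs_nonneg _) ?_ 2
    have e2 : 1 - S i * S j = -((S i - 1) * (S j - 1) + (S i - 1) + (S j - 1)) := by ring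
    rw [e2, abs_neg]
    refine (abs_add_three _ _ _).trans ?_
    rw [abs_mul]
    have := mul_le_mul (hS1 i) (hS1 j) (abs_nonneg _) hτ0
    nlinarith [hS1 i, hS1 j]
  calc ‖stieltjes Y z - stieltjes X z‖
      = ‖(stieltjes Y z - stieltjes M z) + (stieltjes M z - stieltjes X z)‖ := by ring_nf
    _ ≤ _ := (norm_add_le _ _).trans (add_le_add h1 h2)

/-- The left side is |x - 1| / (√x + x), and the denominator is at least 1 for x ≥ 1/2. -/
theorem abs_inv_sqrt_sub_one_le {x τ : ℝ} (hτ : τ ≤ 1 / 2) (hx : |x - 1| ≤ τ) :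
    |(√x)⁻¹ - 1| ≤ τ := by
  have h1 := abs_le.1 hx
  have hx0 : 1 / 2 ≤ x := by linarith
  have hs : 1 / 2 ≤ √x := Real.le_sqrt_of_sq_le (by norm_num; linarith)
  have hs0 : 0 < √x := by linarith
  have h2 : √x ^ 2 = x := Real.sq_sqrt (by linarith)
  have h3 : (√x)⁻¹ - 1 = -(x - 1) / (√x + x) := by
    field_simp
    nlinarith
  rw [h3, abs_div, abs_neg, abs_of_pos (by linarith : 0 < √x + x)]
  exact (div_le_self (abs_nonneg _) (by linarith)).trans hx

variable {n : ℕ} {ω : Fin n → ℝ} {ν : Measure ℝ}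

/-- The ratio of the weighted degree of a node and its mean. -/
noncomputable def relDeg (ω : Fin n → ℝ) (ν : Measure ℝ) (w : Sym2 (Fin n) → ℝ) (i : Fin n) : ℝ :=
  deg w i / (moment ν 1 * ω i)

theorem continuous_relDeg (i : Fin n) : Continuous fun w => relDeg ω ν w i :=
  (continuous_deg i).div_const _

namespace IsModel

variable [IsProbabilityMeasure ν]

/-- The normalized Laplacian in terms of the centred matrix. -/
theorem scaledLap_apply (h : IsModel ω ν) (w : Sym2 (Fin n) → ℝ) (i j : Fin n) :
    scaledLap w (limitRadius ω ν) i j =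
      (√(relDeg ω ν w i))⁻¹ * adj (fun e => centredWeight ω ν e (w e)) i j *
          (√(relDeg ω ν w j))⁻¹ -
        moment ν 1 * rho ω / limitRadius ω ν * (ω i * (√(deg w i))⁻¹) *
          (ω j * (√(deg w j))⁻¹) := by
  have h1 := h.moment_pos 1
  have hi := h.pos i
  have hj := h.pos j
  have hr := h.limitRadius_pos i
  -- This holds for degree 0 too, where both sides are 0, so the decomposition is valid for every w
  -- without an exceptional event.
  have hT : ∀ k, (√(relDeg ω ν w k))⁻¹ = √(moment ν 1) * √(ω k) * (√(deg w k))⁻¹ := fun k => by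
    rw [relDeg, Real.sqrt_div' _ (mul_pos h1 (h.pos k)).le, Real.sqrt_mul h1.le, inv_div,
      div_eq_mul_inv]
  rw [hT, hT]
  simp only [scaledLap, normLap, invSqrtDeg, Matrix.smul_apply, Matrix.sub_apply,
    Matrix.mul_diagonal, Matrix.diagonal_mul, adj, Matrix.of_apply, centredWeight, linkProb_mk,
    pairScale_mk, smul_eq_mul]
  rw [Real.sqrt_mul hi.le]
  have s1 := Real.sqrt_pos.2 hi
  have s2 := Real.sqrt_pos.2 hj
  have s3 : √(moment ν 1) * √(moment ν 1) = moment ν 1 := Real.mul_self_sqrt h1.le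
  generalize (√(deg w i))⁻¹ = di
  generalize (√(deg w j))⁻¹ = dj
  have e1 : √(moment ν 1) * √(ω i) * di * (-(w s(i, j) - moment ν 1 * (rho ω * ω i * ω j)) /
      (moment ν 1 * (√(ω i) * √(ω j)) * limitRadius ω ν)) * (√(moment ν 1) * √(ω j) * dj) =
      (√(moment ν 1) * √(moment ν 1)) * ((√(ω i) * √(ω j)) * (di * dj *
      (-(w s(i, j) - moment ν 1 * (rho ω * ω i * ω j)) /
      (moment ν 1 * (√(ω i) * √(ω j)) * limitRadius ω ν)))) := by ring
  rw [e1, s3]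
  field_simp
  ring

/-- The number of bad vertices is bounded pointwise by a sum of squares, as in Chebyshev's
inequality; every random term on the right then has a mean that is known to be bounded. -/
theorem norm_stieltjes_scaledLap_sub_le (h : IsModel ω ν) (w : Sym2 (Fin n) → ℝ) {τ : ℝ}
    (hτ0 : 0 < τ) (hτ : τ ≤ 1 / 2) {z : ℂ} (hz : 0 < z.im) :
    ‖stieltjes (scaledLap w (limitRadius ω ν)) z -
        stieltjes (adj fun e => centredWeight ω ν e (w e)) z‖ ≤
      2 * z.im⁻¹ * ((1 + 2 * ∑ i, (relDeg ω ν w i - 1) ^ 2 / τ ^ 2) / n) +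
        z.im⁻¹ ^ 2 * (3 * τ *
          (1 + (∑ i, ∑ j, centredWeight ω ν s(i, j) (w s(i, j)) ^ 2) / n)) := by
  classical
  set bad : Finset (Fin n) := Finset.univ.filter fun i => τ < |relDeg ω ν w i - 1| with hb
  have hbad : (bad.card : ℝ) ≤ ∑ i, (relDeg ω ν w i - 1) ^ 2 / τ ^ 2 := by
    have : ∑ _i ∈ bad, (1 : ℝ) ≤ ∑ i ∈ bad, (relDeg ω ν w i - 1) ^ 2 / τ ^ 2 := by
      refine Finset.sum_le_sum fun i hi => ?_
      rw [one_le_div (by positivity), ← sq_abs (relDeg ω ν w i - 1)]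
      exact pow_le_pow_left₀ hτ0.le (by simpa [hb] using hi : _ < _).le 2
    rw [Finset.sum_const, nsmul_eq_mul, mul_one] at this
    exact this.trans (Finset.sum_le_sum_of_subset_of_nonneg (Finset.subset_univ _)
      fun i _ _ => by positivity)
  have h1 := norm_stieltjes_diagonal_mul_sub_le (adj_isHermitian
    (fun e => centredWeight ω ν e (w e))) (scaledLap_isHermitian w (limitRadius ω ν)) _ _ _
    (fun i j => by rw [h.scaledLap_apply w i j]) hτ0.le (by linarith) bad (fun i hi =>
      abs_inv_sqrt_sub_one_le hτ (by simpa [hb] using hi)) hz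
  refine h1.trans ?_
  rw [Fintype.card_fin]
  have := inv_pos.2 hz
  -- Makes the bound linear in the squared Frobenius norm, whose mean is available.
  have hs : ∀ x : ℝ, 0 ≤ x → √x ≤ 1 + x := fun x hx => by
    rw [Real.sqrt_le_left (by linarith)]
    nlinarith
  gcongr
  exact hs _ (by positivity)

/-- The defect is Lipschitz on the ball of radius b, so it passes from X to the rescaled Laplacian.
Using Z in place of ‖z‖ keeps the bound uniform over a compact range of Re z. -/
theorem integral_norm_defect_scaledLap_le (h : IsModel ω ν) (hn : 0 < n)
    (hK : sparsity ω ν ≤ 1) {z : ℂ} (hz : 0 < z.im) {b Z q δ τ : ℝ} (hb : b = z.im⁻¹)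
    (hZ : ‖z‖ ≤ Z) (hq : q = b ^ 2 / 4 + Z * b + 1) (hδ : 0 < δ) (hτ0 : 0 < τ) (hτ : τ ≤ 1 / 2) :
    ∫ w, ‖defect z (stieltjes (scaledLap w (limitRadius ω ν)) z)‖ ∂networkLaw ω ν ≤
      δ + δ⁻¹ * ((12 * b ^ 3 * q + (b / 2 + Z) * (2 * b ^ 3 + 4 * b ^ 4) + q * b ^ 2) *
        (√(sparsity ω ν) / 2 + 1 / n + avg ω / (4 * n))) +
      (b / 2 + Z) * (2 * b * (1 / n + 2 * (sparsity ω ν / τ ^ 2)) + b ^ 2 * (6 * τ)) := by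
  have := h.isProbabilityMeasure_networkLaw
  have hb0 : 0 < b := hb ▸ inv_pos.2 hz
  have hZ0 : 0 ≤ Z := (norm_nonneg z).trans hZ
  have hn' : (0 : ℝ) < n := by exact_mod_cast hn
  have i : Fin n := ⟨0, hn⟩
  set sX : (Sym2 (Fin n) → ℝ) → ℂ := fun w =>
    stieltjes (adj fun e => centredWeight ω ν e (w e)) z with hsX
  set F : (Sym2 (Fin n) → ℝ) → ℝ := fun w => ‖defect z (sX w)‖ ^ 2 with hF
  set G : (Sym2 (Fin n) → ℝ) → ℝ := fun w => ∑ i, (relDeg ω ν w i - 1) ^ 2 / τ ^ 2 with hG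
  set H : (Sym2 (Fin n) → ℝ) → ℝ := fun w =>
    (∑ i, ∑ j, centredWeight ω ν s(i, j) (w s(i, j)) ^ 2) / n with hH
  have hcw : Continuous fun (w : Sym2 (Fin n) → ℝ) (e : Sym2 (Fin n)) =>
      centredWeight ω ν e (w e) := continuous_pi fun e =>
    (continuous_centredWeight e).comp (continuous_apply e)
  have cF : Continuous F :=
    (continuous_norm.comp ((continuous_defect_stieltjes hz).comp hcw)).pow 2
  have cGi : ∀ i, Continuous fun w => (relDeg ω ν w i - 1) ^ 2 := fun i =>
    ((continuous_relDeg i).sub continuous_const).pow 2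
  have cG : Continuous G := continuous_finsetSum _ fun i _ => (cGi i).div_const _
  have cH : Continuous H := (continuous_finsetSum _ fun i _ => continuous_finsetSum _ fun j _ =>
    ((continuous_centredWeight _).comp (continuous_apply _)).pow 2).div_const _
  have iF := h.integrable_networkLaw cF
  have iG := h.integrable_networkLaw cG
  have iH := h.integrable_networkLaw cH
  have bF : ∫ w, F w ∂networkLaw ω ν ≤
      (12 * b ^ 3 * q + (b / 2 + Z) * (2 * b ^ 3 + 4 * b ^ 4) + q * b ^ 2) *
        (√(sparsity ω ν) / 2 + 1 / n + avg ω / (4 * n)) := by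
    refine (h.integral_norm_defect_sq_le hn hK hz hb rfl).trans ?_
    have := (h.avg_pos i).le
    rw [hq]
    gcongr
  have bG : ∫ w, G w ∂networkLaw ω ν ≤ n * (sparsity ω ν / τ ^ 2) := by
    simp only [hG]
    rw [integral_finsetSum _ fun i _ => h.integrable_networkLaw ((cGi i).div_const _)]
    have : ∀ i : Fin n, ∫ w, (relDeg ω ν w i - 1) ^ 2 / τ ^ 2 ∂networkLaw ω ν ≤
        sparsity ω ν / τ ^ 2 := fun i => by
      rw [integral_div]
      exact div_le_div_of_nonneg_right (h.integral_deg_sub_sq_le i) (by positivity)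
    refine (Finset.sum_le_sum fun i _ => this i).trans ?_
    simp
  have bH : ∫ w, H w ∂networkLaw ω ν ≤ 1 / 4 := h.integral_sum_centredWeight_sq_le i
  have hpt : ∀ w, ‖defect z (stieltjes (scaledLap w (limitRadius ω ν)) z)‖ ≤
      (δ + (b / 2 + Z) * (2 * b * (1 / n) + b ^ 2 * (3 * τ))) + δ⁻¹ * F w +
        (b / 2 + Z) * (2 * b * (2 / n)) * G w + (b / 2 + Z) * (b ^ 2 * (3 * τ)) * H w := by
    intro w
    have h1 := h.norm_stieltjes_scaledLap_sub_le w hτ0 hτ hz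
    have h2 := norm_defect_sub_le (z := z) (norm_stieltjes_le (scaledLap_isHermitian w
      (limitRadius ω ν)) hz) (norm_stieltjes_le (adj_isHermitian
      fun e => centredWeight ω ν e (w e)) hz)
    rw [← hb] at h1 h2
    -- A Young inequality, by which the second moment of the defect controls the first.
    have h3 : ‖defect z (sX w)‖ ≤ δ + δ⁻¹ * F w := by
      have e1 := sq_nonneg (‖defect z (sX w)‖ - δ)
      have e2 := norm_nonneg (defect z (sX w))
      rw [← sub_nonneg]
      have e3 : δ + δ⁻¹ * F w - ‖defect z (sX w)‖ =
          δ⁻¹ * ((‖defect z (sX w)‖ - δ) ^ 2 + δ * ‖defect z (sX w)‖) := by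
        simp only [hF]
        field_simp
        ring
      rw [e3]
      positivity
    have h4 := norm_sub_norm_le (defect z (stieltjes (scaledLap w (limitRadius ω ν)) z))
      (defect z (sX w))
    have h5 : (b / 2 + ‖z‖) * ‖stieltjes (scaledLap w (limitRadius ω ν)) z - sX w‖ ≤
        (b / 2 + Z) * (2 * b * ((1 + 2 * G w) / n) + b ^ 2 * (3 * τ * (1 + H w))) := by
      gcongr
    have h6 : (b / 2 + Z) * (2 * b * ((1 + 2 * G w) / n) + b ^ 2 * (3 * τ * (1 + H w))) =
      (b / 2 + Z) * (2 * b * (1 / n) + b ^ 2 * (3 * τ)) +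
        (b / 2 + Z) * (2 * b * (2 / n)) * G w + (b / 2 + Z) * (b ^ 2 * (3 * τ)) * H w := by
      ring
    linarith
  have i1 : Integrable (fun w => (δ + (b / 2 + Z) * (2 * b * (1 / n) + b ^ 2 * (3 * τ))) +
      δ⁻¹ * F w) (networkLaw ω ν) := (integrable_const _).add (iF.const_mul _)
  have i2 : Integrable (fun w => (δ + (b / 2 + Z) * (2 * b * (1 / n) + b ^ 2 * (3 * τ))) +
      δ⁻¹ * F w + (b / 2 + Z) * (2 * b * (2 / n)) * G w) (networkLaw ω ν) :=
    i1.add (iG.const_mul _)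
  have i3 : Integrable (fun w => (δ + (b / 2 + Z) * (2 * b * (1 / n) + b ^ 2 * (3 * τ))) +
      δ⁻¹ * F w + (b / 2 + Z) * (2 * b * (2 / n)) * G w + (b / 2 + Z) * (b ^ 2 * (3 * τ)) * H w)
      (networkLaw ω ν) := i2.add (iH.const_mul _)
  refine (integral_mono_of_nonneg (Eventually.of_forall fun _ => norm_nonneg _) i3
    (Eventually.of_forall hpt)).trans ?_
  rw [integral_add i2 (iH.const_mul _), integral_add i1 (iG.const_mul _),
    integral_add (integrable_const _) (iF.const_mul _), integral_const_mul, integral_const_mul,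
    integral_const_mul]
  simp only [integral_const, probReal_univ, smul_eq_mul, one_mul]
  have e1 : (b / 2 + Z) * (2 * b * (2 / n)) * ∫ w, G w ∂networkLaw ω ν ≤
      (b / 2 + Z) * (2 * b * (2 / n)) * (n * (sparsity ω ν / τ ^ 2)) := by gcongr
  have e2 : (b / 2 + Z) * (b ^ 2 * (3 * τ)) * ∫ w, H w ∂networkLaw ω ν ≤
      (b / 2 + Z) * (b ^ 2 * (3 * τ)) * 1 := by
    gcongr
    linarith
  have e3 : δ⁻¹ * ∫ w, F w ∂networkLaw ω ν ≤ δ⁻¹ *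
      ((12 * b ^ 3 * q + (b / 2 + Z) * (2 * b ^ 3 + 4 * b ^ 4) + q * b ^ 2) *
        (√(sparsity ω ν) / 2 + 1 / n + avg ω / (4 * n))) := by gcongr
  have e4 : (b / 2 + Z) * (2 * b * (2 / n)) * (n * (sparsity ω ν / τ ^ 2)) =
      (b / 2 + Z) * (2 * b * (2 * (sparsity ω ν / τ ^ 2))) := by
    field_simp
  rw [e4] at e1
  linarith

end IsModel

/-- The linear statistics of the rescaled eigenvalues converge to those of the semicircle law. -/
theorem tendsto_integral_abs_linearStatistic_eig
    {ω : (n : ℕ) → Fin n → ℝ} {ν : ℕ → Measure ℝ} [∀ n, IsProbabilityMeasure (ν n)]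
    (h : ∀ n, IsModel (ω n) (ν n))
    (hκ : Tendsto (fun n => sparsity (ω n) (ν n)) atTop (𝓝 0))
    (hs : Tendsto (fun n : ℕ => avg (ω n) / n) atTop (𝓝 0))
    {g : ℝ → ℝ} (hg : Continuous g) (hc : HasCompactSupport g) :
    Tendsto (fun n : ℕ => ∫ w, |(n : ℝ)⁻¹ * ∑ i, g ((eig w i - 1) / limitRadius (ω n) (ν n)) -
      ∫ E, g E * semicircleDensity 0 1 E| ∂networkLaw (ω n) (ν n)) atTop (𝓝 0) := by
  have := fun n => (h n).isProbabilityMeasure_networkLaw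
  refine tendsto_integral_abs_linearStatistic (fun n => networkLaw (ω n) (ν n))
    (fun n w i => (eig w i - 1) / limitRadius (ω n) (ν n))
    (fun n i => ((measurable_eig i).sub_const _).div_const _) ?_ hg hc
  intro η hη B ε hε
  set b := η⁻¹ with hb
  set Z := |B| + η with hZ
  set q := b ^ 2 / 4 + Z * b + 1 with hq
  have hb0 : 0 < b := inv_pos.2 hη
  have hZ0 : 0 < Z := by positivity
  -- The tolerance τ is fixed before n grows: its own contribution stays below ε / 4, while κ / τ²
  -- still tends to 0.
  set τ := min (1 / 2) (ε / 4 / ((b / 2 + Z) * (b ^ 2 * 6))) with hτ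
  have hτ0 : 0 < τ := lt_min (by norm_num) (by positivity)
  have hττ : (b / 2 + Z) * (b ^ 2 * (6 * τ)) ≤ ε / 4 := by
    have : τ ≤ ε / 4 / ((b / 2 + Z) * (b ^ 2 * 6)) := min_le_right _ _
    rw [le_div_iff₀ (by positivity)] at this
    linarith
  set C := 12 * b ^ 3 * q + (b / 2 + Z) * (2 * b ^ 3 + 4 * b ^ 4) + q * b ^ 2 with hC
  have hinv : Tendsto (fun n : ℕ => 1 / (n : ℝ)) atTop (𝓝 0) :=
    tendsto_one_div_atTop_nhds_zero_nat
  have l1 : Tendsto (fun n : ℕ => (ε / 4)⁻¹ * (C * (√(sparsity (ω n) (ν n)) / 2 + 1 / n +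
      avg (ω n) / n / 4))) atTop (𝓝 ((ε / 4)⁻¹ * (C * (√0 / 2 + 0 + 0 / 4)))) :=
    (((((hκ.sqrt).div_const 2).add hinv).add (hs.div_const 4)).const_mul _).const_mul _
  have l2 : Tendsto (fun n : ℕ => (b / 2 + Z) * (2 * b * (1 / (n : ℝ) +
      2 * (sparsity (ω n) (ν n) / τ ^ 2)))) atTop
      (𝓝 ((b / 2 + Z) * (2 * b * (0 + 2 * (0 / τ ^ 2))))) :=
    ((hinv.add ((hκ.div_const _).const_mul _)).const_mul _).const_mul _
  simp only [Real.sqrt_zero, zero_div, add_zero, mul_zero] at l1 l2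
  filter_upwards [l1.eventually_le_const (show 0 < ε / 4 by positivity),
    l2.eventually_le_const (show 0 < ε / 4 by positivity),
    hκ.eventually_le_const one_pos, eventually_gt_atTop 0] with n h1 h2 h3 hn E hE
  have hz : (0 : ℝ) < (E + η * Complex.I : ℂ).im := by simpa using hη
  have hzim : (E + η * Complex.I : ℂ).im = η := by simp
  have hnorm : ‖(E + η * Complex.I : ℂ)‖ ≤ Z := by
    refine (norm_add_le _ _).trans ?_
    simp only [Complex.norm_mul, Complex.norm_real, Complex.norm_I, mul_one, Real.norm_eq_abs,
      abs_of_pos hη]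
    have := le_abs_self B
    linarith
  have key := (h n).integral_norm_defect_scaledLap_le hn h3 hz (b := b) (by rw [hzim]) hnorm hq
    (show 0 < ε / 4 by positivity) hτ0 (min_le_left _ _)
  have hst : ∀ w : Sym2 (Fin n) → ℝ,
      stieltjes (scaledLap w (limitRadius (ω n) (ν n))) (E + η * Complex.I) =
        empStieltjes (fun l => (eig w l - 1) / limitRadius (ω n) (ν n)) (E + η * Complex.I) :=
    fun w => stieltjes_scaledLap w ((h n).limitRadius_pos ⟨0, hn⟩) hz
  simp only [hst] at key
  refine key.trans ?_
  have e1 : avg (ω n) / (4 * n) = avg (ω n) / n / 4 := by ring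
  rw [e1, mul_add (b / 2 + Z) (2 * b * _), ← hC]
  linarith

end WeightedChungLu

namespace WeightedChungLu

/-! ### Traces of powers and quadratic forms -/

section Trace

variable {ι : Type*} [Fintype ι] [DecidableEq ι]

theorem trace_pow_eq_sum_eigenvalues_pow {A : Matrix ι ι ℝ} (hA : A.IsHermitian) (k : ℕ) :
    (A ^ k).trace = ∑ i, hA.eigenvalues i ^ k := by
  conv_lhs => rw [hA.spectral_theorem]
  rw [← map_pow, Matrix.diagonal_pow, Unitary.conjStarAlgAut_apply, Matrix.trace_mul_comm,
    ← mul_assoc]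
  simp [Matrix.trace_diagonal]

/-- For even k all terms of the trace are nonnegative, so each eigenvalue satisfies |λ|^k ≤ s^k. -/
theorem abs_dotProduct_mulVec_le_of_trace_pow_le {A : Matrix ι ι ℝ} (hA : A.IsHermitian) {k : ℕ}
    (hk : Even k) (hk0 : k ≠ 0) {s : ℝ} (hs : 0 ≤ s) (h : (A ^ k).trace ≤ s ^ k) (x : ι → ℝ) :
    |x ⬝ᵥ A.mulVec x| ≤ s * (x ⬝ᵥ x) := by
  have h1 : ∀ i, |hA.eigenvalues i| ≤ s := fun i => by
    refine le_of_pow_le_pow_left₀ hk0 hs ?_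
    rw [hk.pow_abs]
    refine le_trans ?_ h
    rw [trace_pow_eq_sum_eigenvalues_pow hA]
    exact Finset.single_le_sum (f := fun i => hA.eigenvalues i ^ k)
      (fun i _ => hk.pow_nonneg _) (Finset.mem_univ i)
  have h2 : ∀ i, |hA.eigenvalues₀ i| ≤ s := fun i => by
    have := h1 (Fintype.equivOfCardEq (Fintype.card_fin _) i)
    simpa [Matrix.IsHermitian.eigenvalues] using this
  obtain ⟨b, hb⟩ := exists_orthonormalBasis_dotProduct_mulVec hA
  have e1 := hb (WithLp.toLp 2 x)
  have e2 := dotProduct_self_eq_sum_repr_sq b (WithLp.toLp 2 x)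
  simp only at e1 e2
  rw [e1, e2, Finset.mul_sum]
  refine (Finset.abs_sum_le_sum_abs _ _).trans (Finset.sum_le_sum fun i _ => ?_)
  rw [abs_mul, abs_of_nonneg (sq_nonneg (b.repr _ i))]
  exact mul_le_mul_of_nonneg_right (h2 i) (sq_nonneg _)

end Trace

/-! ### Concentration of the degrees -/

/-- By convexity the exponential lies below its chord over [0, 1]; this needs only the mean of the
weight. -/
theorem exp_mul_le_of_mem_Icc (t : ℝ) {x : ℝ} (h0 : 0 ≤ x) (h1 : x ≤ 1) :
    Real.exp (t * x) ≤ 1 + (Real.exp t - 1) * x := by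
  have := convexOn_exp.2 (Set.mem_univ 0) (Set.mem_univ t) (by linarith : 0 ≤ 1 - x) h0 (by ring)
  simp only [smul_eq_mul, mul_zero, zero_add, Real.exp_zero, mul_one] at this
  rw [mul_comm t x]
  linarith

variable {n : ℕ} {ω : Fin n → ℝ} {ν : Measure ℝ}

namespace IsModel

variable [IsProbabilityMeasure ν]

/-- The links at a vertex are independent, and each moment generating function is below that of a
Poisson variable of the same mean. -/
theorem mgf_deg_le (h : IsModel ω ν) (i : Fin n) (t : ℝ) :
    ProbabilityTheory.mgf (fun w => deg w i) (networkLaw ω ν) t ≤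
      Real.exp ((Real.exp t - 1) * (moment ν 1 * ω i)) := by
  have h1 : (fun w : Sym2 (Fin n) → ℝ => deg w i) = ∑ j, fun w => w s(i, j) := by
    ext w
    simp [deg, adj]
  rw [h1, (h.iIndepFun_row i).mgf_sum fun j => measurable_pi_apply _]
  have h2 : ∀ j, ProbabilityTheory.mgf (fun w => w s(i, j)) (networkLaw ω ν) t ≤
      Real.exp ((Real.exp t - 1) * (moment ν 1 * linkProb ω s(i, j))) := fun j => by
    have := h.isProbabilityMeasure_linkLaw s(i, j)
    have e1 : ProbabilityTheory.mgf (fun w => w s(i, j)) (networkLaw ω ν) t =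
        ∫ x, Real.exp (t * x) ∂linkLaw ω ν s(i, j) :=
      h.integral_eval s(i, j) (f := fun x => Real.exp (t * x)) (by fun_prop)
    have e2 := h.integrable_linkLaw_pow s(i, j) 1
    have e3 := h.integral_linkLaw_pow s(i, j) one_ne_zero
    simp only [pow_one] at e2 e3
    have e4 : ∫ x, Real.exp (t * x) ∂linkLaw ω ν s(i, j) ≤
        ∫ x, (1 + (Real.exp t - 1) * x) ∂linkLaw ω ν s(i, j) := by
      refine integral_mono_of_nonneg (Eventually.of_forall fun _ => (Real.exp_pos _).le)
        ((integrable_const _).add (e2.const_mul _)) ?_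
      filter_upwards [h.ae_linkLaw s(i, j)] with x hx
      exact exp_mul_le_of_mem_Icc t hx.1 hx.2
    rw [integral_add (integrable_const _) (e2.const_mul _), integral_const_mul, e3] at e4
    simp only [integral_const, probReal_univ, smul_eq_mul, one_mul] at e4
    rw [e1]
    refine e4.trans ?_
    rw [add_comm]
    refine (Real.add_one_le_exp _).trans (le_of_eq ?_)
    ring_nf
  refine (Finset.prod_le_prod (fun j _ => ProbabilityTheory.mgf_nonneg) fun j _ => h2 j).trans ?_
  rw [← Real.exp_sum, ← Finset.mul_sum, ← Finset.mul_sum, h.sum_linkProb]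

/-- Chernoff's bound for the weighted degrees. -/
theorem measureReal_relDeg_le (h : IsModel ω ν) (i : Fin n) {τ : ℝ} (hτ0 : 0 < τ) (hτ : τ ≤ 1) :
    (networkLaw ω ν).real {w | τ ≤ |relDeg ω ν w i - 1|} ≤
      2 * Real.exp (-(moment ν 1 * wmin ω * τ ^ 2 / 4)) := by
  have := h.isProbabilityMeasure_networkLaw
  set M := moment ν 1 * ω i with hM
  have hM0 : 0 < M := mul_pos (h.moment_pos 1) (h.pos i)
  have hMw : moment ν 1 * wmin ω ≤ M :=
    mul_le_mul_of_nonneg_left (wmin_le ω i) (h.moment_pos 1).le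
  have hint : ∀ t, Integrable (fun w => Real.exp (t * deg w i)) (networkLaw ω ν) := fun t =>
    h.integrable_networkLaw (Real.continuous_exp.comp (continuous_const.mul (continuous_deg i)))
  have hexp : Real.exp (-(M * τ ^ 2 / 4)) ≤ Real.exp (-(moment ν 1 * wmin ω * τ ^ 2 / 4)) := by
    gcongr
  have h1 : (networkLaw ω ν).real {w | (1 + τ) * M ≤ deg w i} ≤ Real.exp (-(M * τ ^ 2 / 4)) := by
    -- With t = τ/2 and exp t - 1 ≤ t + t², the exponent is at most M (t² - t τ) = -M τ²/4; the
    -- lower tail uses -t in the same way.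
    refine (ProbabilityTheory.measure_ge_le_exp_mul_mgf _ (by positivity : 0 ≤ τ / 2)
      (hint _)).trans ?_
    refine (mul_le_mul_of_nonneg_left (h.mgf_deg_le i _) (Real.exp_pos _).le).trans ?_
    rw [← Real.exp_add]
    refine Real.exp_le_exp.2 ?_
    have := (abs_le.1 (Real.abs_exp_sub_one_sub_id_le (x := τ / 2)
      (by rw [abs_of_pos] <;> linarith))).2
    nlinarith
  have h2 : (networkLaw ω ν).real {w | deg w i ≤ (1 - τ) * M} ≤ Real.exp (-(M * τ ^ 2 / 4)) := by
    refine (ProbabilityTheory.measure_le_le_exp_mul_mgf _ (by linarith : -(τ / 2) ≤ 0)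
      (hint _)).trans ?_
    refine (mul_le_mul_of_nonneg_left (h.mgf_deg_le i _) (Real.exp_pos _).le).trans ?_
    rw [← Real.exp_add]
    refine Real.exp_le_exp.2 ?_
    have := (abs_le.1 (Real.abs_exp_sub_one_sub_id_le (x := -(τ / 2))
      (by rw [abs_neg, abs_of_pos] <;> linarith))).2
    nlinarith
  have h3 : {w | τ ≤ |relDeg ω ν w i - 1|} ⊆
      {w | (1 + τ) * M ≤ deg w i} ∪ {w | deg w i ≤ (1 - τ) * M} := by
    intro w hw
    rcases le_abs.1 (show τ ≤ |relDeg ω ν w i - 1| from hw) with hw | hw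
    · left
      have : 1 + τ ≤ deg w i / M := by
        have := hw
        unfold relDeg at this
        linarith
      exact (le_div_iff₀ hM0).1 this
    · right
      have : deg w i / M ≤ 1 - τ := by
        have := hw
        unfold relDeg at this
        linarith
      exact (div_le_iff₀ hM0).1 this
  have h4 := (measureReal_mono h3 (measure_ne_top (networkLaw ω ν) _)).trans
    (measureReal_union_le _ _)
  linarith

/-! ### The norm of the centred matrix -/

/-- Supplies the hypothesis c ≤ K² of the moment method for c = 1/n and K = √κ. It rests on ω_min² ≤
ω_max² ≤ 1/ρ = n ω_avg and E[W²] ≤ 1. -/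
theorem inv_le_sparsity (h : IsModel ω ν) (i : Fin n) : 1 / (n : ℝ) ≤ sparsity ω ν := by
  have hn : (0 : ℝ) < n := by exact_mod_cast i.pos
  have h1 := h.avg_pos i
  have h2 := h.moment_pos 2
  have h3 := h.wmin_pos i
  have h4 : moment ν 2 ≤ 1 := h.moment_two_le.trans h.moment_one_le_one
  have h5 : wmin ω ^ 2 ≤ n * avg ω := by
    have e1 : wmin ω ^ 2 ≤ wmax ω ^ 2 :=
      pow_le_pow_left₀ h3.le ((wmin_le ω i).trans (le_wmax ω i)) 2
    refine (e1.trans h.wmax_sq_le).trans (le_of_eq ?_)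
    rw [rho, avg]
    field_simp
  rw [sparsity, div_le_div_iff₀ hn (by positivity), one_mul]
  calc moment ν 2 * wmin ω ^ 2 ≤ 1 * (n * avg ω) := by gcongr
    _ = _ := by ring

/-- The factor 2 raises the variance bound from 1/(4n) to 1/n, the normalization n c ≤ 1 of the walk
sums, and the entry bound to √κ. -/
theorem integral_trace_pow_le (h : IsModel ω ν) (hn : 0 < n) (k : ℕ) :
    ∫ w, (adj (fun e => 2 * centredWeight ω ν e (w e)) ^ k).trace ∂networkLaw ω ν ≤
      n * (2 + (k + 1) * √(sparsity ω ν) * (k + 2)) ^ k := by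
  have := h.isProbabilityMeasure_linkLaw
  have hm : ∀ e, Measurable fun x => 2 * centredWeight ω ν e x := fun e =>
    (measurable_centredWeight e).const_mul 2
  have : ∀ e, IsProbabilityMeasure ((linkLaw ω ν e).map fun x => 2 * centredWeight ω ν e x) :=
    fun e => Measure.isProbabilityMeasure_map (hm e).aemeasurable
  have hn' : (0 : ℝ) < n := by exact_mod_cast hn
  have hκ := h.sparsity_pos ⟨0, hn⟩
  rw [h.integral_networkLaw_comp (f := fun e x => 2 * centredWeight ω ν e x) hm
    (F := fun x => (adj x ^ k).trace) (continuous_adj.pow k).matrix_trace]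
  refine integral_trace_pow_adj_le _ (c := 1 / n) (by positivity) (Real.sqrt_nonneg _) ?_ ?_ ?_
    ?_ ?_ k
  · rw [Real.sq_sqrt hκ.le]
    exact h.inv_le_sparsity ⟨0, hn⟩
  · rw [mul_one_div_cancel hn'.ne']
  · intro e
    rw [integral_map (hm e).aemeasurable (by fun_prop), integral_const_mul,
      h.integral_centredWeight e, mul_zero]
  · intro e
    rw [integral_map (hm e).aemeasurable (by fun_prop)]
    simp only [mul_pow]
    rw [integral_const_mul, h.integral_centredWeight_sq]
    have h3 : 0 ≤ linkProb ω e * (moment ν 1 ^ 2 / moment ν 2) :=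
      mul_nonneg (h.linkProb_pos _).le (div_nonneg (sq_nonneg _) (h.moment_pos 2).le)
    have h4 : (2 : ℝ) ^ 2 * (1 / (4 * n) * (1 - linkProb ω e * (moment ν 1 ^ 2 / moment ν 2))) =
        1 / (n : ℝ) * (1 - linkProb ω e * (moment ν 1 ^ 2 / moment ν 2)) := by
      rw [← mul_assoc]
      congr 1
      field_simp
      norm_num
    rw [h4]
    exact mul_le_of_le_one_right (by positivity) (by linarith)
  · intro e
    rw [ae_map_iff (hm e).aemeasurable (measurableSet_le (by fun_prop) measurable_const)]
    filter_upwards [h.ae_abs_centredWeight_le e] with x hx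
    rw [abs_mul, abs_two]
    linarith

theorem measureReal_trace_pow_le (h : IsModel ω ν) (hn : 0 < n) {k : ℕ} (hk : Even k) {s : ℝ}
    (hs : 0 < s) :
    (networkLaw ω ν).real
        {w | s ^ k ≤ (adj (fun e => 2 * centredWeight ω ν e (w e)) ^ k).trace} ≤
      n * ((2 + (k + 1) * √(sparsity ω ν) * (k + 2)) / s) ^ k := by
  have hc : Continuous fun w : Sym2 (Fin n) → ℝ =>
      (adj (fun e => 2 * centredWeight ω ν e (w e)) ^ k).trace := by
    have : Continuous fun (w : Sym2 (Fin n) → ℝ) (e : Sym2 (Fin n)) =>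
        2 * centredWeight ω ν e (w e) := continuous_pi fun e =>
      continuous_const.mul ((continuous_centredWeight e).comp (continuous_apply e))
    exact ((continuous_adj.comp this).pow k).matrix_trace
  have h1 := mul_meas_ge_le_integral_of_nonneg (μ := networkLaw ω ν)
    (Eventually.of_forall fun w => by
      rw [trace_pow_eq_sum_eigenvalues_pow (adj_isHermitian _)]
      exact Finset.sum_nonneg fun i _ => hk.pow_nonneg _)
    (h.integrable_networkLaw hc) (s ^ k)
  rw [div_pow, ← mul_div_assoc, le_div_iff₀ (by positivity), mul_comm]
  exact h1.trans (h.integral_trace_pow_le hn k)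

/-! ### The upper bound for the spectral radius -/

/-- The quadratic form of N is that of I plus r̃ times (⟨Tx, X Tx⟩ - c ⟨u, x⟩²). The last term
vanishes on the hyperplane orthogonal to u, and elsewhere only lowers the form, so neither bound on
the nontrivial eigenvalues sees it. -/
theorem specRadius_le (h : IsModel ω ν) (hn : 0 < n) {w : Sym2 (Fin n) → ℝ} {τ s : ℝ}
    (hτ : τ ≤ 1 / 2) (hw : ∀ i, |relDeg ω ν w i - 1| ≤ τ) (hs : 0 ≤ s)
    (hX : ∀ x : Fin n → ℝ,
      |x ⬝ᵥ (adj fun e => centredWeight ω ν e (w e)).mulVec x| ≤ s * (x ⬝ᵥ x)) :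
    specRadius w ≤ limitRadius ω ν * ((1 + τ) ^ 2 * s) := by
  have hr := h.limitRadius_pos ⟨0, hn⟩
  set X := adj fun e => centredWeight ω ν e (w e) with hXdef
  set T : Fin n → ℝ := fun i => (√(relDeg ω ν w i))⁻¹ with hT
  set u : Fin n → ℝ := fun i => ω i * (√(deg w i))⁻¹ with hu
  set c := moment ν 1 * rho ω / limitRadius ω ν with hc
  have hc0 : 0 ≤ c := div_nonneg (mul_nonneg (h.moment_pos 1).le (h.rho_pos ⟨0, hn⟩).le) hr.le
  have hτ0 : 0 ≤ τ := (abs_nonneg _).trans (hw ⟨0, hn⟩)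
  have key : ∀ x : Fin n → ℝ, x ⬝ᵥ (normLap w).mulVec x = x ⬝ᵥ x + limitRadius ω ν *
      ((fun i => T i * x i) ⬝ᵥ X.mulVec (fun i => T i * x i) - c * (u ⬝ᵥ x) ^ 2) := by
    intro x
    have e1 : normLap w = 1 + limitRadius ω ν • scaledLap w (limitRadius ω ν) := by
      rw [scaledLap, smul_smul, mul_inv_cancel₀ hr.ne', one_smul, add_sub_cancel]
    rw [e1, Matrix.add_mulVec, Matrix.one_mulVec, dotProduct_add, Matrix.smul_mulVec,
      dotProduct_smul, smul_eq_mul]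
    congr 2
    have e2 : (u ⬝ᵥ x) ^ 2 = ∑ i, ∑ j, u i * x i * (u j * x j) := by
      rw [sq, dotProduct, Finset.sum_mul_sum]
    rw [e2]
    simp only [dotProduct, Matrix.mulVec, Finset.mul_sum, ← Finset.sum_sub_distrib]
    refine Finset.sum_congr rfl fun i _ => Finset.sum_congr rfl fun j _ => ?_
    rw [h.scaledLap_apply w i j]
    ring
  have bound : ∀ x : Fin n → ℝ, |(fun i => T i * x i) ⬝ᵥ X.mulVec (fun i => T i * x i)| ≤
      (1 + τ) ^ 2 * s * (x ⬝ᵥ x) := by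
    intro x
    refine (hX _).trans ?_
    rw [mul_comm ((1 + τ) ^ 2), mul_assoc]
    refine mul_le_mul_of_nonneg_left ?_ hs
    simp only [dotProduct, Finset.mul_sum]
    refine Finset.sum_le_sum fun i _ => ?_
    have e1 := abs_le.1 (abs_inv_sqrt_sub_one_le hτ (hw i))
    have e2 : 0 ≤ T i := inv_nonneg.2 (Real.sqrt_nonneg _)
    have e3 : T i ^ 2 ≤ (1 + τ) ^ 2 := pow_le_pow_left₀ e2 (by linarith [e1.2]) 2
    calc T i * x i * (T i * x i) = T i ^ 2 * (x i * x i) := by ring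
      _ ≤ _ := mul_le_mul_of_nonneg_right e3 (mul_self_nonneg _)
  refine specRadius_le_of_forall (by positivity) u (fun x hx => ?_) fun x => ?_
  · rw [key, hx]
    have := mul_le_mul_of_nonneg_left (abs_le.1 (bound x)).1 hr.le
    linarith
  · rw [key]
    have e1 := mul_le_mul_of_nonneg_left (abs_le.1 (bound x)).2 hr.le
    have e2 : 0 ≤ limitRadius ω ν * (c * (u ⬝ᵥ x) ^ 2) := by positivity
    linarith

/-- A union bound over the n degrees and Markov's inequality for the trace of an even power. -/
theorem measureReal_specRadius_le (h : IsModel ω ν) (hn : 0 < n) {k : ℕ} (hk : Even k)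
    (hk0 : k ≠ 0) {τ s : ℝ} (hτ0 : 0 < τ) (hτ : τ ≤ 1 / 2) (hs : 0 < s) :
    (networkLaw ω ν).real {w | limitRadius ω ν * ((1 + τ) ^ 2 * (s / 2)) < specRadius w} ≤
      2 * (n * Real.exp (-(moment ν 1 * wmin ω * τ ^ 2 / 4))) +
        n * ((2 + (k + 1) * √(sparsity ω ν) * (k + 2)) / s) ^ k := by
  have := h.isProbabilityMeasure_networkLaw
  have hsub : {w | limitRadius ω ν * ((1 + τ) ^ 2 * (s / 2)) < specRadius w} ⊆
      (⋃ i, {w | τ ≤ |relDeg ω ν w i - 1|}) ∪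
        {w | s ^ k ≤ (adj (fun e => 2 * centredWeight ω ν e (w e)) ^ k).trace} := by
    intro w hw
    by_contra hcon
    simp only [Set.mem_union, Set.mem_iUnion, Set.mem_ofPred_eq, not_or, not_exists, not_le] at hcon
    refine absurd (h.specRadius_le hn hτ (fun i => (hcon.1 i).le) (by positivity : 0 ≤ s / 2)
      fun x => ?_) (not_le.2 hw)
    have e1 := abs_dotProduct_mulVec_le_of_trace_pow_le (adj_isHermitian _) hk hk0 hs.le
      hcon.2.le x
    have e2 : adj (fun e => 2 * centredWeight ω ν e (w e)) =
        (2 : ℝ) • adj fun e => centredWeight ω ν e (w e) := by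
      ext i j
      simp [adj]
    rw [e2, Matrix.smul_mulVec, dotProduct_smul, smul_eq_mul, abs_mul, abs_two] at e1
    linarith
  refine (measureReal_mono hsub (measure_ne_top _ _)).trans ((measureReal_union_le _ _).trans
    (add_le_add ?_ (h.measureReal_trace_pow_le hn hk hs)))
  refine (measureReal_iUnion_fintype_le _).trans ?_
  refine (Finset.sum_le_sum fun i _ => h.measureReal_relDeg_le i hτ0 (by linarith)).trans
    (le_of_eq ?_)
  simp
  ring

end IsModel

end WeightedChungLu

namespace WeightedChungLu

/-! ### The expected eigenvalue distribution -/

theorem sum_filter_pos_add {n : ℕ} (hn : 0 < n) (f : Fin n → ℝ) :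
    ∑ l : Fin n with 0 < l.val, f l + f ⟨0, hn⟩ = ∑ l, f l := by
  have h : Finset.univ.filter (fun l : Fin n => ¬ 0 < l.val) = {⟨0, hn⟩} := by
    ext l
    simp [Fin.ext_iff]
  rw [← Finset.sum_filter_add_sum_filter_not Finset.univ (fun l : Fin n => 0 < l.val) f, h,
    Finset.sum_singleton]

theorem isProbabilityMeasure_empiricalLaw {n : ℕ} (hn : 2 ≤ n) (w : Sym2 (Fin n) → ℝ) :
    IsProbabilityMeasure (empiricalLaw w) := by
  constructor
  have h := sum_filter_pos_add (by omega : 0 < n) (fun _ => 1)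
  simp only [Finset.sum_const, nsmul_eq_mul, mul_one, Finset.card_univ, Fintype.card_fin] at h
  have hc : (Finset.univ.filter fun l : Fin n => 0 < l.val).card = n - 1 := by
    have : (Finset.univ.filter fun l : Fin n => 0 < l.val).card + 1 = n := by exact_mod_cast h
    omega
  simp only [empiricalLaw, Measure.smul_apply, Measure.coe_finsetSum, Finset.sum_apply,
    measure_univ, Finset.sum_const, hc, nsmul_eq_mul, mul_one, smul_eq_mul]
  refine ENNReal.inv_mul_cancel ?_ (ENNReal.natCast_ne_top _)
  have : n - 1 ≠ 0 := by omega
  exact_mod_cast this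

theorem integral_empiricalLaw {n : ℕ} (w : Sym2 (Fin n) → ℝ) (f : ℝ → ℝ) :
    ∫ x, f x ∂empiricalLaw w =
      ((n - 1 : ℕ) : ℝ)⁻¹ * ∑ l : Fin n with 0 < l.val, f (eig w l) := by
  rw [empiricalLaw, integral_smul_measure, integral_finsetSum_measure]
  · simp only [integral_dirac, smul_eq_mul, ENNReal.toReal_inv, ENNReal.toReal_natCast]
  · exact fun l _ => integrable_dirac (by simp)

variable {n : ℕ} {ω : Fin n → ℝ} {ν : Measure ℝ}

/-- The averaged law is read as a composition of kernels, for which Fubini holds; n ≥ 2 makes the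
empirical law a probability. -/
theorem IsModel.integral_eigenvalueLaw [IsProbabilityMeasure ν] (h : IsModel ω ν)
    (hn : 2 ≤ n) {f : ℝ → ℝ}
    (hf : Continuous f) {C : ℝ} (hC : ∀ x, |f x| ≤ C) :
    ∫ x, f x ∂eigenvalueLaw ω ν =
      ∫ w, ((n - 1 : ℕ) : ℝ)⁻¹ * ∑ l : Fin n with 0 < l.val, f (eig w l) ∂networkLaw ω ν := by
  have := h.isProbabilityMeasure_networkLaw
  let η : ProbabilityTheory.Kernel (Sym2 (Fin n) → ℝ) ℝ := ⟨empiricalLaw, measurable_empiricalLaw⟩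
  have hη : ProbabilityTheory.IsMarkovKernel η := ⟨isProbabilityMeasure_empiricalLaw hn⟩
  let κ : ProbabilityTheory.Kernel Unit (Sym2 (Fin n) → ℝ) :=
    ProbabilityTheory.Kernel.const Unit (networkLaw ω ν)
  have e1 : eigenvalueLaw ω ν = (ProbabilityTheory.Kernel.comp η κ) () := by
    rw [ProbabilityTheory.Kernel.comp_apply]
    rfl
  rw [e1, ProbabilityTheory.Kernel.integral_comp]
  · exact integral_congr_ae (Eventually.of_forall fun w => integral_empiricalLaw w f)
  · exact Integrable.of_bound hf.aestronglyMeasurable C (Eventually.of_forall hC)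

/-! ### The semicircle law -/

theorem semicircleDensity_zero_one_of_one_le_abs {x : ℝ} (hx : 1 ≤ |x|) :
    semicircleDensity 0 1 x = 0 := by
  rw [semicircleDensity_zero_one, Real.sqrt_eq_zero_of_nonpos, mul_zero]
  have := one_le_sq_iff_one_le_abs x |>.2 hx
  linarith

theorem semicircleDensity_zero_one_nonneg (x : ℝ) : 0 ≤ semicircleDensity 0 1 x := by
  rw [semicircleDensity_zero_one]
  positivity

theorem integral_semicircleDensity_zero_one : ∫ x, semicircleDensity 0 1 x = 1 := by
  have h1 : ∫ x in (-1 : ℝ)..1, semicircleDensity 0 1 x = 1 := by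
    simp only [semicircleDensity_zero_one]
    rw [intervalIntegral.integral_const_mul, integral_sqrt_one_sub_sq]
    field_simp
  rw [intervalIntegral.integral_of_le (by norm_num),
    setIntegral_eq_integral_of_forall_compl_eq_zero] at h1
  · exact h1
  intro x hx
  refine semicircleDensity_zero_one_of_one_le_abs ?_
  by_contra hcon
  have := abs_lt.1 (not_le.1 hcon)
  exact hx ⟨this.1, this.2.le⟩

theorem integral_semicircleLaw_zero_one (g : ℝ → ℝ) :
    ∫ x, g x ∂semicircleLaw 0 1 = ∫ x, g x * semicircleDensity 0 1 x := by
  have hm : Measurable fun x => ENNReal.ofReal (semicircleDensity 0 1 x) :=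
    continuous_semicircleDensity_zero_one.measurable.ennreal_ofReal
  rw [semicircleLaw, integral_withDensity_eq_integral_toReal_smul hm
    (Eventually.of_forall fun _ => ENNReal.ofReal_lt_top)]
  refine integral_congr_ae (Eventually.of_forall fun x => ?_)
  simp only [smul_eq_mul]
  rw [ENNReal.toReal_ofReal (semicircleDensity_zero_one_nonneg x), mul_comm]

/-! ### Weak convergence -/

/-- The mean of `g` over the rescaled eigenvalues. -/
noncomputable def linearStatistic (ω : Fin n → ℝ) (ν : Measure ℝ) (g : ℝ → ℝ)
    (w : Sym2 (Fin n) → ℝ) : ℝ :=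
  (n : ℝ)⁻¹ * ∑ i, g ((eig w i - 1) / limitRadius ω ν)

theorem IsModel.integrable_comp_eig [IsProbabilityMeasure ν] (h : IsModel ω ν)
    {g : ℝ → ℝ} (hg : Continuous g) {C : ℝ}
    (hC : ∀ x, |g x| ≤ C) (l : Fin n) :
    Integrable (fun w => g ((eig w l - 1) / limitRadius ω ν)) (networkLaw ω ν) := by
  have := h.isProbabilityMeasure_networkLaw
  exact Integrable.of_bound
    (hg.measurable.comp (((measurable_eig l).sub_const _).div_const _)).aestronglyMeasurable C
    (Eventually.of_forall fun _ => hC _)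

theorem IsModel.integrable_linearStatistic [IsProbabilityMeasure ν] (h : IsModel ω ν)
    {g : ℝ → ℝ} (hg : Continuous g)
    {C : ℝ} (hC : ∀ x, |g x| ≤ C) : Integrable (linearStatistic ω ν g) (networkLaw ω ν) :=
  (integrable_finsetSum _ fun l _ => h.integrable_comp_eig hg hC l).const_mul _

theorem abs_linearStatistic_le (hn : 0 < n) {g : ℝ → ℝ} {C : ℝ} (hC : ∀ x, |g x| ≤ C)
    (w : Sym2 (Fin n) → ℝ) : |linearStatistic ω ν g w| ≤ C := by
  have hn' : (0 : ℝ) < n := by exact_mod_cast hn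
  rw [linearStatistic, abs_mul, abs_of_pos (inv_pos.2 hn'), inv_mul_le_iff₀ hn']
  refine (Finset.abs_sum_le_sum_abs _ _).trans ((Finset.sum_le_sum fun i _ => hC _).trans ?_)
  simp

/-- A continuous cutoff that is `1` on `[-1, 1]` and `0` outside `[-2, 2]`. -/
noncomputable def cutoff (x : ℝ) : ℝ := max 0 (min 1 (2 - |x|))

theorem continuous_cutoff : Continuous cutoff := by
  unfold cutoff
  fun_prop

theorem cutoff_nonneg (x : ℝ) : 0 ≤ cutoff x := le_max_left _ _

theorem cutoff_le_one (x : ℝ) : cutoff x ≤ 1 := max_le zero_le_one (min_le_left _ _)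

theorem cutoff_of_abs_le {x : ℝ} (hx : |x| ≤ 1) : cutoff x = 1 := by
  rw [cutoff, min_eq_left (by linarith), max_eq_right zero_le_one]

theorem hasCompactSupport_cutoff : HasCompactSupport cutoff := by
  refine HasCompactSupport.intro (isCompact_Icc (a := -2) (b := 2)) fun x hx => ?_
  have : 2 < |x| := by
    by_contra hcon
    exact hx (abs_le.1 (not_lt.1 hcon))
  rw [cutoff, max_eq_left]
  exact (min_le_right _ _).trans (by linarith)

theorem cutoff_mul_semicircleDensity (x : ℝ) :
    cutoff x * semicircleDensity 0 1 x = semicircleDensity 0 1 x := by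
  rcases le_or_gt 1 |x| with hx | hx
  · simp [semicircleDensity_zero_one_of_one_le_abs hx]
  · rw [cutoff_of_abs_le hx.le, one_mul]

/-- Tightness: the fraction of eigenvalues not seen by `cutoff` has mean tending to 1 - 1 = 0,
because the semicircle law lives where the cutoff is 1 and has total mass 1. Outside, g is bounded
by C. -/
theorem tendsto_integral_abs_linearStatistic_of_bounded
    {ω : (n : ℕ) → Fin n → ℝ} {ν : ℕ → Measure ℝ} [∀ n, IsProbabilityMeasure (ν n)]
    (h : ∀ n, IsModel (ω n) (ν n))
    (hκ : Tendsto (fun n => sparsity (ω n) (ν n)) atTop (𝓝 0))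
    (hs : Tendsto (fun n : ℕ => avg (ω n) / n) atTop (𝓝 0))
    {g : ℝ → ℝ} (hg : Continuous g) {C : ℝ} (hC : ∀ x, |g x| ≤ C) :
    Tendsto (fun n : ℕ => ∫ w, |linearStatistic (ω n) (ν n) g w -
      ∫ E, g E * semicircleDensity 0 1 E| ∂networkLaw (ω n) (ν n)) atTop (𝓝 0) := by
  have hP := fun n => (h n).isProbabilityMeasure_networkLaw
  have hC0 : 0 ≤ C := (abs_nonneg _).trans (hC 0)
  have hcg : Continuous fun x => g x * cutoff x := hg.mul continuous_cutoff
  have hχC : ∀ x, |cutoff x| ≤ 1 := fun x => by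
    rw [abs_of_nonneg (cutoff_nonneg x)]
    exact cutoff_le_one x
  have hgC : ∀ x, |g x * cutoff x| ≤ C := fun x => by
    rw [abs_mul]
    exact (mul_le_mul (hC x) (hχC x) (abs_nonneg _) hC0).trans (mul_one C).le
  have l1 := tendsto_integral_abs_linearStatistic_eig h hκ hs hcg hasCompactSupport_cutoff.mul_left
  have l2 := tendsto_integral_abs_linearStatistic_eig h hκ hs continuous_cutoff
    hasCompactSupport_cutoff
  have i1 : ∫ E, g E * cutoff E * semicircleDensity 0 1 E = ∫ E, g E * semicircleDensity 0 1 E := by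
    simp only [mul_assoc, cutoff_mul_semicircleDensity]
  have i2 : ∫ E, cutoff E * semicircleDensity 0 1 E = 1 := by
    simp only [cutoff_mul_semicircleDensity, integral_semicircleDensity_zero_one]
  rw [i1] at l1
  rw [i2] at l2
  have l3 := l1.add (l2.const_mul C)
  simp only [mul_zero, add_zero] at l3
  refine squeeze_zero' (Eventually.of_forall fun n => integral_nonneg fun w => abs_nonneg _) ?_ l3
  filter_upwards [eventually_gt_atTop 0] with n hn
  set I := ∫ E, g E * semicircleDensity 0 1 E
  have hn' : (0 : ℝ) < n := by exact_mod_cast hn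
  have j1 : Integrable (fun w => |linearStatistic (ω n) (ν n) (fun x => g x * cutoff x) w - I|)
      (networkLaw (ω n) (ν n)) :=
    (((h n).integrable_linearStatistic hcg hgC).sub (integrable_const I)).abs
  have j2 : Integrable (fun w => |linearStatistic (ω n) (ν n) cutoff w - 1|)
      (networkLaw (ω n) (ν n)) :=
    (((h n).integrable_linearStatistic continuous_cutoff hχC).sub (integrable_const 1)).abs
  change _ ≤ ∫ w, |linearStatistic (ω n) (ν n) (fun x => g x * cutoff x) w - I|
    ∂networkLaw (ω n) (ν n) + C * ∫ w, |linearStatistic (ω n) (ν n) cutoff w - 1|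
    ∂networkLaw (ω n) (ν n)
  rw [← integral_const_mul, ← integral_add j1 (j2.const_mul C)]
  refine integral_mono_of_nonneg (Eventually.of_forall fun w => abs_nonneg _)
    (j1.add (j2.const_mul C)) (Eventually.of_forall fun w => ?_)
  have key : |linearStatistic (ω n) (ν n) g w -
      linearStatistic (ω n) (ν n) (fun x => g x * cutoff x) w| ≤
      C * (1 - linearStatistic (ω n) (ν n) cutoff w) := by
    have e1 : 1 - linearStatistic (ω n) (ν n) cutoff w =
        (n : ℝ)⁻¹ * ∑ i, (1 - cutoff ((eig w i - 1) / limitRadius (ω n) (ν n))) := by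
      rw [Finset.sum_sub_distrib, mul_sub, linearStatistic]
      simp [hn'.ne']
    rw [e1, linearStatistic, linearStatistic, ← mul_sub, ← mul_assoc,
      mul_comm C, mul_assoc, ← Finset.sum_sub_distrib, abs_mul, abs_of_pos (inv_pos.2 hn')]
    refine mul_le_mul_of_nonneg_left ?_ (inv_pos.2 hn').le
    rw [Finset.mul_sum]
    refine (Finset.abs_sum_le_sum_abs _ _).trans (Finset.sum_le_sum fun i _ => ?_)
    set y := (eig w i - 1) / limitRadius (ω n) (ν n)
    have e2 : g y - g y * cutoff y = g y * (1 - cutoff y) := by ring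
    have e3 : 0 ≤ 1 - cutoff y := sub_nonneg.2 (cutoff_le_one y)
    rw [e2, abs_mul, abs_of_nonneg e3]
    exact mul_le_mul_of_nonneg_right (hC y) e3
  have e4 := abs_sub_comm (linearStatistic (ω n) (ν n) cutoff w) 1
  have e5 := mul_le_mul_of_nonneg_left
    (le_abs_self (1 - linearStatistic (ω n) (ν n) cutoff w)) hC0
  have e6 := abs_sub_le (linearStatistic (ω n) (ν n) g w)
    (linearStatistic (ω n) (ν n) (fun x => g x * cutoff x) w) I
  change |linearStatistic (ω n) (ν n) g w - I| ≤
    |linearStatistic (ω n) (ν n) (fun x => g x * cutoff x) w - I| +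
      C * |linearStatistic (ω n) (ν n) cutoff w - 1|
  rw [e4]
  linarith

/-- The semicircle law for the expected eigenvalue distribution. -/
theorem tendsto_integral_map_eigenvalueLaw
    {ω : (n : ℕ) → Fin n → ℝ} {ν : ℕ → Measure ℝ} [∀ n, IsProbabilityMeasure (ν n)]
    (h : ∀ n, IsModel (ω n) (ν n))
    (hκ : Tendsto (fun n => sparsity (ω n) (ν n)) atTop (𝓝 0))
    (hs : Tendsto (fun n : ℕ => avg (ω n) / n) atTop (𝓝 0))
    (g : BoundedContinuousFunction ℝ ℝ) :
    Tendsto (fun n => ∫ x, g x ∂((eigenvalueLaw (ω n) (ν n)).map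
      fun x => (x - 1) / limitRadius (ω n) (ν n))) atTop (𝓝 (∫ x, g x ∂semicircleLaw 0 1)) := by
  have hP := fun n => (h n).isProbabilityMeasure_networkLaw
  have hC : ∀ x, |g x| ≤ ‖g‖ := fun x => g.norm_coe_le_norm x
  rw [integral_semicircleLaw_zero_one]
  set I := ∫ x, g x * semicircleDensity 0 1 x with hI
  have l1 := tendsto_integral_abs_linearStatistic_of_bounded h hκ hs g.continuous hC
  have l2 : Tendsto (fun n : ℕ => 2 * ‖g‖ * ((n - 1 : ℕ) : ℝ)⁻¹) atTop (𝓝 (2 * ‖g‖ * 0)) :=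
    (tendsto_inv_atTop_zero.comp (tendsto_natCast_atTop_atTop.comp
      (tendsto_sub_atTop_nat 1))).const_mul _
  have l3 := l1.add l2
  simp only [mul_zero, add_zero] at l3
  rw [tendsto_iff_dist_tendsto_zero]
  refine squeeze_zero' (Eventually.of_forall fun n => dist_nonneg) ?_ l3
  filter_upwards [eventually_ge_atTop 2] with n hn
  have hn0 : 0 < n := by omega
  have hn1 : ((n - 1 : ℕ) : ℝ) = n - 1 := by
    rw [Nat.cast_sub (by omega), Nat.cast_one]
  have hn2 : (0 : ℝ) < n - 1 := by
    have : (2 : ℝ) ≤ n := by exact_mod_cast hn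
    linarith
  rw [integral_map (by fun_prop) g.continuous.aestronglyMeasurable,
    (h n).integral_eigenvalueLaw hn (f := fun x => g ((x - 1) / limitRadius (ω n) (ν n)))
      (g.continuous.comp (by fun_prop)) (fun x => hC _), hn1, Real.dist_eq]
  have j1 : Integrable (fun w => ((n : ℝ) - 1)⁻¹ * ∑ l : Fin n with 0 < l.val,
      g ((eig w l - 1) / limitRadius (ω n) (ν n))) (networkLaw (ω n) (ν n)) :=
    (integrable_finsetSum _ fun l _ => (h n).integrable_comp_eig g.continuous hC l).const_mul _
  have j2 : Integrable (fun w => |linearStatistic (ω n) (ν n) g w - I|)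
      (networkLaw (ω n) (ν n)) :=
    (((h n).integrable_linearStatistic g.continuous hC).sub (integrable_const I)).abs
  have e1 : I = ∫ _w, I ∂networkLaw (ω n) (ν n) := by simp
  have e2 : 2 * ‖g‖ * ((n : ℝ) - 1)⁻¹ =
      ∫ _w, 2 * ‖g‖ * ((n : ℝ) - 1)⁻¹ ∂networkLaw (ω n) (ν n) := by simp
  conv_lhs => rw [e1]
  rw [← integral_sub j1 (integrable_const I), e2, ← integral_add j2 (integrable_const _)]
  refine (abs_integral_le_integral_abs).trans ?_
  refine integral_mono_of_nonneg (Eventually.of_forall fun w => abs_nonneg _)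
    (j2.add (integrable_const _)) (Eventually.of_forall fun w => ?_)
  set S := linearStatistic (ω n) (ν n) g w with hS
  have e3 := sum_filter_pos_add hn0 (fun l => g ((eig w l - 1) / limitRadius (ω n) (ν n)))
  have e4 : ∑ l, g ((eig w l - 1) / limitRadius (ω n) (ν n)) = n * S := by
    rw [hS, linearStatistic, mul_inv_cancel_left₀ (by positivity)]
  set g0 := g ((eig w ⟨0, hn0⟩ - 1) / limitRadius (ω n) (ν n)) with hg0
  have e5 : ∑ l : Fin n with 0 < l.val, g ((eig w l - 1) / limitRadius (ω n) (ν n)) =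
      n * S - g0 := by linarith
  change |((n : ℝ) - 1)⁻¹ * ∑ l : Fin n with 0 < l.val,
    g ((eig w l - 1) / limitRadius (ω n) (ν n)) - I| ≤ |S - I| + 2 * ‖g‖ * ((n : ℝ) - 1)⁻¹
  -- Omitting one eigenvalue and renormalizing changes the mean by (S - g0)/(n - 1), which is at
  -- most 2‖g‖/(n - 1).
  have e6 : ((n : ℝ) - 1)⁻¹ * (n * S - g0) - I = (S - I) + (S - g0) * ((n : ℝ) - 1)⁻¹ := by
    field_simp
    ring
  rw [e5, e6]
  refine (abs_add_le _ _).trans (add_le_add le_rfl ?_)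
  rw [abs_mul, abs_of_pos (inv_pos.2 hn2)]
  refine mul_le_mul_of_nonneg_right ?_ (inv_pos.2 hn2).le
  have e7 := abs_linearStatistic_le (ω := ω n) (ν := ν n) hn0 hC w
  have e8 := hC ((eig w ⟨0, hn0⟩ - 1) / limitRadius (ω n) (ν n))
  have e9 := abs_sub S g0
  linarith

/-! ### The spectral radius -/

/-- If the radius were too small, a bump inside the edge would miss all nontrivial eigenvalues,
whereas its linear statistic converges to a positive number. -/
theorem tendsto_measureReal_specRadius_le
    {ω : (n : ℕ) → Fin n → ℝ} {ν : ℕ → Measure ℝ} [∀ n, IsProbabilityMeasure (ν n)]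
    (h : ∀ n, IsModel (ω n) (ν n))
    (hκ : Tendsto (fun n => sparsity (ω n) (ν n)) atTop (𝓝 0))
    (hs : Tendsto (fun n : ℕ => avg (ω n) / n) atTop (𝓝 0)) {ε : ℝ} (hε : 0 < ε) :
    Tendsto (fun n => (networkLaw (ω n) (ν n)).real
      {w | specRadius w / limitRadius (ω n) (ν n) ≤ 1 - ε}) atTop (𝓝 0) := by
  have hP := fun n => (h n).isProbabilityMeasure_networkLaw
  set e := min ε (1 / 2) with he
  have he0 : 0 < e := lt_min hε (by norm_num)
  have he1 : e ≤ 1 / 2 := min_le_right _ _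
  have heε : e ≤ ε := min_le_left _ _
  -- A tent supported on [1 - e, 1], where the semicircle density is positive in the interior.
  set g : ℝ → ℝ := fun x => max 0 (e / 2 - |x - (1 - e / 2)|) with hg
  have hgc : Continuous g := by
    rw [hg]
    fun_prop
  have hg0 : ∀ x, 0 ≤ g x := fun x => le_max_left _ _
  have hg1 : ∀ x, |g x| ≤ 1 := fun x => by
    rw [abs_of_nonneg (hg0 x)]
    exact max_le zero_le_one (by linarith [abs_nonneg (x - (1 - e / 2))])
  have hgz : ∀ x, |x| ≤ 1 - e → g x = 0 := fun x hx => by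
    refine max_eq_left ?_
    have := (abs_le.1 hx).2
    rw [abs_of_nonpos (by linarith)]
    linarith
  have hgs : HasCompactSupport g := by
    refine HasCompactSupport.intro (isCompact_Icc (a := 1 - e) (b := 1)) fun x hx => ?_
    refine max_eq_left ?_
    by_contra hcon
    have h1 := abs_lt.1 (by linarith : |x - (1 - e / 2)| < e / 2)
    exact hx ⟨by linarith, by linarith⟩
  set γ := ∫ E, g E * semicircleDensity 0 1 E with hγ
  have hγ0 : 0 < γ := by
    refine Continuous.integral_pos_of_hasCompactSupport_nonneg_nonzero (x := 1 - e / 2)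
      (hgc.mul continuous_semicircleDensity_zero_one) hgs.mul_right
      (fun x => mul_nonneg (hg0 x) (semicircleDensity_zero_one_nonneg x)) ?_
    refine mul_ne_zero ?_ ?_
    · simp only [hg, sub_self, abs_zero, sub_zero]
      rw [max_eq_right (by linarith)]
      linarith
    · rw [semicircleDensity_zero_one]
      have : 0 < √(1 - (1 - e / 2) ^ 2) := Real.sqrt_pos.2 (by nlinarith)
      positivity
  have l1 := (tendsto_integral_abs_linearStatistic_eig h hκ hs hgc hgs).const_mul (γ / 2)⁻¹
  rw [mul_zero] at l1
  refine squeeze_zero' (Eventually.of_forall fun n => measureReal_nonneg) ?_ l1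
  have l2 := (tendsto_inv_atTop_nhds_zero_nat (𝕜 := ℝ)).eventually_le_const (half_pos hγ0)
  filter_upwards [eventually_gt_atTop 0, l2] with n hn hn2
  have hr := (h n).limitRadius_pos ⟨0, hn⟩
  have hn' : (0 : ℝ) < n := by exact_mod_cast hn
  have hsub : {w | specRadius w / limitRadius (ω n) (ν n) ≤ 1 - ε} ⊆
      {w | γ / 2 ≤ |linearStatistic (ω n) (ν n) g w - γ|} := by
    intro w hw
    have hw' : specRadius w / limitRadius (ω n) (ν n) ≤ 1 - e := by
      have : specRadius w / limitRadius (ω n) (ν n) ≤ 1 - ε := hw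
      linarith
    have e1 : ∀ l : Fin n, 0 < l.val → g ((eig w l - 1) / limitRadius (ω n) (ν n)) = 0 := by
      intro l hl
      refine hgz _ (le_trans ?_ hw')
      rw [abs_div, abs_of_pos hr, abs_sub_comm]
      exact div_le_div_of_nonneg_right (abs_one_sub_eig_le_specRadius w hl) hr.le
    -- Only the trivial eigenvalue can contribute, and it contributes at most 1/n.
    have e2 : linearStatistic (ω n) (ν n) g w ≤ γ / 2 := by
      rw [linearStatistic, ← sum_filter_pos_add hn, Finset.sum_eq_zero
        fun l hl => e1 l (Finset.mem_filter.1 hl).2, zero_add]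
      refine le_trans (mul_le_of_le_one_right (by positivity) ?_) hn2
      exact (le_abs_self _).trans (hg1 _)
    change γ / 2 ≤ |linearStatistic (ω n) (ν n) g w - γ|
    rw [abs_sub_comm]
    exact le_trans (by linarith) (le_abs_self _)
  refine (measureReal_mono hsub (measure_ne_top _ _)).trans ?_
  rw [← div_eq_inv_mul, le_div_iff₀' (half_pos hγ0)]
  exact mul_meas_ge_le_integral_of_nonneg (Eventually.of_forall fun w => abs_nonneg _)
    (((h n).integrable_linearStatistic hgc hg1).sub (integrable_const γ)).abs _

theorem exp_neg_two_mul_log {x : ℝ} (hx : 0 < x) : x * Real.exp (-(2 * Real.log x)) = x⁻¹ := by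
  rw [two_mul, neg_add, Real.exp_add, Real.exp_neg, Real.exp_log hx]
  field_simp

/-- Since ω_min / E[W] ≤ ω_avg / E[W²], the growth hypothesis gives (log n)^6 ≤ C E[W] ω_min. For
large n the exponent is then at least 2 log n, which beats the factor n of the union bound. -/
theorem IsModel.mul_exp_le_inv [IsProbabilityMeasure ν] (h : IsModel ω ν) (hn : 0 < n) {C τ : ℝ}
    (hC : 0 < C) (hτ : 0 < τ)
    (hln : Real.log n ^ 6 * (avg ω / moment ν 2) ≤ C * wmin ω ^ 2) (h1 : 1 ≤ Real.log n)
    (h2 : 8 * C / τ ^ 2 ≤ Real.log n) :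
    n * Real.exp (-(moment ν 1 * wmin ω * τ ^ 2 / 4)) ≤ (n : ℝ)⁻¹ := by
  have hn' : (0 : ℝ) < n := by exact_mod_cast hn
  rw [← exp_neg_two_mul_log hn']
  generalize Real.log n = ℓ at *
  have hℓ0 : 0 < ℓ := by linarith
  have m1 := h.moment_pos 1
  have m2 := h.moment_pos 2
  have hw := h.wmin_pos ⟨0, hn⟩
  have ha := h.avg_pos ⟨0, hn⟩
  have e1 : ℓ ^ 6 ≤ C * (moment ν 1 * wmin ω) := by
    have e2 : wmin ω / moment ν 1 ≤ avg ω / moment ν 2 :=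
      div_le_div₀ ha.le (wmin_le_avg _ ⟨0, hn⟩) m2 h.moment_two_le
    have e3 : ℓ ^ 6 * (wmin ω / moment ν 1) ≤ C * wmin ω ^ 2 :=
      (mul_le_mul_of_nonneg_left e2 (by positivity)).trans hln
    rw [← mul_div_assoc, div_le_iff₀ m1] at e3
    refine le_of_mul_le_mul_right (e3.trans (le_of_eq ?_)) hw
    ring
  have e4 : 8 * C ≤ ℓ * τ ^ 2 := (div_le_iff₀ (by positivity)).1 h2
  have e5 : ℓ ^ 2 ≤ ℓ ^ 6 := pow_le_pow_right₀ h1 (by norm_num)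
  have e6 : 2 * ℓ ≤ moment ν 1 * wmin ω * τ ^ 2 / 4 := by
    refine le_of_mul_le_mul_left ?_ hC
    have e7 : ℓ ^ 2 * τ ^ 2 ≤ C * (moment ν 1 * wmin ω) * τ ^ 2 :=
      mul_le_mul_of_nonneg_right (e5.trans e1) (by positivity)
    have e8 := mul_le_mul_of_nonneg_left e4 hℓ0.le
    linarith
  gcongr

/-- The growth hypothesis says (log n)³ √κ ≤ √C, and k is of order log n, so the correction of order
k² √κ is O(1/log n) and falls below e/4. The base is then a fixed number below 1, and k is long
enough to make its k-th power at most n⁻². -/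
theorem IsModel.mul_pow_le_inv [IsProbabilityMeasure ν] (h : IsModel ω ν) (hn : 0 < n)
    {C e s L : ℝ} (he : 0 < e) (hs : 0 < s) (hL : 0 < L)
    (hLθ : L * Real.log ((2 + e / 4) / s) = -1) (hθ : (2 + e / 4) / s < 1)
    (hln : Real.log n ^ 6 * (avg ω / moment ν 2) ≤ C * wmin ω ^ 2) (h1 : 1 ≤ Real.log n)
    (h3 : 4 * ((2 * L + 4) ^ 2 * √C) / e ≤ Real.log n) {k : ℕ} (hk1 : 2 * (L * Real.log n) ≤ k)
    (hk2 : (k : ℝ) + 2 ≤ (2 * L + 4) * Real.log n) :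
    n * ((2 + (k + 1) * √(sparsity ω ν) * (k + 2)) / s) ^ k ≤ (n : ℝ)⁻¹ := by
  have hn' : (0 : ℝ) < n := by exact_mod_cast hn
  rw [← exp_neg_two_mul_log hn']
  generalize Real.log n = ℓ at *
  have hℓ0 : 0 < ℓ := by linarith
  have m2 := h.moment_pos 2
  have hw := h.wmin_pos ⟨0, hn⟩
  have hθ0 : 0 < (2 + e / 4) / s := by positivity
  have hθlog := (Real.log_neg hθ0 hθ).le
  have e1 : ℓ ^ 3 * √(sparsity ω ν) ≤ √C := by
    refine Real.le_sqrt_of_sq_le ?_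
    rw [mul_pow, Real.sq_sqrt (h.sparsity_pos ⟨0, hn⟩).le, sparsity, ← pow_mul]
    rw [← mul_div_assoc, div_le_iff₀ (by positivity)] at hln ⊢
    norm_num
    linarith
  have e2 : 4 * ((2 * L + 4) ^ 2 * √C) ≤ ℓ * e := (div_le_iff₀ he).1 h3
  have e3 : (k + 1) * √(sparsity ω ν) * (k + 2) ≤ e / 4 := by
    have e4 : (k + 1) * √(sparsity ω ν) * (k + 2) ≤
        ((2 * L + 4) * ℓ) * √(sparsity ω ν) * ((2 * L + 4) * ℓ) := by
      gcongr
      linarith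
    refine e4.trans (le_of_mul_le_mul_left ?_ hℓ0)
    calc ℓ * ((2 * L + 4) * ℓ * √(sparsity ω ν) * ((2 * L + 4) * ℓ))
        = (2 * L + 4) ^ 2 * (ℓ ^ 3 * √(sparsity ω ν)) := by ring
      _ ≤ (2 * L + 4) ^ 2 * √C := by gcongr
      _ ≤ ℓ * (e / 4) := by linarith
  have e5 : (2 + (k + 1) * √(sparsity ω ν) * (k + 2)) / s ≤ (2 + e / 4) / s := by
    gcongr
  have e6 : ((2 + e / 4) / s) ^ k ≤ Real.exp (-(2 * ℓ)) := by
    rw [← Real.exp_log (pow_pos hθ0 k), Real.log_pow]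
    refine Real.exp_le_exp.2 ((mul_le_mul_of_nonpos_right hk1 hθlog).trans (le_of_eq ?_))
    calc 2 * (L * ℓ) * Real.log ((2 + e / 4) / s) =
          2 * ℓ * (L * Real.log ((2 + e / 4) / s)) := by ring
      _ = _ := by rw [hLθ]; ring
  exact mul_le_mul_of_nonneg_left ((pow_le_pow_left₀ (by positivity) e5 k).trans e6) hn'.le

/-- The degree term contributes 2/n and the trace term 1/n, so the probability is eventually at most
3/n. -/
theorem tendsto_measureReal_le_specRadius
    {ω : (n : ℕ) → Fin n → ℝ} {ν : ℕ → Measure ℝ} [∀ n, IsProbabilityMeasure (ν n)]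
    (h : ∀ n, IsModel (ω n) (ν n)) {C : ℝ} (hC : 0 < C)
    (hlog : ∀ᶠ n : ℕ in atTop, Real.log n ^ 6 * (avg (ω n) / moment (ν n) 2) ≤
      C * wmin (ω n) ^ 2) {ε : ℝ} (hε : 0 < ε) :
    Tendsto (fun n => (networkLaw (ω n) (ν n)).real
      {w | 1 + ε ≤ specRadius w / limitRadius (ω n) (ν n)}) atTop (𝓝 0) := by
  have hP := fun n => (h n).isProbabilityMeasure_networkLaw
  set e := min ε 1 with he
  have he0 : 0 < e := lt_min hε one_pos
  have he1 : e ≤ 1 := min_le_right _ _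
  have heε : e ≤ ε := min_le_left _ _
  -- The margins are split so that (1 + τ)² (s/2) stays below 1 + e, while s still exceeds 2 + e/4,
  -- the base of the trace bound.
  set τ := e / 8 with hτ
  set s := 2 * (1 + e / 4) with hsdef
  have hs0 : 0 < s := by positivity
  have hτ0 : 0 < τ := by positivity
  have hprod : (1 + τ) ^ 2 * (s / 2) < 1 + e := by
    rw [hτ, hsdef]
    nlinarith [mul_pos he0 he0, mul_le_mul he1 he1 he0.le zero_le_one]
  set θ := (2 + e / 4) / s with hθ
  have hθ0 : 0 < θ := by positivity
  have hθ1 : θ < 1 := by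
    rw [hθ, div_lt_one hs0, hsdef]
    linarith
  have hθlog : Real.log θ < 0 := Real.log_neg hθ0 hθ1
  set L := (-Real.log θ)⁻¹ with hL
  have hL0 : 0 < L := inv_pos.2 (neg_pos.2 hθlog)
  have hLθ : L * Real.log θ = -1 := by
    rw [hL]
    have := hθlog.ne
    field_simp
  have hlogtop : Tendsto (fun n : ℕ => Real.log n) atTop atTop :=
    Real.tendsto_log_atTop.comp tendsto_natCast_atTop_atTop
  have l1 := (tendsto_inv_atTop_nhds_zero_nat (𝕜 := ℝ)).const_mul 3
  rw [mul_zero] at l1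
  refine squeeze_zero' (Eventually.of_forall fun n => measureReal_nonneg) ?_ l1
  filter_upwards [eventually_gt_atTop 0, hlog, hlogtop.eventually_ge_atTop 1,
    hlogtop.eventually_ge_atTop (8 * C / τ ^ 2),
    hlogtop.eventually_ge_atTop (4 * ((2 * L + 4) ^ 2 * √C) / e)] with n hn hln h1 h2 h3
  have hn' : (0 : ℝ) < n := by exact_mod_cast hn
  have hr := (h n).limitRadius_pos ⟨0, hn⟩
  set ℓ := Real.log n with hℓ
  have hℓ0 : 0 < ℓ := by linarith
  -- An even exponent, with L = 1 / |log θ| so that θ^k ≤ n⁻².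
  set k := 2 * ⌈L * ℓ⌉₊ with hk
  have hk1 : 2 * (L * ℓ) ≤ k := by
    have := Nat.le_ceil (L * ℓ)
    rw [hk]
    push_cast
    linarith
  have hk2 : (k : ℝ) + 2 ≤ (2 * L + 4) * ℓ := by
    have := (Nat.ceil_lt_add_one (by positivity : 0 ≤ L * ℓ)).le
    rw [hk]
    push_cast
    nlinarith
  have hk0 : k ≠ 0 := by
    intro hk0
    rw [hk0, Nat.cast_zero] at hk1
    have : 0 < L * ℓ := by positivity
    linarith
  have hsub : {w : Sym2 (Fin n) → ℝ | 1 + ε ≤ specRadius w / limitRadius (ω n) (ν n)} ⊆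
      {w | limitRadius (ω n) (ν n) * ((1 + τ) ^ 2 * (s / 2)) < specRadius w} := by
    intro w hw
    have e1 : (1 + ε) * limitRadius (ω n) (ν n) ≤ specRadius w := (le_div_iff₀ hr).1 hw
    change limitRadius (ω n) (ν n) * ((1 + τ) ^ 2 * (s / 2)) < specRadius w
    nlinarith
  refine (measureReal_mono hsub (measure_ne_top _ _)).trans
    (((h n).measureReal_specRadius_le hn ⟨⌈L * ℓ⌉₊, by rw [hk, two_mul]⟩ hk0 hτ0
      (by rw [hτ]; linarith) hs0).trans ?_)
  have t1 := (h n).mul_exp_le_inv hn hC hτ0 hln h1 h2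
  have t2 := (h n).mul_pow_le_inv hn he0 hs0 hL0 hLθ hθ1 hln h1 h3 hk1 hk2
  linarith

end WeightedChungLu
-- The two assertions combined
theorem mainTheorem1
    (ω : (n : ℕ) → Fin n → ℝ) (ν : ℕ → Measure ℝ) [∀ n, IsProbabilityMeasure (ν n)]
    (ω_pos : ∀ n i, 0 < ω n i)
    (ω_max : ∀ n, WeightedChungLu.wmax (ω n) ^ 2 ≤ 1 / WeightedChungLu.rho (ω n))
    (weight_mem : ∀ n, ∀ᵐ x ∂(ν n), 0 < x ∧ x ≤ 1)
    (ω_min : Tendsto (fun n => WeightedChungLu.wmin (ω n)) atTop atTop)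
    (sparse : (fun n => WeightedChungLu.avg (ω n)) =o[atTop] fun n => (n : ℝ))
    (degree : (fun n => WeightedChungLu.avg (ω n) / WeightedChungLu.moment (ν n) 2)
      =o[atTop] fun n => WeightedChungLu.wmin (ω n) ^ 2) :
    (∀ g : BoundedContinuousFunction ℝ ℝ,
      Tendsto
        (fun n => ∫ x, g x ∂((WeightedChungLu.eigenvalueLaw (ω n) (ν n)).map
          fun x => (x - 1) / WeightedChungLu.limitRadius (ω n) (ν n)))
        atTop (𝓝 (∫ x, g x ∂(WeightedChungLu.semicircleLaw 0 1)))) ∧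
    ((fun n : ℕ => Real.log n ^ 6 *
        (WeightedChungLu.avg (ω n) / WeightedChungLu.moment (ν n) 2))
        =O[atTop] (fun n => WeightedChungLu.wmin (ω n) ^ 2) →
      ∀ ε : ℝ, 0 < ε →
        Tendsto
          (fun n => WeightedChungLu.networkLaw (ω n) (ν n)
            {w | ε ≤ |WeightedChungLu.specRadius w /
              WeightedChungLu.limitRadius (ω n) (ν n) - 1|})
          atTop (𝓝 0)) := by
  have h : ∀ n, WeightedChungLu.IsModel (ω n) (ν n) := fun n =>
    ⟨ω_pos n, ω_max n, weight_mem n⟩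
  have hκ : Tendsto (fun n => WeightedChungLu.sparsity (ω n) (ν n)) atTop (𝓝 0) := by
    refine degree.tendsto_div_nhds_zero.congr fun n => ?_
    rw [WeightedChungLu.sparsity, div_div]
  have hs : Tendsto (fun n : ℕ => WeightedChungLu.avg (ω n) / n) atTop (𝓝 0) :=
    sparse.tendsto_div_nhds_zero
  refine ⟨WeightedChungLu.tendsto_integral_map_eigenvalueLaw h hκ hs, fun hlog ε hε => ?_⟩
  have hP := fun n => (h n).isProbabilityMeasure_networkLaw
  obtain ⟨C, hC, hb⟩ := hlog.exists_pos
  have hlog' : ∀ᶠ n : ℕ in atTop, Real.log n ^ 6 *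
      (WeightedChungLu.avg (ω n) / WeightedChungLu.moment (ν n) 2) ≤
        C * WeightedChungLu.wmin (ω n) ^ 2 := by
    filter_upwards [hb.bound] with n hn
    rw [Real.norm_of_nonneg (sq_nonneg (WeightedChungLu.wmin (ω n)))] at hn
    exact (Real.le_norm_self _).trans hn
  have l := (WeightedChungLu.tendsto_measureReal_specRadius_le h hκ hs hε).add
    (WeightedChungLu.tendsto_measureReal_le_specRadius h hC hlog' hε)
  rw [add_zero] at l
  refine (ENNReal.tendsto_toReal_iff (fun n => measure_ne_top _ _) ENNReal.zero_ne_top).1 ?_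
  rw [ENNReal.toReal_zero]
  refine squeeze_zero (fun n => ENNReal.toReal_nonneg) (fun n => ?_) l
  refine (measureReal_mono ?_ (measure_ne_top _ _)).trans (measureReal_union_le _ _)
  intro w hw
  rcases le_abs.1 (show ε ≤ |_| from hw) with hw | hw
  · right
    change 1 + ε ≤ _
    linarith
  · left
    change _ ≤ 1 - ε
    linarith
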